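/- **Setting.** A Datalog program $P$ has EDB and IDB predicate symbols with fixed arities, a designated target IDB, and for each IDB $T$ one rule $T(\mathbf x_H)\leftarrow\varphi_1\oplus\varphi_2\oplus\cdots$, whose body is a sum of sum-product queries $$\varphi(\mathbf x_H)=\bigoplus_{\mathbf x_{[\ell]\setminus H}}\ \bigotimes_{J\in\mathcal E}T_J(\mathbf x_J),$$ where each $T_J$ is an EDB or IDB predicate, $H$ is the set of head variables, and $([\ell],\mathcal E)$ is the hypergraph of $\varphi$. The arity of $P$ is the maximal arity of an IDB. A *tree decomposition* of $\varphi$ is a tree $\mathcal T$ with bags $\chi(t)\subseteq[\ell]$ such that every $J\in\mathcal E$ is contained in a bag and, for every $i\in[\ell]$, the nodes whose bags contain $i$ form a non-empty subtree. It is a *join tree* if every bag belongs to $\mathcal E$. It is *free-connex* if for some root $r$ there are no $x\in H$, $y\in[\ell]\setminus H$ such that $\mathrm{TOP}_r(y)$ is a proper ancestor of $\mathrm{TOP}_r(x)$, where $\mathrm{TOP}_r(z)$ is the node closest to $r$ whose bag contains $z$. $P$ is *rulewise free-connex acyclic* if every sum-product query in every rule has a free-connex join tree. "Semiring" means a naturally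 ordered commutative semiring $\sigma=(D,\oplus,\otimes,\mathbf 0,\mathbf 1)$ that is $\omega$-complete and $\omega$-continuous, with $x\sqsubseteq y\iff\exists z\; x\oplus z=y$. For an EDB instance $I$ (a finite table of tuples for each EDB), $m$ is the total number of tuples and $n$ is the number of distinct constants. When the tuples of $I$ are annotated by elements of $\sigma$ (tuples outside the tables have value $\mathbf 0$), the semantics of $P$ is the least fixpoint of its immediate consequence operator, the variables ranging over the active domain. A *grounding* is a system of polynomial equations, with one equation for each variable (variables without a written equation being $\mathbf 0$), whose coefficients are grounded EDB atoms and whose variables are grounded IDB atoms, possibly of new IDB predicates. Its size is the total number of occurrences of coefficients and variables. It is *$\sigma$-equivalent* to $P$ on $I$ if, for every annotation of the tuples of $I$ by elements of $\sigma$, the least fixpoints of both exist and agree on all grounded atoms of the target. The machine model is a unit-cost word RAM with $O(\log m)$-bit words; each constant fits in $O(\log m)$ bits. **Proposition.** Let $P$ be a rulewise free-connex acyclic Datalog program of arity at most $k$. Then there are a word-RAM program $M$ and a constant $C$, both depending only on $P$ and $k$, such that for every $d$ there is a $b$ with the following property. For every EDB instance $I$ with input size $m$ and active domain size $n$ whose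 constants are natural numbers less than $(m+2)^d$, the program $M$, started on the list of the tables of $I$, halts after at most $C\,(m+n^k+1)$ steps, all machine words being smaller than $(m+2)^b$ throughout, and outputs a grounding $G$ of size at most $C\,(m+n^k+1)$ that is $\sigma$-equivalent to $P$ on $I$ for every semiring $\sigma$. In short, over any semiring a $\sigma$-equivalent grounding can be constructed in time, and has size, $O(m+n^k)$. -/

import Mathlib

namespace Datalog

/-! ### Syntax of programs -/

/-- The extensional (EDB) and intensional (IDB) predicate symbols, with their arities. -/
structure Schema where
  numEdb : ℕ
  edbArity : Fin numEdb → ℕ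
  numIdb : ℕ
  idbArity : Fin numIdb → ℕ

/-- An atom over the variables `x_0, …, x_{ℓ-1}`. -/
inductive Atom (S : Schema) (ℓ : ℕ) where
  | edb (R : Fin S.numEdb) (x : Fin (S.edbArity R) → Fin ℓ) : Atom S ℓ
  | idb (T : Fin S.numIdb) (x : Fin (S.idbArity T) → Fin ℓ) : Atom S ℓ

/-- The set of variables that occur in an atom. -/
def Atom.vars {S : Schema} {ℓ : ℕ} : Atom S ℓ → Finset (Fin ℓ)
  | .edb _ x => Finset.univ.image x
  | .idb _ x => Finset.univ.image x

/-- A sum-product query with head `T(x_H)`: the sum, over the variables that are not in the head,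
of the product of the atoms of the body. -/
structure SumProd (S : Schema) (T : Fin S.numIdb) where
  numVars : ℕ
  head : Fin (S.idbArity T) → Fin numVars
  body : List (Atom S numVars)

/-- The set `H` of head variables. -/
def SumProd.headVars {S : Schema} {T : Fin S.numIdb} (φ : SumProd S T) :
    Finset (Fin φ.numVars) :=
  Finset.univ.image φ.head

/-- The hyperedges of the associated hypergraph, whose vertices are all the variables. -/
def SumProd.edges {S : Schema} {T : Fin S.numIdb} (φ : SumProd S T) :
    Set (Finset (Fin φ.numVars)) :=
  {J | ∃ A ∈ φ.body, A.vars = J}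

/-- A program: for every IDB symbol one rule, whose body is a sum of sum-product queries, and a
designated target IDB symbol. -/
structure Program (S : Schema) where
  rules : (T : Fin S.numIdb) → List (SumProd S T)
  target : Fin S.numIdb

/-- The arity of a program: the largest arity of an IDB symbol. -/
def Program.arity {S : Schema} (_P : Program S) : ℕ := Finset.univ.sup S.idbArity

/-! ### Free-connex acyclicity -/

/-- A tree decomposition of a hypergraph with vertex set `Fin ℓ` and hyperedges `E`. -/
structure TreeDecomposition (ℓ : ℕ) (E : Set (Finset (Fin ℓ))) where
  numNodes : ℕ
  tree : SimpleGraph (Fin numNodes)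
  isTree : tree.IsTree
  bag : Fin numNodes → Finset (Fin ℓ)
  covers : ∀ J ∈ E, ∃ t, J ⊆ bag t
  /-- Running intersection; `Connected` contains non-emptiness. -/
  running : ∀ i : Fin ℓ, (tree.induce {t | i ∈ bag t}).Connected

namespace TreeDecomposition

variable {ℓ : ℕ} {E : Set (Finset (Fin ℓ))}

/-- A join tree is a tree decomposition all of whose bags are hyperedges. -/
def IsJoinTree (D : TreeDecomposition ℓ E) : Prop := ∀ t, D.bag t ∈ E

/-- `t` is the highest node (the one closest to the root `r`) whose bag contains `x`. -/
def IsTop (D : TreeDecomposition ℓ E) (r : Fin D.numNodes) (x : Fin ℓ) (t : Fin D.numNodes) :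
    Prop :=
  x ∈ D.bag t ∧ ∀ t', x ∈ D.bag t' → D.tree.dist r t ≤ D.tree.dist r t'

/-- `u` is a (proper) ancestor of `v` in the tree rooted at `r`: it is another node on the path
from `r` to `v`. -/
def IsAncestor (D : TreeDecomposition ℓ E) (r u v : Fin D.numNodes) : Prop :=
  u ≠ v ∧ ∃ p : D.tree.Walk r v, p.IsPath ∧ u ∈ p.support

/-- Free-connexity with respect to the root `r`, for the set `H` of head variables. -/
def FreeConnexAt (D : TreeDecomposition ℓ E) (H : Finset (Fin ℓ)) (r : Fin D.numNodes) : Prop :=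
  ∀ x ∈ H, ∀ y ∉ H, ∀ tx ty, D.IsTop r x tx → D.IsTop r y ty → ¬ D.IsAncestor r ty tx

end TreeDecomposition

/-- The query is acyclic and has a free-connex join tree. -/
def SumProd.FreeConnexAcyclic {S : Schema} {T : Fin S.numIdb} (φ : SumProd S T) : Prop :=
  ∃ D : TreeDecomposition φ.numVars φ.edges,
    D.IsJoinTree ∧ ∃ r, D.FreeConnexAt φ.headVars r

/-- Every sum-product query of every rule has a free-connex join tree. -/
def Program.RulewiseFreeConnexAcyclic {S : Schema} (P : Program S) : Prop :=
  ∀ T, ∀ φ ∈ P.rules T, φ.FreeConnexAcyclic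

/-! ### Instances and least fixpoint semantics -/

/-- The tuples of an EDB instance, each EDB relation given as a table without repetitions.
Constants are natural numbers. The annotations are kept apart, see `Instance.value`. -/
structure Instance (S : Schema) where
  table : (R : Fin S.numEdb) → List (Fin (S.edbArity R) → ℕ)
  nodup : ∀ R, (table R).Nodup

namespace Instance

variable {S : Schema} (I : Instance S)

/-- The input size `m`: the sum of the sizes of the EDB relations. -/
def size : ℕ := ∑ R, (I.table R).length

/-- The active domain: the constants that occur in the instance. -/
def adom : Finset ℕ :=
  Finset.univ.biUnion fun R => (I.table R).toFinset.biUnion fun c => Finset.univ.image c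

/-- The `σ`-relation given by annotating the tuples of the instance: tuples that are not in the
table have value `0`. -/
def value {σ : Type*} [Zero σ] (ann : (R : Fin S.numEdb) → (Fin (S.edbArity R) → ℕ) → σ)
    (R : Fin S.numEdb) (c : Fin (S.edbArity R) → ℕ) : σ :=
  if c ∈ I.table R then ann R c else 0

/-- The instance as a sequence of machine words: for each EDB relation the number of its tuples,
followed by the tuples. -/
def encode : List ℕ :=
  (List.finRange S.numEdb).flatMap fun R =>
    (I.table R).length :: (I.table R).flatMap fun c => List.ofFn c

end Instance

/-- The value of an atom under an assignment of constants to the variables, for given values of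
the EDB and IDB relations. -/
def Atom.eval {S : Schema} {ℓ : ℕ} {σ : Type*}
    (e : (R : Fin S.numEdb) → (Fin (S.edbArity R) → ℕ) → σ)
    (h : (T : Fin S.numIdb) → (Fin (S.idbArity T) → ℕ) → σ) (v : Fin ℓ → ℕ) : Atom S ℓ → σ
  | .edb R x => e R (v ∘ x)
  | .idb T x => h T (v ∘ x)

/-- The value of a sum-product query at a tuple `c`: the sum over all assignments of constants of
the active domain to the variables that send the head to `c`. -/
def SumProd.eval {S : Schema} {T : Fin S.numIdb} {σ : Type*} [CommSemiring σ] (φ : SumProd S T)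
    (I : Instance S) (ann : (R : Fin S.numEdb) → (Fin (S.edbArity R) → ℕ) → σ)
    (h : (T : Fin S.numIdb) → (Fin (S.idbArity T) → ℕ) → σ) (c : Fin (S.idbArity T) → ℕ) : σ :=
  ∑ v ∈ (Fintype.piFinset fun _ : Fin φ.numVars => I.adom) with v ∘ φ.head = c,
    (φ.body.map fun A => A.eval (I.value ann) h v).prod

/-- The immediate consequence operator of a program on an annotated instance. -/
def Program.ico {S : Schema} {σ : Type*} [CommSemiring σ] (P : Program S) (I : Instance S)
    (ann : (R : Fin S.numEdb) → (Fin (S.edbArity R) → ℕ) → σ)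
    (h : (T : Fin S.numIdb) → (Fin (S.idbArity T) → ℕ) → σ) :
    (T : Fin S.numIdb) → (Fin (S.idbArity T) → ℕ) → σ :=
  fun T c => ((P.rules T).map fun φ => φ.eval I ann h c).sum

/-! ### Groundings -/

/-- A variable of a grounding: a grounded IDB atom, that is, a predicate name and a tuple of
constants. New predicate names may be introduced. -/
abbrev GroundVar : Type := ℕ × List ℕ

/-- A coefficient of a grounding: a grounded EDB atom. -/
abbrev GroundCoeff (S : Schema) : Type := (R : Fin S.numEdb) × (Fin (S.edbArity R) → ℕ)

/-- A monomial: a product of coefficients and variables. -/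
abbrev Monomial (S : Schema) : Type := List (GroundCoeff S ⊕ GroundVar)

/-- A grounding: a system of polynomial equations, each a variable and the list of monomials whose
sum is its right-hand side, with one equation at most for each variable. A variable without an
equation has the equation `x = 0`. -/
structure Grounding (S : Schema) where
  eqs : List (GroundVar × List (Monomial S))
  distinct : (eqs.map Prod.fst).Nodup

namespace Grounding

variable {S : Schema} (G : Grounding S)

/-- The total number of (occurrences of) coefficients and variables, on both sides. -/
def size : ℕ := (G.eqs.map fun q => 1 + (q.2.map List.length).sum).sum

/-- The immediate consequence operator: it evaluates all right-hand sides. -/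
def ico {σ : Type*} [CommSemiring σ] (e : (R : Fin S.numEdb) → (Fin (S.edbArity R) → ℕ) → σ)
    (h : GroundVar → σ) : GroundVar → σ := fun x =>
  ((G.eqs.filter fun q => q.1 = x).map fun q =>
    (q.2.map fun w => (w.map fun f => Sum.elim (fun a => e a.1 a.2) h f).prod).sum).sum

/-- The words that describe a variable. -/
def encodeVar (x : GroundVar) : List ℕ := x.1 :: x.2.length :: x.2

/-- The words that describe a factor of a monomial. -/
def encodeFactor : GroundCoeff S ⊕ GroundVar → List ℕ
  | .inl a => 0 :: a.1.val :: List.ofFn a.2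
  | .inr x => 1 :: encodeVar x

/-- The words that describe a monomial: the number of factors, and the factors. -/
def encodeMonomial (w : Monomial S) : List ℕ := w.length :: w.flatMap encodeFactor

/-- The system as a sequence of machine words: for each equation its variable, the number of its
monomials, and the monomials. -/
def encode : List ℕ :=
  G.eqs.flatMap fun q => encodeVar q.1 ++ q.2.length :: q.2.flatMap encodeMonomial

end Grounding

/-- A grounding is `σ`-equivalent to a program on an instance if, for every annotation of the
instance by elements of `σ`, the least fixpoints of both exist and their targets are the same
`σ`-relation. -/
def SigmaEquivalent {S : Schema} (P : Program S) (I : Instance S) (G : Grounding S)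
    (σ : Type*) [CommSemiring σ] [Preorder σ] : Prop :=
  ∀ ann : (R : Fin S.numEdb) → (Fin (S.edbArity R) → ℕ) → σ,
    ∃ (hP : (T : Fin S.numIdb) → (Fin (S.idbArity T) → ℕ) → σ) (hG : GroundVar → σ),
      IsLeast (Function.fixedPoints (P.ico I ann)) hP ∧
      IsLeast (Function.fixedPoints (G.ico (I.value ann))) hG ∧
      ∀ c, hP P.target c = hG (P.target.val, List.ofFn c)

/-! ### The word RAM -/

namespace RAM

/-- Instructions of a word RAM. Registers are named by fixed numbers; the memory is an array of
words that `load` and `store` address through a register. Subtraction is truncated at `0`, and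
division by `0` gives `0`. -/
inductive Instr where
  | const (dst n : ℕ)
  | add (dst a b : ℕ)
  | sub (dst a b : ℕ)
  | mul (dst a b : ℕ)
  | div (dst a b : ℕ)
  | mod (dst a b : ℕ)
  | load (dst a : ℕ)
  | store (a b : ℕ)
  | jmp (l : ℕ)
  | jz (a l : ℕ)
  | write (a : ℕ)

/-- A configuration: program counter, registers, memory, and the words written to the output. -/
structure Config where
  pc : ℕ
  reg : ℕ → ℕ
  mem : ℕ → ℕ
  out : List ℕ

/-- Put a word in a register and go to the next instruction. -/
def Config.set (s : Config) (dst x : ℕ) : Config :=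
  { s with pc := s.pc + 1, reg := Function.update s.reg dst x }

/-- The effect of an instruction. -/
def Instr.exec (s : Config) : Instr → Config
  | .const dst n => s.set dst n
  | .add dst a b => s.set dst (s.reg a + s.reg b)
  | .sub dst a b => s.set dst (s.reg a - s.reg b)
  | .mul dst a b => s.set dst (s.reg a * s.reg b)
  | .div dst a b => s.set dst (s.reg a / s.reg b)
  | .mod dst a b => s.set dst (s.reg a % s.reg b)
  | .load dst a => s.set dst (s.mem (s.reg a))
  | .store a b => { s with pc := s.pc + 1, mem := Function.update s.mem (s.reg a) (s.reg b) }
  | .jmp l => { s with pc := l }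
  | .jz a l => { s with pc := if s.reg a = 0 then l else s.pc + 1 }
  | .write a => { s with pc := s.pc + 1, out := s.out ++ [s.reg a] }

/-- One step; a configuration whose program counter has left the program has halted. -/
def step (M : List Instr) (s : Config) : Config :=
  match M[s.pc]? with
  | none => s
  | some i => i.exec s

/-- The initial configuration: the input is in the memory from address `0` on, and everything else
is `0`. -/
def init (input : List ℕ) : Config :=
  { pc := 0, reg := fun _ => 0, mem := fun i => input.getD i 0, out := [] }

/-- The configuration after `t` steps. -/
def run (M : List Instr) (input : List ℕ) (t : ℕ) : Config := (step M)^[t] (init input)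

/-- On the given input, `M` halts after at most `time` steps with the given output, and in the
whole run each register and each memory cell holds a word smaller than `bound`. -/
def Computes (M : List Instr) (input output : List ℕ) (time bound : ℕ) : Prop :=
  ∃ t ≤ time, M.length ≤ (run M input t).pc ∧ (run M input t).out = output ∧
    ∀ s ≤ t, ∀ a, (run M input s).reg a < bound ∧ (run M input s).mem a < bound

end RAM

end Datalog

/-! Each sum-product query is evaluated bottom-up along its free-connex join tree. A node multiplies
the atoms assigned to it and the messages of its children, and sums out the non-head variables whose
highest occurrence is at that node. Suppose the remaining variables include a non-head variable. Its
top is then a proper ancestor, so by free-connexity no head variable has its top at this node. All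
remaining variables therefore occur in the parent's bag, and the message can be sent there.
Otherwise only head variables remain, and the message is a factor of the head.
`SumProd.FreeConnexAcyclic.nonempty_plan` extracts such an elimination order, and `Plan.eliminate`
proves by distributivity that it preserves the value of the query.

Every bag is the variable set of an atom of the query. It is therefore enough to let a step range
over the tuples that this guard atom can match: at most `m` for an EDB atom and `n ^ a` with `a ≤ k`
for an IDB atom. The heads contribute at most `n ^ k` tuples each, up to the degenerate case that
the summand `1` covers. Each tuple yields one equation of constant size, so the grounding has size
`O(m + n ^ k)`.

Grouping the tuples by the kept variables takes neither sorting nor hashing. Each step maintains an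
array, indexed by the number of the key, that contains the last tuple seen with this key. The
equation of a tuple adds its term to the partial sum of that earlier tuple, so the message at a key
is the partial sum that the array finally refers to (`Layout.message_eq`). The memory starts with
zeros, hence an entry `0` means that there is no such tuple, and the corresponding variable has no
equation and thus the value `0`. Repeated variables in an atom are treated without branching: each
monomial has a flag variable of value `1` or `0` as a factor.

For equivalence, every solution of the equations for the new variables turns the equations of the
original atoms into the operator of the program (`Program.ico_layout`). The least fixpoint of the
program thus extends to a fixpoint of the grounding, and the least fixpoint of the grounding
restricts to one of the program, so the two agree (`sigmaEquivalent_of_ico_eq`).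

The algorithm is a sequence of unnested counting loops with straight-line bodies. These are compiled
to the word RAM once and for all, so that its correctness reduces to loop invariants. The size of
the grounding is at most the length of the output, which is at most the running time. -/

namespace Datalog.RAM

/-! ### Runs with bounded words -/

/-- All words of a configuration are smaller than `B`. -/
def Config.Below (B : ℕ) (s : Config) : Prop := ∀ a, s.reg a < B ∧ s.mem a < B

/-- `M` leads from `s` to `s'` in `t` steps, through configurations with words smaller than `B`. -/
def Reaches (M : List Instr) (B : ℕ) (s s' : Config) (t : ℕ) : Prop :=
  (step M)^[t] s = s' ∧ ∀ j ≤ t, ((step M)^[j] s).Below B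

theorem Reaches.refl {M : List Instr} {B : ℕ} {s : Config} (h : s.Below B) :
    Reaches M B s s 0 :=
  ⟨rfl, fun j hj => by obtain rfl : j = 0 := by omega
                       exact h⟩

theorem Reaches.below {M : List Instr} {B : ℕ} {s s' : Config} {t : ℕ}
    (h : Reaches M B s s' t) : s'.Below B := h.1 ▸ h.2 t le_rfl

theorem Reaches.trans {M : List Instr} {B : ℕ} {s s' s'' : Config} {t t' : ℕ}
    (h : Reaches M B s s' t) (h' : Reaches M B s' s'' t') : Reaches M B s s'' (t + t') := by
  obtain ⟨rfl, h2⟩ := h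
  obtain ⟨rfl, h2'⟩ := h'
  refine ⟨by rw [add_comm, Function.iterate_add_apply], fun j hj => ?_⟩
  rcases le_total j t with hjt | hjt
  · exact h2 j hjt
  · obtain ⟨i, rfl⟩ := Nat.exists_eq_add_of_le hjt
    have := h2' i (by omega)
    rwa [← Function.iterate_add_apply, add_comm] at this

/-- The instructions `c` stand in the program `M` from position `pc` on. -/
def CodeAt (M : List Instr) (pc : ℕ) (c : List Instr) : Prop :=
  ∃ u v, M = u ++ c ++ v ∧ u.length = pc

theorem CodeAt.left {M : List Instr} {pc : ℕ} {c c' : List Instr} (h : CodeAt M pc (c ++ c')) :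
    CodeAt M pc c := by
  obtain ⟨u, v, rfl, rfl⟩ := h
  exact ⟨u, c' ++ v, by simp, rfl⟩

theorem CodeAt.right {M : List Instr} {pc : ℕ} {c c' : List Instr} (h : CodeAt M pc (c ++ c')) :
    CodeAt M (pc + c.length) c' := by
  obtain ⟨u, v, rfl, rfl⟩ := h
  exact ⟨u ++ c, v, by simp, by simp⟩

theorem CodeAt.get {M : List Instr} {pc : ℕ} {i : Instr} {c : List Instr}
    (h : CodeAt M pc (i :: c)) : M[pc]? = some i := by
  obtain ⟨u, v, rfl, rfl⟩ := h
  simp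

theorem CodeAt.tail {M : List Instr} {pc : ℕ} {i : Instr} {c : List Instr}
    (h : CodeAt M pc (i :: c)) : CodeAt M (pc + 1) c :=
  CodeAt.right (c := [i]) h

theorem Reaches.single {M : List Instr} {B : ℕ} {s : Config} {i : Instr} (hi : M[s.pc]? = some i)
    (h : s.Below B) (h' : (i.exec s).Below B) : Reaches M B s (i.exec s) 1 := by
  have hs : step M s = i.exec s := by simp [step, hi]
  refine ⟨by simpa using hs, fun j hj => ?_⟩
  obtain rfl | rfl : j = 0 ∨ j = 1 := by omega
  · exact h
  · simpa [hs] using h'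

theorem Config.Below.set {B : ℕ} {s : Config} (h : s.Below B) {dst x : ℕ} (hx : x < B) :
    (s.set dst x).Below B := by
  intro a
  refine ⟨?_, (h a).2⟩
  by_cases ha : a = dst
  · subst ha; simpa [Config.set] using hx
  · simpa [Config.set, Function.update_of_ne ha] using (h a).1

theorem Config.Below.of_eq {B : ℕ} {s s' : Config} (h : s.Below B) (hr : s'.reg = s.reg)
    (hm : s'.mem = s.mem) : s'.Below B := by
  intro a; rw [hr, hm]; exact h a

theorem Reaches.set {M : List Instr} {B : ℕ} {s : Config} {i : Instr} {dst x : ℕ}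
    (hi : M[s.pc]? = some i) (he : i.exec s = s.set dst x) (h : s.Below B) (hx : x < B) :
    Reaches M B s (s.set dst x) 1 :=
  he ▸ Reaches.single hi h (he ▸ h.set hx)

/-! ### Expressions -/

/-- The state of a structured program: variables, memory and output. -/
structure Store where
  var : ℕ → ℕ
  mem : ℕ → ℕ
  out : List ℕ

/-- All words of a store are smaller than `B`. -/
def Store.Below (B : ℕ) (h : Store) : Prop := ∀ a, h.var a < B ∧ h.mem a < B

/-- The variables of a structured program live in the even registers. -/
def Config.store (s : Config) : Store := ⟨fun x => s.reg (2 * x), s.mem, s.out⟩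

/-- Binary operations. -/
inductive BinOp where
  | add | sub | mul | div | mod

/-- The value of a binary operation. -/
def BinOp.eval : BinOp → ℕ → ℕ → ℕ
  | .add, x, y => x + y
  | .sub, x, y => x - y
  | .mul, x, y => x * y
  | .div, x, y => x / y
  | .mod, x, y => x % y

/-- The instruction that performs a binary operation. -/
def BinOp.instr : BinOp → ℕ → ℕ → ℕ → Instr
  | .add => .add
  | .sub => .sub
  | .mul => .mul
  | .div => .div
  | .mod => .mod

theorem BinOp.exec_instr (o : BinOp) (s : Config) (dst a b : ℕ) :
    (o.instr dst a b).exec s = s.set dst (o.eval (s.reg a) (s.reg b)) := by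
  cases o <;> rfl

/-- Arithmetic expressions over variables and memory cells. -/
inductive Expr where
  | const (n : ℕ)
  | var (x : ℕ)
  | bin (o : BinOp) (a b : Expr)
  | load (a : Expr)

namespace Expr

/-- The value of an expression. -/
def eval (h : Store) : Expr → ℕ
  | const n => n
  | var x => h.var x
  | bin o a b => o.eval (a.eval h) (b.eval h)
  | load a => h.mem (a.eval h)

/-- A measure of the magnitude of the words that occur in the evaluation of an expression. -/
def size : Expr → ℕ
  | const n => n + 1
  | var _ => 1
  | bin _ a b => a.size + b.size
  | load a => a.size

theorem size_pos : ∀ e : Expr, 1 ≤ e.size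
  | const n => by simp [size]
  | var _ => le_rfl
  | bin _ a b => by have := a.size_pos; simp only [size]; omega
  | load a => a.size_pos

/-- If `x < p` and `y < q`, then `x + y` and `x * y` are smaller than `p * q`, so exponents add up
along the expression. Hence temporary words stay below a fixed power of the bound for stored words.
-/
theorem eval_lt {h : Store} {B : ℕ} (hB : 2 ≤ B) (hh : h.Below B) :
    ∀ e : Expr, e.eval h < B ^ e.size
  | const n => by
      calc n < 2 ^ n := Nat.lt_two_pow_self
        _ ≤ B ^ n := Nat.pow_le_pow_left hB n
        _ ≤ B ^ (n + 1) := Nat.pow_le_pow_right (by omega) (by omega)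
  | var x => by simpa [eval, size] using (hh x).1
  | bin o a b => by
      have ha := eval_lt hB hh a
      have hb := eval_lt hB hh b
      have hA : 2 ≤ B ^ a.size := hB.trans (Nat.le_self_pow (by have := a.size_pos; omega) B)
      have hC : 2 ≤ B ^ b.size := hB.trans (Nat.le_self_pow (by have := b.size_pos; omega) B)
      simp only [eval, size, pow_add]
      generalize a.eval h = x at *
      generalize b.eval h = y at *
      generalize B ^ a.size = p at *
      generalize B ^ b.size = q at *
      have hp : p ≤ p * q := Nat.le_mul_of_pos_right p (by omega)
      cases o <;> simp only [BinOp.eval]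
      · nlinarith
      · omega
      · exact Nat.mul_lt_mul'' ha hb
      · exact (Nat.div_le_self x y).trans_lt (ha.trans_le hp)
      · exact (Nat.mod_le x y).trans_lt (ha.trans_le hp)
  | load a => (hh _).2.trans_le (Nat.le_self_pow (by have := a.size_pos; simp only [size]; omega) B)

/-- Code that puts the value of an expression into the register `2 * d + 3`. -/
def code : Expr → ℕ → List Instr
  | const n, d => [.const (2 * d + 3) n]
  | var x, d => [.const (2 * d + 3) 0, .add (2 * d + 3) (2 * x) (2 * d + 3)]
  | bin o a b, d => a.code d ++ (b.code (d + 1) ++ [o.instr (2 * d + 3) (2 * d + 3) (2 * d + 5)])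
  | load a, d => a.code d ++ [.load (2 * d + 3) (2 * d + 3)]

/-- The effect of the evaluation of an expression on a configuration. -/
structure Evaluated (e : Expr) (d : ℕ) (s s' : Config) : Prop where
  pc : s'.pc = s.pc + (e.code d).length
  store : s'.store = s.store
  low : ∀ r < 2 * d + 3, s'.reg r = s.reg r
  val : s'.reg (2 * d + 3) = e.eval s.store

end Expr

theorem Config.store_set_odd (s : Config) (d x : ℕ) :
    (s.set (2 * d + 3) x).store = s.store := by
  simp only [Config.store, Config.set, Store.mk.injEq, and_true]
  funext y
  rw [Function.update_of_ne (by omega)]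

theorem Config.set_reg_self (s : Config) (d x : ℕ) : (s.set d x).reg d = x := by
  simp [Config.set]

theorem Config.set_reg_of_ne (s : Config) {d r : ℕ} (x : ℕ) (h : r ≠ d) :
    (s.set d x).reg r = s.reg r := by
  simp [Config.set, h]

theorem Config.set_pc (s : Config) (d x : ℕ) : (s.set d x).pc = s.pc + 1 := rfl

/-- The odd registers form a stack. The right operand is evaluated at depth `d + 1`, which leaves
the left operand in register `2 * d + 3` intact. Two bounds are kept apart: stored words are below
`B₀`, while temporary words only obey the larger bound `B`. -/
theorem Expr.reaches {M : List Instr} {B B₀ S : ℕ} (h2 : 2 ≤ B₀) (hB : B₀ ^ S ≤ B) :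
    ∀ (e : Expr) (d : ℕ) (s : Config), e.size ≤ S → CodeAt M s.pc (e.code d) → s.Below B →
      s.store.Below B₀ → ∃ s', Reaches M B s s' (e.code d).length ∧ e.Evaluated d s s' := by
  intro e
  have bound : ∀ (e : Expr) {h : Store}, e.size ≤ S → h.Below B₀ → e.eval h < B :=
    fun e h he hh => (e.eval_lt h2 hh).trans_le ((Nat.pow_le_pow_right (by omega) he).trans hB)
  induction e with
  | const n =>
    intro d s hS hc hs hst
    exact ⟨s.set (2 * d + 3) n, .set hc.get rfl hs (bound (const n) hS hst),
      s.set_pc _ _, s.store_set_odd _ _, fun r hr => s.set_reg_of_ne _ (by omega),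
      s.set_reg_self _ _⟩
  | var x =>
    intro d s hS hc hs hst
    -- The machine cannot copy a register, so the variable is added to a register that was set to 0.
    have h1 : Reaches M B s (s.set (2 * d + 3) 0) 1 :=
      .set hc.get rfl hs ((Nat.zero_le _).trans_lt (hs 0).1)
    have hx : (s.set (2 * d + 3) 0).reg (2 * x) + (s.set (2 * d + 3) 0).reg (2 * d + 3)
        = s.store.var x := by
      rw [Config.set_reg_self, Config.set_reg_of_ne _ _ (by omega)]; rfl
    have h2 : Reaches M B (s.set (2 * d + 3) 0) ((s.set (2 * d + 3) 0).set (2 * d + 3) _) 1 :=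
      .set hc.tail.get rfl h1.below (by rw [hx]; exact bound (var x) hS hst)
    refine ⟨_, h1.trans h2, ⟨rfl, ?_, fun r hr => ?_, ?_⟩⟩
    · rw [Config.store_set_odd, Config.store_set_odd]
    · rw [Config.set_reg_of_ne _ _ (by omega), Config.set_reg_of_ne _ _ (by omega)]
    · rw [Config.set_reg_self, hx]; rfl
  | bin o a b iha ihb =>
    intro d s hS hc hs hst
    have hS' : a.size + b.size ≤ S := hS
    obtain ⟨s₁, r₁, e₁⟩ := iha d s (by omega) hc.left hs hst
    have hc₁ : CodeAt M s₁.pc (b.code (d + 1) ++ [o.instr (2 * d + 3) (2 * d + 3) (2 * d + 5)]) := by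
      rw [e₁.pc]; exact hc.right
    obtain ⟨s₂, r₂, e₂⟩ := ihb (d + 1) s₁ (by omega) hc₁.left r₁.below (e₁.store ▸ hst)
    have hc₂ : CodeAt M s₂.pc [o.instr (2 * d + 3) (2 * d + 3) (2 * d + 5)] := by
      rw [e₂.pc]; exact hc₁.right
    have hv : o.eval (s₂.reg (2 * d + 3)) (s₂.reg (2 * d + 5)) = (bin o a b).eval s.store := by
      have := e₂.val
      rw [show 2 * (d + 1) + 3 = 2 * d + 5 by ring, e₁.store] at this
      rw [this, e₂.low _ (by omega), e₁.val]; rfl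
    have r₃ : Reaches M B s₂ (s₂.set (2 * d + 3) ((bin o a b).eval s.store)) 1 :=
      .set hc₂.get (by rw [BinOp.exec_instr, hv]) r₂.below (bound (bin o a b) hS hst)
    refine ⟨_, ?_, ⟨?_, ?_, fun r hr => ?_, s₂.set_reg_self _ _⟩⟩
    · have := (r₁.trans r₂).trans r₃
      simpa [code, add_assoc] using this
    · rw [Config.set_pc, e₂.pc, e₁.pc]; simp [code, add_assoc]
    · rw [Config.store_set_odd, e₂.store, e₁.store]
    · rw [Config.set_reg_of_ne _ _ (by omega), e₂.low _ (by omega), e₁.low _ hr]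
  | load a iha =>
    intro d s hS hc hs hst
    obtain ⟨s₁, r₁, e₁⟩ := iha d s hS hc.left hs hst
    have hc₁ : CodeAt M s₁.pc [.load (2 * d + 3) (2 * d + 3)] := by rw [e₁.pc]; exact hc.right
    have hv : s₁.mem (s₁.reg (2 * d + 3)) = (load a).eval s.store := by
      have : s₁.mem = s.mem := congrArg Store.mem e₁.store
      rw [e₁.val, this]; rfl
    have r₃ : Reaches M B s₁ (s₁.set (2 * d + 3) ((load a).eval s.store)) 1 :=
      .set hc₁.get (by rw [← hv]; rfl) r₁.below (bound (load a) hS hst)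
    refine ⟨_, by simpa [code] using r₁.trans r₃, ⟨?_, ?_, fun r hr => ?_, s₁.set_reg_self _ _⟩⟩
    · rw [Config.set_pc, e₁.pc]; simp [code, add_assoc]
    · rw [Config.store_set_odd, e₁.store]
    · rw [Config.set_reg_of_ne _ _ (by omega), e₁.low _ hr]

/-! ### Statements -/

/-- Statements without control flow. -/
inductive Stmt where
  | assign (x : ℕ) (e : Expr)
  | store (a e : Expr)
  | write (e : Expr)

namespace Stmt

/-- The effect of a statement. -/
def exec (h : Store) : Stmt → Store
  | assign x e => { h with var := Function.update h.var x (e.eval h) }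
  | store a e => { h with mem := Function.update h.mem (a.eval h) (e.eval h) }
  | write e => { h with out := h.out ++ [e.eval h] }

/-- The sum of the sizes of the expressions of a statement. -/
def size : Stmt → ℕ
  | assign _ e => e.size
  | store a e => a.size + e.size
  | write e => e.size

/-- The code of a statement. -/
def code : Stmt → List Instr
  | assign x e => e.code 0 ++ [.const 5 0, .add (2 * x) 3 5]
  | store a e => a.code 0 ++ (e.code 1 ++ [.store 3 5])
  | write e => e.code 0 ++ [.write 3]

end Stmt

theorem Config.store_set_even (s : Config) (x n : ℕ) :
    (s.set (2 * x) n).store = { s.store with var := Function.update s.store.var x n } := by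
  simp only [Config.store, Config.set, Store.mk.injEq, and_true]
  funext y
  by_cases hy : y = x
  · subst hy; simp
  · rw [Function.update_of_ne (by omega), Function.update_of_ne hy]

/-- Register 1 is reserved for the limit of the surrounding loop, hence the claim that a statement
preserves it. -/
theorem Stmt.reaches {M : List Instr} {B B₀ S : ℕ} (h2 : 2 ≤ B₀) (hB : B₀ ^ S ≤ B)
    (st : Stmt) (s : Config) (hS : st.size ≤ S) (hc : CodeAt M s.pc st.code) (hs : s.Below B)
    (hst : s.store.Below B₀) :
    ∃ s', Reaches M B s s' st.code.length ∧ s'.pc = s.pc + st.code.length ∧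
      s'.store = st.exec s.store ∧ s'.reg 1 = s.reg 1 := by
  have bound : ∀ (e : Expr), e.size ≤ S → e.eval s.store < B :=
    fun e he => (e.eval_lt h2 hst).trans_le ((Nat.pow_le_pow_right (by omega) he).trans hB)
  have hB0 : 0 < B := (Nat.zero_le _).trans_lt (hs 0).1
  cases st with
  | assign x e =>
    obtain ⟨s₁, r₁, e₁⟩ := Expr.reaches h2 hB e 0 s hS hc.left hs hst
    have hc₁ : CodeAt M s₁.pc [.const 5 0, .add (2 * x) 3 5] := by rw [e₁.pc]; exact hc.right
    have r₂ : Reaches M B s₁ (s₁.set 5 0) 1 := .set hc₁.get rfl r₁.below hB0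
    have hv : (s₁.set 5 0).reg 3 + (s₁.set 5 0).reg 5 = e.eval s.store := by
      rw [Config.set_reg_self, Config.set_reg_of_ne _ _ (by omega)]
      exact e₁.val
    have r₃ : Reaches M B (s₁.set 5 0) ((s₁.set 5 0).set (2 * x) (e.eval s.store)) 1 :=
      .set hc₁.tail.get (by rw [← hv]; rfl) r₂.below (bound e hS)
    refine ⟨_, by simpa [code] using (r₁.trans r₂).trans r₃, ?_, ?_, ?_⟩
    · rw [Config.set_pc, Config.set_pc, e₁.pc]; simp [code, add_assoc]
    · rw [Config.store_set_even, s₁.store_set_odd 1, e₁.store]; rfl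
    · rw [Config.set_reg_of_ne _ _ (by omega), Config.set_reg_of_ne _ _ (by omega),
        e₁.low _ (by omega)]
  | store a e =>
    have hS' : a.size + e.size ≤ S := hS
    obtain ⟨s₁, r₁, e₁⟩ := Expr.reaches h2 hB a 0 s (by omega) hc.left hs hst
    have hc₁ : CodeAt M s₁.pc (e.code 1 ++ [.store 3 5]) := by rw [e₁.pc]; exact hc.right
    obtain ⟨s₂, r₂, e₂⟩ := Expr.reaches h2 hB e 1 s₁ (by omega) hc₁.left r₁.below (e₁.store ▸ hst)
    have hc₂ : CodeAt M s₂.pc [.store 3 5] := by rw [e₂.pc]; exact hc₁.right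
    have h3 : s₂.reg 3 = a.eval s.store := by rw [e₂.low _ (by omega)]; exact e₁.val
    have h5 : s₂.reg 5 = e.eval s.store := by rw [← e₁.store]; exact e₂.val
    have hex : ((Instr.store 3 5).exec s₂).Below B := by
      intro x
      refine ⟨(r₂.below x).1, ?_⟩
      simp only [Instr.exec, h3, h5]
      by_cases hx : x = a.eval s.store
      · subst hx; simpa using bound e (by omega)
      · rw [Function.update_of_ne hx]; exact (r₂.below x).2
    refine ⟨_, by simpa [code, add_assoc] using (r₁.trans r₂).trans (.single hc₂.get r₂.below hex),
      ?_, ?_, ?_⟩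
    · simp only [Instr.exec, e₂.pc, e₁.pc]; simp [code, add_assoc]
    · have := e₂.store.trans e₁.store
      simp only [Config.store, Store.mk.injEq] at this
      simp only [Instr.exec, Config.store, h3, h5, exec, this]
    · simp only [Instr.exec]; rw [e₂.low _ (by omega), e₁.low _ (by omega)]
  | write e =>
    obtain ⟨s₁, r₁, e₁⟩ := Expr.reaches h2 hB e 0 s hS hc.left hs hst
    have hc₁ : CodeAt M s₁.pc [.write 3] := by rw [e₁.pc]; exact hc.right
    have h3 : s₁.reg 3 = e.eval s.store := e₁.val
    refine ⟨_, by simpa [code] using r₁.trans (.single hc₁.get r₁.below (r₁.below.of_eq rfl rfl)),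
      ?_, ?_, ?_⟩
    · simp only [Instr.exec, e₁.pc]; simp [code, add_assoc]
    · have := e₁.store
      simp only [Config.store, Store.mk.injEq] at this
      simp only [Instr.exec, Config.store, h3, exec, this]
    · simp only [Instr.exec]; rw [e₁.low _ (by omega)]

/-- The effect of a list of statements. -/
def execs (l : List Stmt) (h : Store) : Store := l.foldl Stmt.exec h

/-- The words stay below `B` when the statements of the list are executed. -/
def OkStmts (B : ℕ) : List Stmt → Store → Prop
  | [], h => h.Below B
  | st :: l, h => h.Below B ∧ OkStmts B l (st.exec h)

theorem stmts_reaches {M : List Instr} {B B₀ S : ℕ} (h2 : 2 ≤ B₀) (hB : B₀ ^ S ≤ B)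
    (l : List Stmt) : ∀ (s : Config), (∀ st ∈ l, st.size ≤ S) →
    CodeAt M s.pc (l.flatMap Stmt.code) → s.Below B → OkStmts B₀ l s.store →
    ∃ s', Reaches M B s s' (l.flatMap Stmt.code).length ∧
      s'.pc = s.pc + (l.flatMap Stmt.code).length ∧
      s'.store = execs l s.store ∧ s'.reg 1 = s.reg 1 := by
  induction l with
  | nil => intro s _ _ hs _; exact ⟨s, .refl hs, rfl, rfl, rfl⟩
  | cons st l ih =>
    intro s hS hc hs hok
    rw [List.flatMap_cons] at hc
    obtain ⟨s₁, r₁, p₁, e₁, q₁⟩ := st.reaches h2 hB s (hS st (by simp)) hc.left hs hok.1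
    obtain ⟨s₂, r₂, p₂, e₂, q₂⟩ := ih s₁ (fun t ht => hS t (by simp [ht]))
      (by rw [p₁]; exact hc.right) r₁.below (e₁ ▸ hok.2)
    refine ⟨s₂, by simpa using r₁.trans r₂, ?_, ?_, q₂.trans q₁⟩
    · rw [p₂, p₁]; simp [add_assoc]
    · rw [e₂, e₁]; rfl

/-! ### Programs with counting loops -/

/-- A statement, or a loop that executes its body for the values `0, 1, …, lim - 1` of the
variable `0`. -/
inductive Seg where
  | simple (st : Stmt)
  | loop (lim : Expr) (body : List Stmt)

/-- Change the loop variable. -/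
def Store.setIdx (h : Store) (i : ℕ) : Store := { h with var := Function.update h.var 0 i }

/-- One round of a loop. -/
def iter (body : List Stmt) (h : Store) : Store :=
  (execs body h).setIdx ((execs body h).var 0 + 1)

namespace Seg

/-- The effect of a segment. -/
def exec (h : Store) : Seg → Store
  | simple st => st.exec h
  | loop lim body => (iter body)^[lim.eval h] (h.setIdx 0)

/-- The code of a segment that starts at position `pc`. -/
def code (pc : ℕ) : Seg → List Instr
  | simple st => st.code
  | loop lim body =>
      lim.code 0 ++ ([.const 5 0, .add 1 3 5, .const 0 0, .sub 3 1 0,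
        .jz 3 (pc + (lim.code 0).length + (body.flatMap Stmt.code).length + 8)] ++
        (body.flatMap Stmt.code ++
          [.const 3 1, .add 0 0 3, .jmp (pc + (lim.code 0).length + 3)]))

/-- The number of instructions of a segment. -/
def length : Seg → ℕ
  | simple st => st.code.length
  | loop lim body => (lim.code 0).length + (body.flatMap Stmt.code).length + 8

theorem code_length (pc : ℕ) : ∀ g : Seg, (g.code pc).length = g.length
  | simple _ => rfl
  | loop lim body => by simp [code, length]; omega

/-- The sum of the sizes of the expressions of a segment. -/
def size : Seg → ℕ
  | simple st => st.size
  | loop lim body => lim.size + (body.map Stmt.size).sum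

/-- During the execution of the segment the words stay below `B`, and a loop has at most `X`
rounds. -/
def Ok (B X : ℕ) (h : Store) : Seg → Prop
  | simple st => h.Below B ∧ (st.exec h).Below B
  | loop lim body => h.Below B ∧ lim.eval h ≤ X ∧
      (∀ i ≤ lim.eval h, ((iter body)^[i] (h.setIdx 0)).Below B ∧
        ((iter body)^[i] (h.setIdx 0)).var 0 = i) ∧
      ∀ i < lim.eval h, OkStmts B body ((iter body)^[i] (h.setIdx 0))

end Seg

/-- Induction on the number `k` of remaining rounds, started at the loop test. A round costs its
body and five instructions of test, increment and jump; the final test costs two. -/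
theorem Seg.loop_reaches {M : List Instr} {B B₀ S : ℕ} (h2 : 2 ≤ B₀) (hB : B₀ ^ S ≤ B)
    (hle : B₀ ≤ B) {body : List Stmt}
    (hS : ∀ st ∈ body, st.size ≤ S) (n : ℕ) : ∀ (k i : ℕ) (h : Store) (s : Config), i + k = n →
    CodeAt M s.pc ([.sub 3 1 0, .jz 3 (s.pc + (body.flatMap Stmt.code).length + 5)] ++
        (body.flatMap Stmt.code ++ [.const 3 1, .add 0 0 3, .jmp s.pc])) →
    s.Below B → s.store = (iter body)^[i] h →
    (∀ i ≤ n, ((iter body)^[i] h).Below B₀ ∧ ((iter body)^[i] h).var 0 = i) →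
    (∀ i < n, OkStmts B₀ body ((iter body)^[i] h)) → s.reg 1 = n →
    ∃ s', Reaches M B s s' (k * ((body.flatMap Stmt.code).length + 5) + 2) ∧
      s'.pc = s.pc + (body.flatMap Stmt.code).length + 5 ∧ s'.store = (iter body)^[n] h := by
  intro k
  induction k with
  | zero =>
    rintro i h s rfl hc hs hst hbel hok hn
    have hi : s.reg 0 = i := by
      have := congrArg (fun t => Store.var t 0) hst
      simpa [(hbel i le_rfl).2, Config.store] using this
    have r₁ : Reaches M B s (s.set 3 0) 1 :=
      .set hc.left.get (by simp [Instr.exec, hn, hi]) hs ((Nat.zero_le _).trans_lt (hs 0).1)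
    have r₂ := Reaches.single (i := .jz 3 (s.pc + (body.flatMap Stmt.code).length + 5))
      (hc.left.tail.get) r₁.below (r₁.below.of_eq rfl rfl)
    refine ⟨_, by simpa using r₁.trans r₂, ?_, ?_⟩
    · simp [Instr.exec, Config.set_reg_self]
    · rw [add_zero, ← hst, ← s.store_set_odd 0 0]; rfl
  | succ k ih =>
    rintro i h s hik hc hs hst hbel hok hn
    have hi : s.reg 0 = i := by
      have := congrArg (fun t => Store.var t 0) hst
      simpa [(hbel i (by omega)).2, Config.store] using this
    have hnB : n < B := by rw [← hn]; exact (hs 1).1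
    have r₁ : Reaches M B s (s.set 3 (n - i)) 1 :=
      .set hc.left.get (by simp [Instr.exec, hn, hi]) hs
      ((Nat.sub_le n i).trans_lt hnB)
    have r₂ := Reaches.single (i := .jz 3 (s.pc + (body.flatMap Stmt.code).length + 5))
      (hc.left.tail.get) r₁.below (r₁.below.of_eq rfl rfl)
    set s₂ := (Instr.jz 3 (s.pc + (body.flatMap Stmt.code).length + 5)).exec (s.set 3 (n - i))
      with hs₂
    have p₂ : s₂.pc = s.pc + 2 := by
      have : n - i ≠ 0 := by omega
      simp [hs₂, Instr.exec, Config.set_reg_self, this, Config.set_pc]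
    have e₂ : s₂.store = (iter body)^[i] h := by
      rw [← hst, ← s.store_set_odd 0 (n - i)]; rfl
    have q₂ : s₂.reg 1 = n := 
      (s.set_reg_of_ne (n - i) (show 1 ≠ 3 by omega)).trans hn
    have hc₂ := hc.right
    rw [show s.pc + _ = s₂.pc by rw [p₂]; rfl] at hc₂
    obtain ⟨s₃, r₃, p₃, e₃, q₃⟩ := stmts_reaches h2 hB body s₂ hS hc₂.left r₂.below
      (by rw [e₂]; exact hok i (by omega))
    have hc₃ := hc₂.right
    rw [← p₃] at hc₃
    have r₄ : Reaches M B s₃ (s₃.set 3 1) 1 := .set hc₃.get rfl r₃.below (by omega)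
    have e₄ : (s₃.set 3 1).store = s₃.store := s₃.store_set_odd 0 1
    have hit : (iter body)^[i + 1] h = (s₃.store).setIdx (s₃.store.var 0 + 1) := by
      rw [Function.iterate_succ_apply', ← e₂, iter, ← e₃]
    have h0 : s₃.store.var 0 = i := by
      have := (hbel (i + 1) (by omega)).2
      rw [hit] at this
      simpa [Store.setIdx] using this
    have r₅ : Reaches M B (s₃.set 3 1) ((s₃.set 3 1).set 0 (i + 1)) 1 := by
      refine .set hc₃.tail.get ?_ r₄.below (by omega)
      have : s₃.reg 0 = i := h0
      simp [Instr.exec, Config.set_reg_self, Config.set_reg_of_ne, this]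
    have r₆ := Reaches.single (i := .jmp s.pc) (s := (s₃.set 3 1).set 0 (i + 1))
      hc₃.tail.tail.get r₅.below (r₅.below.of_eq rfl rfl)
    obtain ⟨s', r', p', e'⟩ := ih (i + 1) h ((Instr.jmp s.pc).exec ((s₃.set 3 1).set 0 (i + 1)))
      (by omega) hc r₆.below (by
        rw [hit, h0, ← e₄]
        exact (s₃.set 3 1).store_set_even 0 (i + 1)) hbel hok (by
        rw [← q₂, ← q₃]
        simp [Instr.exec, Config.set_reg_of_ne])
    refine ⟨s', ?_, p', e'⟩
    have := (((((r₁.trans r₂).trans r₃).trans r₄).trans r₅).trans r₆).trans r'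
    convert this using 1
    ring

theorem Seg.reaches {M : List Instr} {B B₀ S X : ℕ} (h2 : 2 ≤ B₀) (hB : B₀ ^ S ≤ B)
    (hle : B₀ ≤ B) (g : Seg) (s : Config) (hS : g.size ≤ S) (hc : CodeAt M s.pc (g.code s.pc))
    (hs : s.Below B) (hok : g.Ok B₀ X s.store) :
    ∃ s', ∃ t ≤ g.length * (X + 1), Reaches M B s s' t ∧ s'.pc = s.pc + g.length ∧
      s'.store = g.exec s.store := by
  cases g with
  | simple st =>
    obtain ⟨s', r, p, e, -⟩ := st.reaches h2 hB s hS hc hs hok.1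
    exact ⟨s', _, Nat.le_mul_of_pos_right _ (by omega), r, p, e⟩
  | loop lim body =>
    obtain ⟨hb, hX, hbel, hst⟩ := hok
    have hS' : lim.size + (body.map Stmt.size).sum ≤ S := hS
    have hSb : ∀ st ∈ body, st.size ≤ S := fun st hm =>
      (List.single_le_sum (fun _ _ => Nat.zero_le _) _ (List.mem_map_of_mem hm)).trans (by omega)
    have hB0 : 0 < B := by omega
    obtain ⟨s₁, r₁, e₁⟩ := Expr.reaches h2 hB lim 0 s (by omega) hc.left hs hb
    have hc₁ := hc.right
    rw [← e₁.pc] at hc₁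
    have r₂ : Reaches M B s₁ (s₁.set 5 0) 1 := .set hc₁.left.get rfl r₁.below hB0
    have hv : (s₁.set 5 0).reg 3 + (s₁.set 5 0).reg 5 = lim.eval s.store := by
      rw [Config.set_reg_self, Config.set_reg_of_ne _ _ (by omega)]
      exact e₁.val
    have r₃ : Reaches M B (s₁.set 5 0) ((s₁.set 5 0).set 1 (lim.eval s.store)) 1 :=
      .set hc₁.left.tail.get (by rw [← hv]; rfl) r₂.below
        ((lim.eval_lt h2 hb).trans_le ((Nat.pow_le_pow_right (by omega) (by omega)).trans hB))
    have r₄ : Reaches M B ((s₁.set 5 0).set 1 (lim.eval s.store))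
        (((s₁.set 5 0).set 1 (lim.eval s.store)).set 0 0) 1 :=
      .set hc₁.left.tail.tail.get rfl r₃.below hB0
    set s₄ := ((s₁.set 5 0).set 1 (lim.eval s.store)).set 0 0 with hs₄
    have p₄ : s₄.pc = s.pc + (lim.code 0).length + 3 := by
      simp only [hs₄, Config.set_pc, e₁.pc]
    have e₄ : s₄.store = s.store.setIdx 0 := by
      rw [hs₄, show (0 : ℕ) = 2 * 0 by rfl, Config.store_set_even]
      have : ((s₁.set (2 * 1 + 3) 0).set 1 (lim.eval s.store)).store = s.store := by
        rw [← e₁.store, ← s₁.store_set_odd 1 0]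
        simp only [Config.store, Config.set, Store.mk.injEq, and_true]
        funext y
        rw [Function.update_of_ne (by omega)]
      simp only [Nat.reduceMul, Nat.reduceAdd] at this
      simp only [Nat.mul_zero, this]; rfl
    -- The limit is copied and the index cleared by three instructions that run only once. The loop
    -- head stands behind them, whence the offsets 3 and 8 = 3 + 5 in the code.
    have hc₄ : CodeAt M s₄.pc ([.sub 3 1 0, .jz 3 (s₄.pc + (body.flatMap Stmt.code).length + 5)] ++
        (body.flatMap Stmt.code ++ [.const 3 1, .add 0 0 3, .jmp s₄.pc])) := by
      have := hc₁.tail.tail.tail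
      rw [p₄, ← e₁.pc, show s₁.pc + 3 + (body.flatMap Stmt.code).length + 5
        = s₁.pc + (body.flatMap Stmt.code).length + 8 by omega]
      exact this
    obtain ⟨s', r', p', e'⟩ := Seg.loop_reaches h2 hB hle hSb (lim.eval s.store) (lim.eval s.store)
      0 (s.store.setIdx 0) s₄ (by omega) hc₄ r₄.below e₄ hbel hst (by
        rw [hs₄, Config.set_reg_of_ne _ _ (by omega), Config.set_reg_self])
    refine ⟨s', _, ?_, (((r₁.trans r₂).trans r₃).trans r₄).trans r', ?_, e'⟩
    · simp only [length]
      generalize (lim.code 0).length = p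
      generalize (body.flatMap Stmt.code).length = q
      generalize lim.eval s.store = n at *
      nlinarith [Nat.mul_le_mul_right (q + 5) hX]
    · rw [p', p₄]; simp only [length]; omega

/-- The code of a list of segments that starts at position `pc`. -/
def progCode : ℕ → List Seg → List Instr
  | _, [] => []
  | pc, g :: p => g.code pc ++ progCode (pc + g.length) p

/-- The effect of a list of segments. -/
def progExec (p : List Seg) (h : Store) : Store := p.foldl Seg.exec h

/-- During the execution of the program the words stay below `B`, and the loops have at most `X`
rounds. -/
def ProgOk (B X : ℕ) : List Seg → Store → Prop
  | [], _ => True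
  | g :: p, h => g.Ok B X h ∧ ProgOk B X p (g.exec h)

theorem progOk_append {B X : ℕ} {p q : List Seg} {h : Store} :
    ProgOk B X (p ++ q) h ↔ ProgOk B X p h ∧ ProgOk B X q (progExec p h) := by
  induction p generalizing h with
  | nil => simp [ProgOk, progExec]
  | cons g p ih => simp [ProgOk, ih, progExec, and_assoc]

/-- Since loops are not nested, every instruction is executed at most `X + 1` times, which gives the
time bound. -/
theorem prog_reaches {M : List Instr} {B B₀ S X : ℕ} (h2 : 2 ≤ B₀) (hB : B₀ ^ S ≤ B)
    (hle : B₀ ≤ B) (p : List Seg) : ∀ s : Config, (∀ g ∈ p, g.size ≤ S) →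
    CodeAt M s.pc (progCode s.pc p) → s.Below B → ProgOk B₀ X p s.store →
    ∃ s', ∃ t ≤ (progCode s.pc p).length * (X + 1), Reaches M B s s' t ∧
      s'.pc = s.pc + (progCode s.pc p).length ∧ s'.store = progExec p s.store := by
  induction p with
  | nil => intro s _ _ hs _; exact ⟨s, 0, by simp, .refl hs, rfl, rfl⟩
  | cons g p ih =>
    intro s hS hc hs hok
    obtain ⟨s₁, t₁, ht₁, r₁, p₁, e₁⟩ := g.reaches h2 hB hle s (hS g (by simp)) hc.left hs hok.1
    have hc₁ := hc.right
    rw [Seg.code_length] at hc₁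
    rw [← p₁] at hc₁
    obtain ⟨s₂, t₂, ht₂, r₂, p₂, e₂⟩ := ih s₁ (fun g' hg' => hS g' (by simp [hg'])) hc₁ r₁.below
      (e₁ ▸ hok.2)
    refine ⟨s₂, _, ?_, r₁.trans r₂, ?_, ?_⟩
    · simp only [progCode, List.length_append, Seg.code_length, ← p₁, add_mul]
      exact Nat.add_le_add ht₁ ht₂
    · rw [p₂, p₁]; simp [progCode, Seg.code_length, add_assoc]
    · rw [e₂, e₁]; rfl

/-- The store in which the input is in the memory. -/
def inputStore (input : List ℕ) : Store := ⟨fun _ => 0, fun i => input.getD i 0, []⟩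

theorem computes_of_progOk {p : List Seg} {input : List ℕ} {B₀ X S : ℕ} (h2 : 2 ≤ B₀)
    (hS : 1 ≤ S) (hp : ∀ g ∈ p, g.size ≤ S) (hin : ∀ i, input.getD i 0 < B₀)
    (hok : ProgOk B₀ X p (inputStore input)) :
    Computes (progCode 0 p) input (progExec p (inputStore input)).out
      ((progCode 0 p).length * (X + 1)) (B₀ ^ S) := by
  have hle : B₀ ≤ B₀ ^ S := Nat.le_self_pow (by omega) _
  have hbel : (init input).Below (B₀ ^ S) := fun a =>
    ⟨show 0 < B₀ ^ S by omega, (hin a).trans_le hle⟩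
  obtain ⟨s', t, ht, r, hpc, hst⟩ := prog_reaches (M := progCode 0 p) h2 le_rfl hle p (init input)
    hp ⟨[], [], by simp [init], rfl⟩ hbel hok
  refine ⟨t, ht, ?_, ?_, fun j hj a => r.2 j hj a⟩
  · rw [run, r.1, hpc]; simp [init]
  · rw [run, r.1]; exact congrArg Store.out hst

theorem out_length_step (M : List Instr) (s : Config) :
    (step M s).out.length ≤ s.out.length + 1 := by
  unfold step
  rcases M[s.pc]? with _ | i
  · simp
  · cases i <;> simp [Instr.exec, Config.set]

/-- A step writes at most one word. This bounds the size of the grounding by the running time. -/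
theorem Computes.length_le {M : List Instr} {input output : List ℕ} {time bound : ℕ}
    (h : Computes M input output time bound) : output.length ≤ time := by
  obtain ⟨t, ht, -, rfl, -⟩ := h
  refine le_trans ?_ ht
  clear ht
  unfold run
  induction t with
  | zero => simp [init]
  | succ t ih =>
    rw [Function.iterate_succ_apply']
    exact (out_length_step _ _).trans (by omega)

/-! ### Hoare triples -/

/-- From every store with the property `Pre` the program runs within the bounds `B` and `X` and ends
in a store with the property `Post`. -/
def Triple (B X : ℕ) (Pre : Store → Prop) (p : List Seg) (Post : Store → Prop) : Prop :=
  ∀ h, Pre h → ProgOk B X p h ∧ Post (progExec p h)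

theorem Triple.append {B X : ℕ} {P Q R : Store → Prop} {p q : List Seg}
    (hp : Triple B X P p Q) (hq : Triple B X Q q R) : Triple B X P (p ++ q) R := by
  intro h hh
  obtain ⟨h1, h2⟩ := hp h hh
  obtain ⟨h3, h4⟩ := hq _ h2
  exact ⟨progOk_append.2 ⟨h1, h3⟩, by rw [progExec, List.foldl_append]; exact h4⟩

/-- The invariant is indexed by the prefix already processed. The splitting of `l` tells the body
where it stands in the list. -/
theorem Triple.flatMap {B X : ℕ} {α : Type*} (f : α → List Seg) (I : List α → Store → Prop)
    (l : List α) (h : ∀ u a v, l = u ++ a :: v → Triple B X (I u) (f a) (I (u ++ [a]))) :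
    Triple B X (I []) (l.flatMap f) (I l) := by
  have : ∀ v u, l = u ++ v → Triple B X (I u) (v.flatMap f) (I l) := by
    intro v
    induction v with
    | nil => rintro u rfl h hh; exact ⟨trivial, by simpa [progExec] using hh⟩
    | cons a v ih =>
      intro u hu
      rw [List.flatMap_cons]
      exact (h u a v hu).append (ih (u ++ [a]) (by simp [hu]))
  exact this l [] rfl

theorem Triple.loop {B X : ℕ} {P Q : Store → Prop} {lim : Expr} {body : List Stmt}
    (n : ℕ) (hn : n ≤ X) (Inv : ℕ → Store → Prop)
    (hP : ∀ h, P h → h.Below B ∧ lim.eval h = n ∧ Inv 0 (h.setIdx 0))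
    (hI : ∀ i ≤ n, ∀ h, Inv i h → h.Below B ∧ h.var 0 = i)
    (hbody : ∀ i < n, ∀ h, Inv i h → OkStmts B body h ∧ Inv (i + 1) (iter body h))
    (hQ : ∀ h, Inv n h → Q h) : Triple B X P [.loop lim body] Q := by
  intro h hh
  obtain ⟨h1, h2, h3⟩ := hP h hh
  have key : ∀ i ≤ n, Inv i ((iter body)^[i] (h.setIdx 0)) := by
    intro i
    induction i with
    | zero => intro _; exact h3
    | succ i ih =>
      intro hi
      rw [Function.iterate_succ_apply']
      exact (hbody i (by omega) _ (ih (by omega))).2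
  refine ⟨⟨⟨h1, by omega, ?_, ?_⟩, trivial⟩, hQ _ ?_⟩
  · rw [h2]; exact fun i hi => hI i hi _ (key i hi)
  · rw [h2]; exact fun i hi => (hbody i hi _ (key i hi.le)).1
  · have := key n le_rfl
    simpa [progExec, Seg.exec, h2] using this

end Datalog.RAM

namespace Datalog

/-! ### Blocks of equations -/

/-- A list of tuples over which a block of equations ranges: the table of an EDB predicate, or all
tuples of constants that fit an IDB predicate. -/
inductive Source (S : Schema) where
  | edb (R : Fin S.numEdb)
  | idb (T : Fin S.numIdb)

/-- The length of the tuples of a source. -/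
def Source.arity {S : Schema} : Source S → ℕ
  | .edb R => S.edbArity R
  | .idb T => S.idbArity T

/-- The number of tuples of a source; the list `dom` enumerates the active domain. -/
def Source.card {S : Schema} (I : Instance S) (dom : List ℕ) : Source S → ℕ
  | .edb R => (I.table R).length
  | .idb T => dom.length ^ S.idbArity T

/-- The entry at position `j` of the tuple number `i` of a source. -/
def Source.row {S : Schema} (I : Instance S) (dom : List ℕ) : Source S → ℕ → ℕ → ℕ
  | .edb R, i, j =>
      if h : j < S.edbArity R then (I.table R).getD i (fun _ => 0) ⟨j, h⟩ else 0
  | .idb T, i, j =>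
      if j < S.idbArity T then dom.getD (i / dom.length ^ j % dom.length) 0 else 0

/-- A factor of the monomial that belongs to a tuple: an atom whose arguments are given by positions
of the tuple, or the message of another block at a key given by positions of the tuple. -/
inductive Factor (S : Schema) (ι : Type) where
  | edb (R : Fin S.numEdb) (p : Fin (S.edbArity R) → ℕ)
  | idb (T : Fin S.numIdb) (p : Fin (S.idbArity T) → ℕ)
  | msg (s : ι) (key : List ℕ)

/-- The monomial that belongs to a tuple; it counts only if the tuple satisfies the equations between
positions. -/
structure Term (S : Schema) (ι : Type) where
  eqs : List (ℕ × ℕ)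
  factors : List (Factor S ι)

/-- A block of equations, one for each tuple of a source. A block `head T` defines the IDB predicate
`T`. A block `chain` computes the sums of its terms over all tuples with the same key. -/
inductive Block (S : Schema) (ι : Type) where
  | head (T : Fin S.numIdb) (terms : List (Term S ι))
  | chain (src : Source S) (key : List ℕ) (terms : List (Term S ι))

namespace Block

variable {S : Schema} {ι : Type}

/-- The source of a block. -/
def src : Block S ι → Source S
  | head T _ => .idb T
  | chain src _ _ => src

/-- The terms of a block. -/
def terms : Block S ι → List (Term S ι)
  | head _ l => l
  | chain _ _ l => l

end Block

/-- Blocks with numbers. -/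
structure Layout (S : Schema) (ι : Type) where
  id : ι → ℕ
  blk : ι → Block S ι

/-- The number, from 1 on, of the last of the first `n` indices that `f` maps to `κ`, and `0` if there
is none. -/
def lastIdx (f : ℕ → ℕ) : ℕ → ℕ → ℕ
  | 0, _ => 0
  | n + 1, κ => if f n = κ then n + 1 else lastIdx f n κ

/-- `1` if the equations hold for the tuple, and `0` otherwise. -/
def flag (r : ℕ → ℕ) : List (ℕ × ℕ) → ℕ
  | [] => 1
  | p :: l => (1 - ((r p.1 - r p.2) + (r p.2 - r p.1))) * flag r l

/-- The number of a key of a tuple. -/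
def keyCode (N : ℕ) (key : List ℕ) (r : ℕ → ℕ) : ℕ := Nat.ofDigits N (key.map r)

namespace Layout

variable {S : Schema} {ι : Type} (A : Layout S ι) (I : Instance S) (dom : List ℕ) (N : ℕ)

/-- The index of the variable that contains the partial sum for a key over the first `i` tuples. -/
def partialRef (s : ι) (i κ : ℕ) : ℕ :=
  match A.blk s with
  | .head _ _ => 0
  | .chain src key _ => lastIdx (fun i => keyCode N key (src.row I dom i)) i κ

/-- The index of the variable that contains the message of a block for a key. -/
def ref (s : ι) (κ : ℕ) : ℕ := A.partialRef I dom N s ((A.blk s).src.card I dom) κ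

/-- The variables that a block defines for its partial sums. -/
def chainVar (s : ι) (i : ℕ) : GroundVar := (S.numIdb + 1 + A.id s, [i])

/-- The variable with value `1` for `i = 1` and `0` otherwise. -/
def flagVar (S : Schema) (i : ℕ) : GroundVar := (S.numIdb, [i])

/-- The factor of a monomial that belongs to a tuple. -/
def groundFactor (r : ℕ → ℕ) : Factor S ι → GroundCoeff S ⊕ GroundVar
  | .edb R p => .inl ⟨R, fun j => r (p j)⟩
  | .idb T p => .inr (T.val, List.ofFn fun j => r (p j))
  | .msg s key => .inr (A.chainVar s (A.ref I dom N s (keyCode N key r)))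

/-- The monomial that belongs to a tuple. -/
def groundTerm (r : ℕ → ℕ) (τ : Term S ι) : Monomial S :=
  .inr (flagVar S (flag r τ.eqs)) :: τ.factors.map (A.groundFactor I dom N r)

/-- The equation number `i` of a block. -/
def eqn (s : ι) (i : ℕ) : GroundVar × List (Monomial S) :=
  match A.blk s with
  | .head T terms =>
      ((T.val, List.ofFn fun j : Fin (S.idbArity T) => (Source.idb T).row I dom i j),
        terms.map (A.groundTerm I dom N ((Source.idb T).row I dom i)))
  | .chain src key terms =>
      (A.chainVar s (i + 1),
        [.inr (A.chainVar s (lastIdx (fun i => keyCode N key (src.row I dom i)) i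
          (keyCode N key (src.row I dom i))))] ::
        terms.map (A.groundTerm I dom N (src.row I dom i)))

/-- The equations of the blocks in a list. -/
def blockEqs (order : List ι) : List (GroundVar × List (Monomial S)) :=
  order.flatMap fun s => (List.range ((A.blk s).src.card I dom)).map (A.eqn I dom N s)

/-- All equations. -/
def eqs (order : List ι) : List (GroundVar × List (Monomial S)) :=
  (flagVar S 1, [[]]) :: A.blockEqs I dom N order

end Layout

/-- The words that describe an equation. -/
def encodeEqn {S : Schema} (q : GroundVar × List (Monomial S)) : List ℕ :=
  Grounding.encodeVar q.1 ++ q.2.length :: q.2.flatMap Grounding.encodeMonomial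

/-! ### The program that writes the equations -/

open RAM

/-- The sum of two expressions. -/
abbrev RAM.Expr.add (a b : Expr) : Expr := .bin .add a b

/-- The truncated difference of two expressions. -/
abbrev RAM.Expr.sub (a b : Expr) : Expr := .bin .sub a b

/-- The product of two expressions. -/
abbrev RAM.Expr.mul (a b : Expr) : Expr := .bin .mul a b

/-- A power of an expression. -/
def RAM.Expr.pow (e : Expr) : ℕ → Expr
  | 0 => .const 1
  | n + 1 => .mul (e.pow n) e

theorem RAM.Expr.eval_pow (h : Store) (e : Expr) (n : ℕ) : (e.pow n).eval h = e.eval h ^ n := by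
  induction n with
  | zero => rfl
  | succ n ih => rw [pow_succ, ← ih]; rfl

namespace Layout

variable {S : Schema} {ι : Type} (A : Layout S ι)

/-- The entry at position `j` of the current tuple. -/
def posExpr : Source S → ℕ → Expr
  | .edb R, j => if j < S.edbArity R then
      .load (.add (.add (.add (.var (5 + R)) (.const 1))
        (.mul (.var 0) (.const (S.edbArity R)))) (.const j)) else .const 0
  | .idb T, j => if j < S.idbArity T then
      .load (.add (.mul (.const 1) (.var 3))
        (.bin .mod (.bin .div (.var 0) ((Expr.var 2).pow j)) (.var 2))) else .const 0

/-- The number of tuples of a source. -/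
def cardExpr : Source S → Expr
  | .edb R => .load (.var (5 + R))
  | .idb T => (Expr.var 2).pow (S.idbArity T)

/-- The number of a key of the current tuple. -/
def keyExpr (src : Source S) : List ℕ → Expr
  | [] => .const 0
  | j :: l => .add (posExpr src j) (.mul (.var 1) (keyExpr src l))

/-- The flag of the current tuple. -/
def flagExpr (src : Source S) : List (ℕ × ℕ) → Expr
  | [] => .const 1
  | p :: l => .mul (.sub (.const 1) (.add (.sub (posExpr src p.1) (posExpr src p.2))
      (.sub (posExpr src p.2) (posExpr src p.1)))) (flagExpr src l)

/-- The address of the entry for a key in the array of a block. -/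
def addrExpr (src : Source S) (s : ι) (key : List ℕ) : Expr :=
  .add (.mul (.const (A.id s + 3)) (.var 3)) (keyExpr src key)

/-- The words that describe a factor. -/
def factorExprs (src : Source S) : Factor S ι → List Expr
  | .edb R p => .const 0 :: .const R :: List.ofFn fun j => posExpr src (p j)
  | .idb T p => .const 1 :: .const T :: .const (S.idbArity T) ::
      List.ofFn fun j => posExpr src (p j)
  | .msg s key => [.const 1, .const (S.numIdb + 1 + A.id s), .const 1, .load (A.addrExpr src s key)]

/-- The words that describe a monomial. -/
def termExprs (src : Source S) (τ : Term S ι) : List Expr :=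
  [.const (τ.factors.length + 1), .const 1, .const S.numIdb, .const 1, flagExpr src τ.eqs] ++
    τ.factors.flatMap (A.factorExprs src)

/-- The words that describe an equation of a block. -/
def eqnExprs (s : ι) : List Expr :=
  match A.blk s with
  | .head T terms =>
      [.const T, .const (S.idbArity T)] ++
      (List.ofFn fun j : Fin (S.idbArity T) => posExpr (.idb T) j) ++
      [.const terms.length] ++ terms.flatMap (A.termExprs (.idb T))
  | .chain src key terms =>
      [.const (S.numIdb + 1 + A.id s), .const 1, .add (.var 0) (.const 1),
        .const (terms.length + 1), .const 1, .const 1, .const (S.numIdb + 1 + A.id s), .const 1,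
        .load (A.addrExpr src s key)] ++ terms.flatMap (A.termExprs src)

/-- After an equation has been written, the array of a block is updated. -/
def blockStores (s : ι) : List Stmt :=
  match A.blk s with
  | .head _ _ => []
  | .chain src key _ => [.store (A.addrExpr src s key) (.add (.var 0) (.const 1))]

/-- The code for a block. -/
def blockSeg (s : ι) : Seg :=
  .loop (cardExpr (A.blk s).src) ((A.eqnExprs s).map .write ++ A.blockStores s)

/-- The code that computes the position of the table of an EDB predicate. -/
def baseSegs (R : Fin S.numEdb) : List Seg :=
  [.simple (.assign (5 + R) (.var 4)),
    .simple (.assign 4 (.add (.add (.var 4) (.const 1))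
      (.mul (.load (.var 4)) (.const (S.edbArity R)))))]

/-- The code that enters the constants of a table into the list of the active domain. -/
def domSegs (R : Fin S.numEdb) : List Seg :=
  let c : Expr := .load (.add (.add (.var (5 + R)) (.const 1)) (.var 0))
  let seen : Expr := .add (.mul (.const 2) (.var 3)) c
  [.loop (.mul (.load (.var (5 + R))) (.const (S.edbArity R)))
    [.store (.add (.mul (.const 1) (.var 3)) (.var 2))
        (.mul c (.sub (.const 1) (.load seen))),
      .assign 2 (.add (.var 2) (.sub (.const 1) (.load seen))),
      .store seen (.const 1)]]

/-- The code that computes a number that exceeds all input words and the length of the input, and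
the size of the arrays. -/
def sizeSegs (w : ℕ) : List Seg :=
  [.loop (.var 4) [.assign 1 (.add (.var 1) (.sub (.load (.var 0)) (.var 1)))],
    .simple (.assign 1 (.add (.add (.var 1) (.var 4)) (.const 2))),
    .simple (.assign 3 ((Expr.var 1).pow w))]

/-- The code that writes the equation of the variable with value `1`. -/
def flagSegs (S : Schema) : List Seg :=
  ([.const S.numIdb, .const 1, .const 1, .const 1, .const 0] : List Expr).map
    fun e => .simple (.write e)

/-- The program that writes all equations. -/
def segs (w : ℕ) (order : List ι) : List Seg :=
  (List.finRange S.numEdb).flatMap baseSegs ++ (sizeSegs w ++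
    ((List.finRange S.numEdb).flatMap domSegs ++ (flagSegs S ++
      order.flatMap fun s => [A.blockSeg s])))

end Layout

/-! ### The input -/

namespace Instance

variable {S : Schema} (I : Instance S)

/-- The words that describe the table of an EDB predicate. -/
def encodeTable (R : Fin S.numEdb) : List ℕ :=
  (I.table R).length :: (I.table R).flatMap fun c => List.ofFn c

/-- The position of the table of an EDB predicate in the input. -/
def base (R : Fin S.numEdb) : ℕ :=
  (((List.finRange S.numEdb).take R).flatMap I.encodeTable).length

theorem flatMap_ofFn_length {a : ℕ} (l : List (Fin a → ℕ)) :
    (l.flatMap fun c => List.ofFn c).length = l.length * a := by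
  induction l with
  | nil => simp
  | cons c l ih => simp [ih, add_mul, add_comm]

theorem encodeTable_length (R : Fin S.numEdb) :
    (I.encodeTable R).length = 1 + (I.table R).length * S.edbArity R := by
  rw [encodeTable, List.length_cons, flatMap_ofFn_length, add_comm]

theorem finRange_prefix {n : ℕ} {u v : List (Fin n)} {R : Fin n}
    (h : List.finRange n = u ++ R :: v) : u = (List.finRange n).take R := by
  have hl : u.length = R := by
    have h1 : (List.finRange n)[u.length]? = some R := by rw [h]; simp
    rw [List.getElem?_eq_some_iff] at h1
    obtain ⟨hi, h1⟩ := h1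
    rw [List.getElem_finRange] at h1
    rw [← h1]; rfl
  rw [← hl, h]; simp

theorem encode_getD (R : Fin S.numEdb) {i : ℕ} (hi : i < (I.encodeTable R).length) :
    I.encode.getD (I.base R + i) 0 = (I.encodeTable R).getD i 0 ∧
      I.base R + i < I.encode.length := by
  obtain ⟨u, v, huv⟩ := List.append_of_mem (List.mem_finRange R)
  have hu := finRange_prefix huv
  have he : I.encode = u.flatMap I.encodeTable ++ (I.encodeTable R ++ v.flatMap I.encodeTable) := by
    change (List.finRange S.numEdb).flatMap I.encodeTable = _
    rw [huv, List.flatMap_append, List.flatMap_cons]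
  have hb : I.base R = (u.flatMap I.encodeTable).length := by rw [base, ← hu]
  rw [he, hb]
  constructor
  · rw [List.getD_append_right _ _ _ _ (by omega), List.getD_append _ _ _ _ (by omega)]
    congr 1; omega
  · simp only [List.length_append]; omega

theorem encode_getD_base (R : Fin S.numEdb) :
    I.encode.getD (I.base R) 0 = (I.table R).length := by
  have := (I.encode_getD R (i := 0) (by simp [encodeTable])).1
  simpa [encodeTable] using this

/-- The constants of a table. -/
def cells (R : Fin S.numEdb) : List ℕ := (I.table R).flatMap fun c => List.ofFn c

theorem cells_length (R : Fin S.numEdb) :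
    (I.cells R).length = (I.table R).length * S.edbArity R := flatMap_ofFn_length _

theorem encode_getD_cells (R : Fin S.numEdb) {i : ℕ} (hi : i < (I.cells R).length) :
    I.encode.getD (I.base R + 1 + i) 0 = (I.cells R).getD i 0 ∧
      I.base R + 1 + i < I.encode.length := by
  have := I.encode_getD R (i := 1 + i) (by rw [encodeTable_length, ← cells_length]; omega)
  rw [← add_assoc] at this
  refine ⟨this.1.trans ?_, this.2⟩
  rw [add_comm 1 i]; rfl

theorem flatMap_ofFn_getD {a : ℕ} (l : List (Fin a → ℕ)) {i j : ℕ} (hi : i < l.length)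
    (hj : j < a) :
    (l.flatMap fun c => List.ofFn c).getD (i * a + j) 0 = l.getD i (fun _ => 0) ⟨j, hj⟩ := by
  induction l generalizing i with
  | nil => simp at hi
  | cons c l ih =>
    rw [List.flatMap_cons]
    cases i with
    | zero =>
      rw [List.getD_append _ _ _ _ (by simpa using hj)]
      simp [List.getD_eq_getElem?_getD, hj]
    | succ i =>
      rw [List.getD_append_right _ _ _ _ (by simp [add_mul]; omega)]
      have := ih (i := i) (by simpa using hi)
      rw [List.getD_cons_succ, ← this]
      congr 1
      rw [List.length_ofFn, add_mul]; omega

theorem encode_getD_row (R : Fin S.numEdb) {i j : ℕ} (hi : i < (I.table R).length)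
    (hj : j < S.edbArity R) :
    I.encode.getD (I.base R + 1 + i * S.edbArity R + j) 0
      = (I.table R).getD i (fun _ => 0) ⟨j, hj⟩ ∧
      I.base R + 1 + i * S.edbArity R + j < I.encode.length := by
  have hlt : i * S.edbArity R + j < (I.cells R).length := by
    rw [cells_length]
    calc i * S.edbArity R + j < (i + 1) * S.edbArity R := by rw [add_mul]; omega
      _ ≤ _ := Nat.mul_le_mul_right _ hi
  have := I.encode_getD_cells R hlt
  rw [← add_assoc] at this
  exact ⟨this.1.trans (flatMap_ofFn_getD _ hi hj), this.2⟩

/-- The largest of the first `i` input words. -/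
def maxWord (i : ℕ) : ℕ := (Finset.range i).sup fun j => I.encode.getD j 0

/-- A number that exceeds all input words and the length of the input. -/
def radix : ℕ := I.maxWord I.encode.length + I.encode.length + 2

theorem encode_getD_le (i : ℕ) : I.encode.getD i 0 ≤ I.maxWord I.encode.length := by
  by_cases h : i < I.encode.length
  · exact Finset.le_sup (f := fun j => I.encode.getD j 0) (Finset.mem_range.2 h)
  · rw [List.getD_eq_default _ _ (by omega)]; exact Nat.zero_le _

theorem maxWord_mono {i : ℕ} (h : i ≤ I.encode.length) :
    I.maxWord i ≤ I.maxWord I.encode.length :=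
  Finset.sup_mono (by simpa using h)

/-- Append a constant to a list unless it is there. -/
def insertNew (dom : List ℕ) (c : ℕ) : List ℕ := if c ∈ dom then dom else dom ++ [c]

/-- The list of the constants that occur in a list of constants. -/
def listDom (l : List ℕ) : List ℕ := l.foldl insertNew []

/-- An enumeration of the active domain. -/
def domList : List ℕ := listDom ((List.finRange S.numEdb).flatMap I.cells)

theorem listDom_concat (l : List ℕ) (c : ℕ) : listDom (l ++ [c]) = insertNew (listDom l) c := by
  simp [listDom]

theorem mem_listDom {l : List ℕ} {c : ℕ} : c ∈ listDom l ↔ c ∈ l := by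
  induction l using List.reverseRecOn generalizing c with
  | nil => simp [listDom]
  | append_singleton l a ih =>
    rw [listDom_concat, insertNew]
    split
    · next h =>
      rw [ih] at h
      simp only [ih, List.mem_append, List.mem_singleton]
      exact ⟨Or.inl, fun h' => h'.elim id fun h'' => h'' ▸ h⟩
    · simp [ih]

theorem nodup_listDom (l : List ℕ) : (listDom l).Nodup := by
  induction l using List.reverseRecOn with
  | nil => simp [listDom]
  | append_singleton l a ih =>
    rw [listDom_concat, insertNew]
    split
    · exact ih
    · rw [List.nodup_append]
      refine ⟨ih, by simp, ?_⟩
      rintro x hx y hy rfl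
      simp at hy; subst hy; contradiction

theorem listDom_length_le {l : List ℕ} {b : ℕ} (h : ∀ c ∈ l, c ≤ b) :
    (listDom l).length ≤ b + 1 := by
  rw [← List.toFinset_card_of_nodup (nodup_listDom l)]
  calc _ ≤ (Finset.range (b + 1)).card := Finset.card_le_card fun c hc => by
        rw [List.mem_toFinset, mem_listDom] at hc
        simpa [Nat.lt_succ_iff] using h c hc
    _ = b + 1 := Finset.card_range _

theorem toFinset_domList : I.domList.toFinset = I.adom := by
  ext c
  simp only [domList, List.mem_toFinset, mem_listDom, cells, adom, List.mem_flatMap,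
    List.mem_finRange, true_and, Finset.mem_biUnion, Finset.mem_univ, Finset.mem_image,
    List.mem_ofFn]

theorem domList_length : I.domList.length = I.adom.card := by
  rw [← toFinset_domList, domList, List.toFinset_card_of_nodup (nodup_listDom _)]

theorem le_maxWord_of_mem_cells {R : Fin S.numEdb} {c : ℕ} (hc : c ∈ I.cells R) :
    c ≤ I.maxWord I.encode.length := by
  obtain ⟨i, hi, rfl⟩ := List.mem_iff_getElem.1 hc
  have := (I.encode_getD_cells R hi).1
  rw [List.getD_eq_getElem _ _ hi] at this
  rw [← this]; exact I.encode_getD_le _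

theorem le_maxWord_of_mem_domList {c : ℕ} (hc : c ∈ I.domList) :
    c ≤ I.maxWord I.encode.length := by
  rw [domList, mem_listDom, List.mem_flatMap] at hc
  obtain ⟨R, -, hR⟩ := hc
  exact I.le_maxWord_of_mem_cells hR

/-- The listed constants are distinct and none exceeds the largest input word. -/
theorem domList_length_lt : I.domList.length < I.radix := by
  have := listDom_length_le (l := (List.finRange S.numEdb).flatMap I.cells)
    (b := I.maxWord I.encode.length) (fun c hc => by
      obtain ⟨R, -, hR⟩ := List.mem_flatMap.1 hc
      exact I.le_maxWord_of_mem_cells hR)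
  rw [domList, radix]; omega

theorem domList_getD_lt (i : ℕ) : I.domList.getD i 0 < I.radix := by
  rw [radix]
  by_cases h : i < I.domList.length
  · rw [List.getD_eq_getElem _ _ h]
    have := I.le_maxWord_of_mem_domList (List.getElem_mem h)
    omega
  · rw [List.getD_eq_default _ _ (by omega)]; omega

theorem table_length_lt (R : Fin S.numEdb) : (I.table R).length < I.radix := by
  rw [← encode_getD_base, radix]
  have := I.encode_getD_le (I.base R)
  omega

end Instance

theorem Source.row_lt {S : Schema} (I : Instance S) (src : Source S) {i : ℕ}
    (hi : i < src.card I I.domList) (j : ℕ) : src.row I I.domList i j < I.radix := by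
  have h0 : 0 < I.radix := by rw [Instance.radix]; omega
  cases src with
  | edb R =>
    simp only [row]
    split
    · next h =>
      have := (I.encode_getD_row R hi h).1
      rw [← this, Instance.radix]
      have := I.encode_getD_le (I.base R + 1 + i * S.edbArity R + j)
      omega
    · exact h0
  | idb T =>
    simp only [row]
    split
    · exact I.domList_getD_lt _
    · exact h0

/-- Keys of at most `w` constants are numbers with `w` digits to base `N`, so an array of `N ^ w`
words has a cell for each of them. -/
theorem keyCode_lt {N w : ℕ} (hN : 2 ≤ N) {key : List ℕ} (hw : key.length ≤ w) {r : ℕ → ℕ}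
    (hr : ∀ j, r j < N) : keyCode N key r < N ^ w := by
  refine (Nat.ofDigits_lt_base_pow_length (by omega) ?_).trans_le
    (Nat.pow_le_pow_right (by omega) (by simpa using hw))
  simp only [List.mem_map, forall_exists_index, and_imp, forall_apply_eq_imp_iff₂]
  exact fun j _ => hr j

end Datalog

namespace Datalog

open RAM

/-! ### Paged memory -/

/-- A memory that consists of pages of `W` words. -/
def pagedMem (W : ℕ) (c : ℕ → ℕ → ℕ) (a : ℕ) : ℕ := c (a / W) (a % W)

theorem pagedMem_apply {W r : ℕ} (c : ℕ → ℕ → ℕ) (q : ℕ) (hr : r < W) :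
    pagedMem W c (q * W + r) = c q r := by
  have hW : 0 < W := by omega
  rw [pagedMem, mul_comm, Nat.mul_add_div hW, Nat.div_eq_of_lt hr, Nat.mul_add_mod,
    Nat.mod_eq_of_lt hr, add_zero]

theorem pagedMem_update {W r : ℕ} (c : ℕ → ℕ → ℕ) (q v : ℕ) (hr : r < W) :
    Function.update (pagedMem W c) (q * W + r) v
      = pagedMem W (Function.update c q (Function.update (c q) r v)) := by
  have hW : 0 < W := by omega
  funext a
  by_cases ha : a = q * W + r
  · subst ha
    rw [Function.update_self, pagedMem_apply _ _ hr, Function.update_self, Function.update_self]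
  · rw [Function.update_of_ne ha, pagedMem, pagedMem]
    by_cases hq : a / W = q
    · have hne : a % W ≠ r := by
        rintro rfl
        apply ha
        rw [← hq, mul_comm]
        exact (Nat.div_add_mod a W).symm
      rw [hq, Function.update_self, Function.update_of_ne hne]
    · rw [Function.update_of_ne hq]

/-- The pages: the input, the list of the active domain, the marks of its elements, and the arrays
of the blocks. -/
def content (p₀ p₁ p₂ : ℕ → ℕ) (last : ℕ → ℕ → ℕ) : ℕ → ℕ → ℕ
  | 0 => p₀
  | 1 => p₁
  | 2 => p₂
  | q + 3 => last q

theorem content_update_one (p₀ p₁ p₂ p : ℕ → ℕ) (last : ℕ → ℕ → ℕ) :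
    Function.update (content p₀ p₁ p₂ last) 1 p = content p₀ p p₂ last := by
  funext q
  match q with
  | 0 => rfl
  | 1 => rfl
  | 2 => rfl
  | q + 3 => rfl

theorem content_update_two (p₀ p₁ p₂ p : ℕ → ℕ) (last : ℕ → ℕ → ℕ) :
    Function.update (content p₀ p₁ p₂ last) 2 p = content p₀ p₁ p last := by
  funext q
  match q with
  | 0 => rfl
  | 1 => rfl
  | 2 => rfl
  | q + 3 => rfl

theorem content_update_add_three (p₀ p₁ p₂ p : ℕ → ℕ) (last : ℕ → ℕ → ℕ) (t : ℕ) :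
    Function.update (content p₀ p₁ p₂ last) (t + 3) p
      = content p₀ p₁ p₂ (Function.update last t p) := by
  funext q
  match q with
  | 0 => rfl
  | 1 => rfl
  | 2 => rfl
  | q + 3 =>
    by_cases h : q = t
    · subst h; simp [content]
    · rw [Function.update_of_ne (by omega)]; simp [content, h]

/-! ### Bounds of stores -/

theorem RAM.Store.Below.assign {B : ℕ} {h : Store} (hh : h.Below B) {x v : ℕ} (hv : v < B) :
    Store.Below B { h with var := Function.update h.var x v } := by
  intro a
  refine ⟨?_, (hh a).2⟩
  by_cases ha : a = x
  · subst ha; simpa using hv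
  · simpa [Function.update_of_ne ha] using (hh a).1

theorem RAM.Store.Below.store {B : ℕ} {h : Store} (hh : h.Below B) {x v : ℕ} (hv : v < B) :
    Store.Below B { h with mem := Function.update h.mem x v } := by
  intro a
  refine ⟨(hh a).1, ?_⟩
  by_cases ha : a = x
  · subst ha; simpa using hv
  · simpa [Function.update_of_ne ha] using (hh a).2

theorem RAM.Store.Below.out {B : ℕ} {h : Store} (hh : h.Below B) (o : List ℕ) :
    Store.Below B { h with out := o } := hh

theorem RAM.Expr.eval_out (h : Store) (o : List ℕ) (e : Expr) :
    e.eval { h with out := o } = e.eval h := by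
  induction e with
  | const n => rfl
  | var x => rfl
  | bin f a b iha ihb => simp only [Expr.eval, iha, ihb]
  | load a iha => simp only [Expr.eval, iha]

theorem RAM.execs_append (l l' : List Stmt) (h : Store) :
    execs (l ++ l') h = execs l' (execs l h) := by simp [execs]

theorem RAM.execs_writes (l : List Expr) (h : Store) :
    execs (l.map .write) h = { h with out := h.out ++ l.map (Expr.eval h) } := by
  induction l generalizing h with
  | nil => simp [execs]
  | cons e l ih =>
    have : execs ((e :: l).map .write) h
        = execs (l.map .write) { h with out := h.out ++ [e.eval h] } := rfl
    rw [this, ih]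
    simp [Expr.eval_out]

theorem RAM.okStmts_writes {B : ℕ} (l : List Expr) {l' : List Stmt} {h : Store} (hh : h.Below B)
    (h' : OkStmts B l' (execs (l.map .write) h)) : OkStmts B (l.map .write ++ l') h := by
  induction l generalizing h with
  | nil => exact h'
  | cons e l ih => exact ⟨hh, ih (hh.out _) h'⟩

/-! ### Correctness of the program -/

/-- The state of the program between two loops. -/
structure State {S : Schema} (I : Instance S) (B N n W : ℕ) (mem : ℕ → ℕ) (out : List ℕ)
    (h : Store) : Prop where
  var_one : h.var 1 = N
  var_two : h.var 2 = n
  var_three : h.var 3 = W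
  var_four : h.var 4 = I.encode.length
  var_base : ∀ R : Fin S.numEdb, h.var (5 + R) = I.base R
  mem_eq : h.mem = mem
  out_eq : h.out = out
  below : h.Below B

section

variable {S : Schema} {I : Instance S} {B X : ℕ}

theorem State.setIdx {N n W : ℕ} {mem : ℕ → ℕ} {out : List ℕ} {h : Store}
    (hs : State I B N n W mem out h) {i : ℕ} (hi : i < B) :
    State I B N n W mem out (h.setIdx i) where
  var_one := hs.var_one
  var_two := hs.var_two
  var_three := hs.var_three
  var_four := hs.var_four
  var_base R := by
    rw [← hs.var_base R]
    simp [Store.setIdx, Function.update_of_ne]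
  mem_eq := hs.mem_eq
  out_eq := hs.out_eq
  below := hs.below.assign hi

theorem setIdx_var_zero (h : Store) (i : ℕ) : (h.setIdx i).var 0 = i := by simp [Store.setIdx]

theorem encode_getD_lt (hB : I.radix < B) (i : ℕ) : I.encode.getD i 0 < B := by
  have := I.encode_getD_le i
  rw [Instance.radix] at hB
  omega

/-- A table begins with its number of rows, so its end is found in constant time without reading it.
Variable 4 runs through these ends and finally contains the length of the input. -/
theorem base_triple (hB : I.radix < B) :
    Triple B X (fun h => h = inputStore I.encode) ((List.finRange S.numEdb).flatMap Layout.baseSegs)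
      (State I B 0 0 0 (fun i => I.encode.getD i 0) []) := by
  have hlen : I.encode.length < B := by rw [Instance.radix] at hB; omega
  have key := Triple.flatMap (B := B) (X := X) Layout.baseSegs
    (fun u h => h.var 1 = 0 ∧ h.var 2 = 0 ∧ h.var 3 = 0 ∧
      h.var 4 = (u.flatMap I.encodeTable).length ∧
      (∀ R ∈ u, h.var (5 + R) = I.base R) ∧ h.mem = (fun i => I.encode.getD i 0) ∧ h.out = [] ∧
      h.Below B) (List.finRange S.numEdb) (by
    rintro u R v huv h ⟨h1, h2, h3, h4, h5, hm, ho, hb⟩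
    have hbase : (u.flatMap I.encodeTable).length = I.base R := by
      rw [Instance.base, ← Instance.finRange_prefix huv]
    rw [hbase] at h4
    have hend : I.base R + 1 + (I.table R).length * S.edbArity R
        = ((u ++ [R]).flatMap I.encodeTable).length := by
      rw [List.flatMap_append, List.length_append, hbase, List.flatMap_singleton,
        I.encodeTable_length, add_assoc]
    have hend' : I.base R + 1 + (I.table R).length * S.edbArity R ≤ I.encode.length := by
      rw [hend]
      change _ ≤ ((List.finRange S.numEdb).flatMap I.encodeTable).length
      rw [huv, List.flatMap_append, List.flatMap_append, List.flatMap_cons]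
      simp
    have hb1 : Store.Below B { h with var := Function.update h.var (5 + R) (h.var 4) } :=
      hb.assign (by omega)
    have he : (Function.update h.var (5 + R.val) (h.var 4)) 4 = I.base R := by
      rw [Function.update_of_ne (by omega), h4]
    have hev : Expr.eval { h with var := Function.update h.var (5 + R) (h.var 4) }
        (.add (.add (.var 4) (.const 1)) (.mul (.load (.var 4)) (.const (S.edbArity R))))
        = I.base R + 1 + (I.table R).length * S.edbArity R := by
      simp only [Expr.eval, BinOp.eval, he, hm, I.encode_getD_base]
    refine ⟨⟨⟨hb, hb1⟩, ⟨hb1, hb1.assign ?_⟩, trivial⟩, ?_⟩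
    · exact hev.trans_lt (by omega)
    · simp only [Layout.baseSegs, progExec, List.foldl_cons, List.foldl_nil, Seg.exec, Stmt.exec]
      rw [show Expr.eval h (.var 4) = h.var 4 from rfl, hev]
      refine ⟨?_, ?_, ?_, ?_, ?_, hm, ho, hb1.assign (by omega)⟩
      · rw [Function.update_of_ne (by omega), Function.update_of_ne (by omega), h1]
      · rw [Function.update_of_ne (by omega), Function.update_of_ne (by omega), h2]
      · rw [Function.update_of_ne (by omega), Function.update_of_ne (by omega), h3]
      · rw [Function.update_self, hend]
      · intro R' hR'
        rw [Function.update_of_ne (by omega)]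
        by_cases hRR : R' = R
        · subst hRR; rw [Function.update_self]; exact h4
        · rw [Function.update_of_ne (by omega)]
          simp only [List.mem_append, List.mem_singleton, hRR, or_false] at hR'
          exact h5 R' hR')
  intro h hh
  obtain ⟨k1, h1, h2, h3, h4, h5, hm, ho, hb⟩ := key h (by
    subst hh
    exact ⟨rfl, rfl, rfl, rfl, by simp, rfl, rfl, fun a => ⟨by simp [inputStore]; omega,
      encode_getD_lt hB a⟩⟩)
  exact ⟨k1, h1, h2, h3, h4, fun R => h5 R (List.mem_finRange R), hm, ho, hb⟩

theorem State.assign_var {N n W : ℕ} {mem : ℕ → ℕ} {out : List ℕ} {h : Store}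
    (hs : State I B N n W mem out h) (N' n' W' : ℕ) {x v : ℕ} (hx : x < 4) (hv : v < B)
    (h1 : N' = if x = 1 then v else N) (h2 : n' = if x = 2 then v else n)
    (h3 : W' = if x = 3 then v else W) :
    State I B N' n' W' mem out { h with var := Function.update h.var x v } where
  var_one := by simp only [Function.update_apply, h1, ← hs.var_one, eq_comm]
  var_two := by simp only [Function.update_apply, h2, ← hs.var_two, eq_comm]
  var_three := by simp only [Function.update_apply, h3, ← hs.var_three, eq_comm]
  var_four := by rw [← hs.var_four]; exact Function.update_of_ne (by omega) _ _
  var_base R := by rw [← hs.var_base R]; exact Function.update_of_ne (by omega) _ _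
  mem_eq := hs.mem_eq
  out_eq := hs.out_eq
  below := hs.below.assign hv

/-- The memory after the computation of the size of the arrays, for given contents of the list of
the active domain and of the arrays of the blocks. -/
def memory (I : Instance S) (W : ℕ) (dom : List ℕ) (last : ℕ → ℕ → ℕ) : ℕ → ℕ :=
  pagedMem W (content (fun i => I.encode.getD i 0) (fun i => dom.getD i 0)
    (fun c => if c ∈ dom then 1 else 0) last)

/-- The input fits on page 0 and the rest of the memory is initially 0, which is what empty pages
contain. No time is spent on initialising the arrays. -/
theorem memory_nil {W : ℕ} (hW : I.radix ≤ W) :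
    memory I W [] (fun _ _ => 0) = fun i => I.encode.getD i 0 := by
  have hlen : I.encode.length < W := by rw [Instance.radix] at hW; omega
  funext a
  rw [memory, pagedMem]
  by_cases ha : a < W
  · rw [Nat.div_eq_of_lt ha, Nat.mod_eq_of_lt ha]; rfl
  · rw [List.getD_eq_default _ _ (by omega)]
    have : a / W ≠ 0 := by
      rw [Nat.div_ne_zero_iff]; omega
    match h : a / W with
    | 0 => exact absurd h this
    | 1 => simp [content]
    | 2 => simp [content]
    | q + 3 => simp [content]

theorem size_triple {w : ℕ} (hw : 1 ≤ w) (hB : I.radix ^ w < B) (hX : I.encode.length ≤ X) :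
    Triple B X (State I B 0 0 0 (fun i => I.encode.getD i 0) []) (Layout.sizeSegs w)
      (State I B I.radix 0 (I.radix ^ w) (memory I (I.radix ^ w) [] fun _ _ => 0) []) := by
  have hN : I.radix ≤ I.radix ^ w := Nat.le_self_pow (by omega) _
  rw [memory_nil hN]
  have hB' : I.radix < B := by omega
  have hlen : I.maxWord I.encode.length + I.encode.length + 2 < B := hB'
  refine Triple.append (p := [_]) (q := [_, _])
    (Q := State I B (I.maxWord I.encode.length) 0 0 (fun i => I.encode.getD i 0) []) ?_ ?_
  · refine Triple.loop I.encode.length hX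
      (fun i h => h.var 0 = i ∧ State I B (I.maxWord i) 0 0 (fun i => I.encode.getD i 0) [] h)
      ?_ ?_ ?_ ?_
    · intro h hs
      exact ⟨hs.below, hs.var_four, setIdx_var_zero _ _, hs.setIdx (by omega)⟩
    · exact fun i _ h hs => ⟨hs.2.below, hs.1⟩
    · rintro i hi h ⟨h0, hs⟩
      -- Truncated subtraction gives a maximum without branching: `x + (y - x) = max x y`.
      have hm : I.maxWord i + (I.encode.getD i 0 - I.maxWord i) = I.maxWord (i + 1) := by
        rw [Instance.maxWord, Instance.maxWord, Finset.range_add_one, Finset.sup_insert]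
        generalize (Finset.range i).sup (fun j => I.encode.getD j 0) = x
        generalize I.encode.getD i 0 = y
        rcases le_total x y with h | h
        · rw [sup_eq_left.2 h]; omega
        · rw [sup_eq_right.2 h]; omega
      have hev : Expr.eval h (.add (.var 1) (.sub (.load (.var 0)) (.var 1)))
          = I.maxWord (i + 1) := by
        simp only [Expr.eval, BinOp.eval, h0, hs.var_one, hs.mem_eq, hm]
      have hlt : I.maxWord (i + 1) < B := (I.maxWord_mono (by omega)).trans_lt (by omega)
      have hs' := hs.assign_var (I.maxWord (i + 1)) 0 0 (x := 1) (by omega) hlt rfl rfl rfl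
      have h0' : (Function.update h.var 1 (I.maxWord (i + 1))) 0 = i := by
        rw [Function.update_of_ne (by omega), h0]
      simp only [OkStmts, iter, execs, List.foldl_cons, List.foldl_nil, Stmt.exec, hev, h0',
        setIdx_var_zero, true_and]
      exact ⟨⟨hs.below, hs'.below⟩, hs'.setIdx (by omega)⟩
    · exact fun h hs => hs.2
  · intro h hs
    have hev : Expr.eval h (.add (.add (.var 1) (.var 4)) (.const 2)) = I.radix := by
      simp only [Expr.eval, BinOp.eval, hs.var_one, hs.var_four, Instance.radix]
    have hs' := hs.assign_var I.radix 0 0 (x := 1) (by omega) hB' rfl rfl rfl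
    have hev' : Expr.eval { h with var := Function.update h.var 1 I.radix } ((Expr.var 1).pow w)
        = I.radix ^ w := by
      simp [Expr.eval_pow, Expr.eval]
    have hs'' := hs'.assign_var I.radix 0 (I.radix ^ w) (x := 3) (by omega) hB rfl rfl rfl
    simp only [ProgOk, Seg.Ok, progExec, List.foldl_cons, List.foldl_nil, Seg.exec, Stmt.exec,
      hev, hev']
    exact ⟨⟨⟨hs.below, hs'.below⟩, ⟨hs'.below, hs''.below⟩, trivial⟩, hs''⟩

/-- Insertion without branching: for a constant already seen, the value written behind the end of
the list is 0, which is the default value there. -/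
theorem getD_insertNew (dom : List ℕ) (c : ℕ) :
    (fun i => (Instance.insertNew dom c).getD i 0)
      = Function.update (fun i => dom.getD i 0) dom.length
        (c * (1 - if c ∈ dom then 1 else 0)) := by
  funext i
  rw [Function.update_apply, Instance.insertNew]
  by_cases hc : c ∈ dom
  · simp only [hc, if_true]
    split
    · next h => rw [List.getD_eq_default _ _ (by omega)]; simp
    · rfl
  · simp only [hc, if_false]
    split
    · next h => subst h; simp
    · next h =>
      rcases lt_or_gt_of_ne h with h | h
      · rw [List.getD_append _ _ _ _ h]
      · rw [List.getD_eq_default _ _ (by simp; omega), List.getD_eq_default _ _ (by omega)]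

theorem mem_insertNew (dom : List ℕ) (c : ℕ) :
    (fun x => if x ∈ Instance.insertNew dom c then 1 else 0)
      = Function.update (fun x => if x ∈ dom then 1 else 0) c 1 := by
  funext x
  rw [Function.update_apply, Instance.insertNew]
  by_cases hx : x = c
  · subst hx
    split <;> simp_all
  · split <;> simp [hx]

theorem length_insertNew (dom : List ℕ) (c : ℕ) :
    (Instance.insertNew dom c).length = dom.length + (1 - if c ∈ dom then 1 else 0) := by
  rw [Instance.insertNew]
  split <;> simp

/-- Page 2, indexed by the constants themselves, marks those already seen. Duplicates are therefore
detected in constant time, and the whole enumeration is linear in the input. -/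
theorem dom_triple {w : ℕ} (hw : 1 ≤ w) (hB : I.radix ^ w < B)
    (hX : ∀ R, (I.cells R).length ≤ X) :
    Triple B X (State I B I.radix 0 (I.radix ^ w) (memory I (I.radix ^ w) [] fun _ _ => 0) [])
      ((List.finRange S.numEdb).flatMap Layout.domSegs)
      (State I B I.radix I.domList.length (I.radix ^ w)
        (memory I (I.radix ^ w) I.domList fun _ _ => 0) []) := by
  have hN : I.radix ≤ I.radix ^ w := Nat.le_self_pow (by omega) _
  have hB' : I.radix < B := by omega
  generalize hWdef : I.radix ^ w = W at *
  let Inv (l : List ℕ) : Store → Prop := State I B I.radix (Instance.listDom l).length W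
    (memory I W (Instance.listDom l) fun _ _ => 0) []
  refine Triple.flatMap Layout.domSegs (fun u => Inv (u.flatMap I.cells)) _ ?_
  intro u R v huv
  have hlenR : (I.cells R).length < I.radix := by
    by_cases h0 : (I.cells R).length = 0
    · rw [Instance.radix]; omega
    · have := (I.encode_getD_cells R (i := (I.cells R).length - 1) (by omega)).2
      rw [Instance.radix]; omega
  refine Triple.loop (I.cells R).length (hX R)
      (fun i h => h.var 0 = i ∧ Inv (u.flatMap I.cells ++ (I.cells R).take i) h) ?_ ?_ ?_ ?_
  · intro h hs
    refine ⟨hs.below, ?_, setIdx_var_zero _ _, ?_⟩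
    · simp only [Expr.eval, BinOp.eval, hs.var_base, hs.mem_eq, memory]
      have := pagedMem_apply (W := W) (content (fun i => I.encode.getD i 0)
        (fun i => (Instance.listDom (u.flatMap I.cells)).getD i 0)
        (fun c => if c ∈ Instance.listDom (u.flatMap I.cells) then 1 else 0) fun _ _ => 0) 0
        (r := I.base R) (by
          have := (I.encode_getD R (i := 0) (by simp [Instance.encodeTable])).2
          rw [Instance.radix] at hN; omega)
      rw [Nat.zero_mul, Nat.zero_add] at this
      rw [this, I.cells_length]
      simp only [content, I.encode_getD_base]
    · simpa using State.setIdx hs (i := 0) (by omega)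
  · exact fun i _ h hs => ⟨hs.2.below, hs.1⟩
  · rintro i hi h ⟨h0, hs⟩
    obtain ⟨hcell, hpos⟩ := I.encode_getD_cells R hi
    have htake : u.flatMap I.cells ++ (I.cells R).take (i + 1)
        = (u.flatMap I.cells ++ (I.cells R).take i) ++ [(I.cells R).getD i 0] := by
      rw [List.take_add_one, List.getD_eq_getElem _ _ hi, List.getElem?_eq_getElem hi,
        ← List.append_assoc]
      rfl
    simp only [Inv] at hs ⊢
    rw [htake, Instance.listDom_concat]
    have hdlen : (Instance.listDom (u.flatMap I.cells ++ (I.cells R).take i)).length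
        < I.radix := by
      refine (Instance.listDom_length_le (b := I.maxWord I.encode.length) ?_).trans_lt
        (by rw [Instance.radix]; omega)
      intro c hc
      rcases List.mem_append.1 hc with hc | hc
      · obtain ⟨R', -, hR'⟩ := List.mem_flatMap.1 hc
        exact I.le_maxWord_of_mem_cells hR'
      · exact I.le_maxWord_of_mem_cells (List.mem_of_mem_take hc)
    have hclt : (I.cells R).getD i 0 < I.radix := by
      rw [List.getD_eq_getElem _ _ hi, Instance.radix]
      have := I.le_maxWord_of_mem_cells (List.getElem_mem hi)
      omega
    generalize hc : (I.cells R).getD i 0 = c at *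
    generalize Instance.listDom (u.flatMap I.cells ++ (I.cells R).take i) = dom at *
    have hlt : I.base R + 1 + i < W := by rw [Instance.radix] at hN; omega
    -- the values of the two cells that are read
    have hload : ∀ p₁ p₂ : ℕ → ℕ, pagedMem W (content (fun i => I.encode.getD i 0) p₁ p₂
        fun _ _ => 0) (I.base R + 1 + i) = c := by
      intro p₁ p₂
      have := pagedMem_apply (content (fun i => I.encode.getD i 0) p₁ p₂ fun _ _ => 0) 0 hlt
      rw [Nat.zero_mul, Nat.zero_add] at this
      rw [this]; exact hcell
    have hseen : ∀ p₁ : ℕ → ℕ, pagedMem W (content (fun i => I.encode.getD i 0) p₁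
        (fun x => if x ∈ dom then 1 else 0) fun _ _ => 0) (2 * W + c)
        = if c ∈ dom then 1 else 0 := by
      intro p₁
      rw [pagedMem_apply _ _ (by omega)]; rfl
    set v₁ := c * (1 - if c ∈ dom then 1 else 0) with hv₁
    have hv₁B : v₁ < B := by rw [hv₁]; split <;> simp <;> omega
    set mem₁ := pagedMem W (content (fun i => I.encode.getD i 0)
      (fun i => (Instance.insertNew dom c).getD i 0) (fun x => if x ∈ dom then 1 else 0)
      fun _ _ => 0) with hmem₁
    have hm : h.mem = memory I W dom fun _ _ => 0 := hs.mem_eq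
    have hup₁ : Function.update h.mem (1 * W + dom.length) v₁ = mem₁ := by
      rw [hm, memory, pagedMem_update _ _ _ (by omega), content_update_one, hmem₁,
        getD_insertNew]
      rfl
    have hup₂ : Function.update mem₁ (2 * W + c) 1
        = memory I W (Instance.insertNew dom c) fun _ _ => 0 := by
      rw [hmem₁, memory, pagedMem_update _ _ _ (by omega), content_update_two, mem_insertNew]
      rfl
    have hs₁ : State I B I.radix dom.length W mem₁ [] { h with mem := mem₁ } :=
      ⟨hs.var_one, hs.var_two, hs.var_three, hs.var_four, hs.var_base, rfl, hs.out_eq,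
        hup₁ ▸ hs.below.store hv₁B⟩
    have hs₂ := hs₁.assign_var I.radix (Instance.insertNew dom c).length W (x := 2)
      (v := (Instance.insertNew dom c).length) (by omega)
      (by rw [length_insertNew]; split <;> omega) rfl rfl rfl
    have hs₃ : State I B I.radix (Instance.insertNew dom c).length W
        (memory I W (Instance.insertNew dom c) fun _ _ => 0) []
        { var := Function.update h.var 2 (Instance.insertNew dom c).length
          mem := memory I W (Instance.insertNew dom c) fun _ _ => 0
          out := h.out } :=
      ⟨hs₂.var_one, hs₂.var_two, hs₂.var_three, hs₂.var_four, hs₂.var_base, rfl, hs₂.out_eq,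
        hup₂ ▸ hs₂.below.store (by omega)⟩
    have hbR := hs₂.var_base R
    simp only at hbR
    have h0' : (Function.update h.var 2 (Instance.insertNew dom c).length) 0 = i := by
      rw [Function.update_of_ne (by omega), h0]
    have h3' : (Function.update h.var 2 (Instance.insertNew dom c).length) 3 = W := hs₂.var_three
    -- The new list entry and the new length both depend on the old mark, so the mark is set last.
    have e₁ : Stmt.exec h (.store (.add (.mul (.const 1) (.var 3)) (.var 2))
        (.mul (.load (.add (.add (.var (5 + R)) (.const 1)) (.var 0)))
          (.sub (.const 1) (.load (.add (.mul (.const 2) (.var 3))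
            (.load (.add (.add (.var (5 + R)) (.const 1)) (.var 0))))))))
        = { h with mem := mem₁ } := by
      simp only [Stmt.exec, Expr.eval, BinOp.eval, hs.var_three, hs.var_two, hs.var_base, h0]
      rw [← hup₁, hm, memory, hload, hseen]
    have e₂ : Stmt.exec { h with mem := mem₁ } (.assign 2 (.add (.var 2)
        (.sub (.const 1) (.load (.add (.mul (.const 2) (.var 3))
            (.load (.add (.add (.var (5 + R)) (.const 1)) (.var 0))))))))
        = { var := Function.update h.var 2 (Instance.insertNew dom c).length
            mem := mem₁
            out := h.out } := by
      simp only [Stmt.exec, Expr.eval, BinOp.eval, hs.var_three, hs.var_two, hs.var_base, h0]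
      rw [hmem₁, hload, hseen, length_insertNew]
    have e₃ : Stmt.exec { var := Function.update h.var 2 (Instance.insertNew dom c).length
                          mem := mem₁
                          out := h.out } (.store (.add (.mul (.const 2) (.var 3))
            (.load (.add (.add (.var (5 + R)) (.const 1)) (.var 0)))) (.const 1))
        = { var := Function.update h.var 2 (Instance.insertNew dom c).length
            mem := memory I W (Instance.insertNew dom c) fun _ _ => 0
            out := h.out } := by
      simp only [Stmt.exec, Expr.eval, BinOp.eval, h3', hbR, h0']
      rw [← hup₂]
      congr 2
      rw [hmem₁, hload]
    simp only [OkStmts, iter, execs, List.foldl_cons, List.foldl_nil, e₁, e₂, e₃, h0',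
      setIdx_var_zero, true_and]
    exact ⟨⟨hs.below, hs₁.below, hs₂.below, hs₃.below⟩, hs₃.setIdx (by omega)⟩
  · intro h hs
    have := hs.2
    simpa [Inv] using this

/-- The words say: predicate `S.numIdb` with one argument, namely 1, has one monomial, and this
monomial has no factors. The empty product has the value 1. -/
theorem flag_triple {N n W : ℕ} {mem : ℕ → ℕ} :
    Triple B X (State I B N n W mem []) (Layout.flagSegs S)
      (State I B N n W mem [S.numIdb, 1, 1, 1, 0]) := by
  intro h hs
  have hb := hs.below
  refine ⟨?_, ?_⟩
  · simp only [Layout.flagSegs, List.map_cons, List.map_nil, ProgOk, Seg.Ok, and_true]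
    exact ⟨⟨hb, hb⟩, ⟨hb, hb⟩, ⟨hb, hb⟩, ⟨hb, hb⟩, ⟨hb, hb⟩⟩
  · exact ⟨hs.var_one, hs.var_two, hs.var_three, hs.var_four, hs.var_base, hs.mem_eq, by
      simp [Layout.flagSegs, progExec, Seg.exec, Stmt.exec, hs.out_eq, Expr.eval], hb⟩

end

end Datalog

/-! ### Evaluation of the expressions of a block. -/

namespace Datalog

open RAM

/-- A factor that fits arrays for keys of length `w`, and refers only to the blocks in a list. -/
def Factor.Fits {S : Schema} {ι : Type} (w : ℕ) (u : List ι) : Factor S ι → Prop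
  | .edb _ _ => True
  | .idb _ _ => True
  | .msg s key => s ∈ u ∧ key.length ≤ w

/-- A block that fits arrays for keys of length `w`, and refers only to the blocks in a list. -/
structure Block.Fits {S : Schema} {ι : Type} (w : ℕ) (u : List ι) (b : Block S ι) : Prop where
  arity : b.src.arity ≤ w
  key : ∀ src key terms, b = .chain src key terms → key.length ≤ w
  factors : ∀ τ ∈ b.terms, ∀ f ∈ τ.factors, f.Fits w u

section

variable {S : Schema} {ι : Type} {A : Layout S ι} {I : Instance S} {B X w : ℕ}

/-- The state of the program when it processes the tuple number `i` of a block. -/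
structure BlockState (I : Instance S) (B w : ℕ) (last : ℕ → ℕ → ℕ) (out : List ℕ) (i : ℕ)
    (h : Store) : Prop extends State I B I.radix I.domList.length (I.radix ^ w)
      (memory I (I.radix ^ w) I.domList last) out h where
  idx : h.var 0 = i

theorem radix_le_pow (I : Instance S) (hw : 1 ≤ w) : I.radix ≤ I.radix ^ w :=
  Nat.le_self_pow (by omega) _

theorem two_le_radix (I : Instance S) : 2 ≤ I.radix := by rw [Instance.radix]; omega

theorem Source.card_le {src : Source S} (hw : 1 ≤ w) (ha : src.arity ≤ w) :
    src.card I I.domList ≤ I.radix ^ w := by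
  cases src with
  | edb R => exact (I.table_length_lt R).le.trans (radix_le_pow I hw)
  | idb T =>
    exact (Nat.pow_le_pow_left I.domList_length_lt.le _).trans
      (Nat.pow_le_pow_right (by have := two_le_radix I; omega) ha)

variable {last : ℕ → ℕ → ℕ} {out : List ℕ} {i : ℕ} {h : Store}

theorem BlockState.mem_input (hs : BlockState I B w last out i h) (hw : 1 ≤ w) {a : ℕ}
    (ha : a < I.encode.length) : h.mem a = I.encode.getD a 0 := by
  have hN := radix_le_pow I hw
  have := pagedMem_apply (W := I.radix ^ w) (content (fun i => I.encode.getD i 0)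
    (fun i => I.domList.getD i 0) (fun c => if c ∈ I.domList then 1 else 0) last) 0 (r := a)
    (by rw [Instance.radix] at hN; rw [Instance.radix]; omega)
  rw [Nat.zero_mul, Nat.zero_add] at this
  rw [hs.mem_eq, memory, this]; rfl

theorem BlockState.mem_dom (hs : BlockState I B w last out i h) {r : ℕ}
    (hr : r < I.radix ^ w) : h.mem (1 * I.radix ^ w + r) = I.domList.getD r 0 := by
  rw [hs.mem_eq, memory, pagedMem_apply _ _ hr]; rfl

theorem BlockState.mem_last (hs : BlockState I B w last out i h) (t : ℕ) {r : ℕ}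
    (hr : r < I.radix ^ w) : h.mem ((t + 3) * I.radix ^ w + r) = last t r := by
  rw [hs.mem_eq, memory, pagedMem_apply _ _ hr]; rfl

theorem BlockState.eval_card (hs : BlockState I B w last out i h) (hw : 1 ≤ w) (src : Source S) :
    (Layout.cardExpr src).eval h = src.card I I.domList := by
  cases src with
  | edb R =>
    simp only [Layout.cardExpr, Expr.eval, hs.var_base]
    rw [hs.mem_input hw, I.encode_getD_base]; rfl
    exact (I.encode_getD R (i := 0) (by simp [Instance.encodeTable])).2
  | idb T => simp only [Layout.cardExpr, Expr.eval_pow, Expr.eval, hs.var_two]; rfl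

theorem BlockState.eval_pos (hs : BlockState I B w last out i h) (hw : 1 ≤ w) {src : Source S}
    (hi : i < src.card I I.domList) (j : ℕ) :
    (Layout.posExpr src j).eval h = src.row I I.domList i j := by
  cases src with
  | edb R =>
    simp only [Layout.posExpr, Source.row]
    split
    · next hj =>
      simp only [Expr.eval, BinOp.eval, hs.var_base, hs.idx]
      have := I.encode_getD_row R hi hj
      rw [hs.mem_input hw this.2, this.1]
    · rfl
  | idb T =>
    simp only [Layout.posExpr, Source.row]
    split
    · next hj =>
      simp only [Expr.eval, BinOp.eval, hs.var_three, hs.var_two, hs.idx, Expr.eval_pow]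
      -- A tuple number `i` exists and the arity is positive, so `n ^ arity` and hence `n` is not 0;
      -- this keeps the digits below `n`.
      have hn : 0 < I.domList.length := by
        rcases Nat.eq_zero_or_pos I.domList.length with h0 | h0
        · simp only [Source.card, h0, zero_pow (show S.idbArity T ≠ 0 by omega)] at hi
          omega
        · exact h0
      exact hs.mem_dom ((Nat.mod_lt _ hn).trans (I.domList_length_lt.trans_le (radix_le_pow I hw)))
    · rfl

theorem BlockState.eval_key (hs : BlockState I B w last out i h) (hw : 1 ≤ w) {src : Source S}
    (hi : i < src.card I I.domList) (key : List ℕ) :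
    (Layout.keyExpr src key).eval h = keyCode I.radix key (src.row I I.domList i) := by
  induction key with
  | nil => simp [Layout.keyExpr, Expr.eval, keyCode]
  | cons j l ih =>
    simp only [Layout.keyExpr, Expr.eval, BinOp.eval, ih, hs.eval_pos hw hi, hs.var_one, keyCode,
      List.map_cons, Nat.ofDigits_cons]

theorem BlockState.eval_flag (hs : BlockState I B w last out i h) (hw : 1 ≤ w) {src : Source S}
    (hi : i < src.card I I.domList) (l : List (ℕ × ℕ)) :
    (Layout.flagExpr src l).eval h = flag (src.row I I.domList i) l := by
  induction l with
  | nil => rfl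
  | cons p l ih => simp only [Layout.flagExpr, Expr.eval, BinOp.eval, ih, hs.eval_pos hw hi, flag]

theorem BlockState.eval_addr (hs : BlockState I B w last out i h) (hw : 1 ≤ w) {src : Source S}
    (hi : i < src.card I I.domList) (s : ι) (key : List ℕ) :
    (A.addrExpr src s key).eval h
      = (A.id s + 3) * I.radix ^ w + keyCode I.radix key (src.row I I.domList i) := by
  simp only [Layout.addrExpr, Expr.eval, BinOp.eval, hs.eval_key hw hi, hs.var_three]

theorem BlockState.eval_load (hs : BlockState I B w last out i h) (hw : 1 ≤ w) {src : Source S}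
    (hi : i < src.card I I.domList) (s : ι) {key : List ℕ} (hk : key.length ≤ w) :
    (Expr.load (A.addrExpr src s key)).eval h
      = last (A.id s) (keyCode I.radix key (src.row I I.domList i)) := by
  rw [Expr.eval, hs.eval_addr hw hi, hs.mem_last]
  exact keyCode_lt (two_le_radix I) hk (src.row_lt I hi)

/-- The only factor that depends on the arrays is a message. By `hl` the arrays of the blocks in `u`
already contain the final references, which is why blocks may refer only to earlier ones. -/
theorem BlockState.eval_factor (hs : BlockState I B w last out i h) (hw : 1 ≤ w) {src : Source S}
    (hi : i < src.card I I.domList) {u : List ι}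
    (hl : ∀ t ∈ u, last (A.id t) = A.ref I I.domList I.radix t) {f : Factor S ι}
    (hf : f.Fits w u) :
    (A.factorExprs src f).map (Expr.eval h) = Grounding.encodeFactor
      (A.groundFactor I I.domList I.radix (src.row I I.domList i) f) := by
  cases f with
  | edb R p =>
    simp only [Layout.factorExprs, List.map_cons, List.map_ofFn, Layout.groundFactor,
      Grounding.encodeFactor, Expr.eval, Function.comp_def, hs.eval_pos hw hi]
  | idb T p =>
    simp only [Layout.factorExprs, List.map_cons, List.map_ofFn, Layout.groundFactor,
      Grounding.encodeFactor, Grounding.encodeVar, Expr.eval, Function.comp_def,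
      hs.eval_pos hw hi, List.length_ofFn]
  | msg s key =>
    have := hs.eval_load (A := A) hw hi s hf.2
    rw [hl s hf.1] at this
    simp only [Layout.factorExprs, List.map_cons, List.map_nil, Layout.groundFactor,
      Grounding.encodeFactor, Grounding.encodeVar, Layout.chainVar, this, List.length_cons,
      List.length_nil]
    rfl

theorem BlockState.eval_term (hs : BlockState I B w last out i h) (hw : 1 ≤ w) {src : Source S}
    (hi : i < src.card I I.domList) {u : List ι}
    (hl : ∀ t ∈ u, last (A.id t) = A.ref I I.domList I.radix t) {τ : Term S ι}
    (hf : ∀ f ∈ τ.factors, f.Fits w u) :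
    (A.termExprs src τ).map (Expr.eval h) = Grounding.encodeMonomial
      (A.groundTerm I I.domList I.radix (src.row I I.domList i) τ) := by
  have : (τ.factors.flatMap (A.factorExprs src)).map (Expr.eval h)
      = (τ.factors.map (A.groundFactor I I.domList I.radix (src.row I I.domList i))).flatMap
        Grounding.encodeFactor := by
    rw [List.map_flatMap, List.flatMap_map]
    exact List.flatMap_congr fun f hf' => hs.eval_factor hw hi hl (hf f hf')
  simp only [Layout.termExprs, this, Layout.groundTerm, Grounding.encodeMonomial,
    List.length_cons, List.length_map, List.flatMap_cons, List.map_cons,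
    hs.eval_flag hw hi, Expr.eval, Grounding.encodeFactor, Grounding.encodeVar, Layout.flagVar,
    List.cons_append, List.nil_append, List.length_nil]

theorem BlockState.eval_terms (hs : BlockState I B w last out i h) (hw : 1 ≤ w) {src : Source S}
    (hi : i < src.card I I.domList) {u : List ι}
    (hl : ∀ t ∈ u, last (A.id t) = A.ref I I.domList I.radix t) {terms : List (Term S ι)}
    (hf : ∀ τ ∈ terms, ∀ f ∈ τ.factors, f.Fits w u) :
    (terms.flatMap (A.termExprs src)).map (Expr.eval h)
      = (terms.map (A.groundTerm I I.domList I.radix (src.row I I.domList i))).flatMap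
        Grounding.encodeMonomial := by
  rw [List.map_flatMap, List.flatMap_map]
  exact List.flatMap_congr fun τ hτ => hs.eval_term hw hi hl (hf τ hτ)

/-- By `hself` the array of the block itself describes the tuples before number `i`. It provides the
partial sum that equation `i` continues. -/
theorem BlockState.eval_eqn (hs : BlockState I B w last out i h) (hw : 1 ≤ w) {s : ι}
    (hi : i < (A.blk s).src.card I I.domList) {u : List ι}
    (hl : ∀ t ∈ u, last (A.id t) = A.ref I I.domList I.radix t)
    (hself : last (A.id s) = A.partialRef I I.domList I.radix s i)
    (hf : (A.blk s).Fits w u) :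
    (A.eqnExprs s).map (Expr.eval h) = encodeEqn (A.eqn I I.domList I.radix s i) := by
  have hterms := fun (src : Source S) (hi : i < src.card I I.domList) => hs.eval_terms hw hi hl hf.factors
  have hkey := hf.key
  have hload := fun (src : Source S) (hi : i < src.card I I.domList) (key : List ℕ) (hk : key.length ≤ w) =>
    hs.eval_load (A := A) hw hi s hk
  rw [hself] at hload
  unfold Layout.partialRef at hload
  unfold Layout.eqnExprs Layout.eqn
  cases hb : A.blk s with
  | head T terms =>
    rw [hb] at hi hterms
    have hpos := fun j => hs.eval_pos hw (src := .idb T) hi j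
    have ht := hterms (.idb T) hi
    simp only [Block.terms] at ht
    simp only [List.map_append, ht, encodeEqn, Grounding.encodeVar, List.map_cons, List.map_nil,
      Expr.eval, List.map_ofFn, Function.comp_def, hpos, List.length_ofFn, List.length_map]
    simp
  | chain src key terms =>
    rw [hb] at hi hterms hload
    have ht := hterms src hi
    have hlo := hload src hi key (hkey src key terms hb)
    simp only [Block.terms] at ht
    simp only [List.map_append, ht, encodeEqn, Grounding.encodeVar, List.map_cons, List.map_nil,
      hlo, List.length_map, Layout.chainVar, List.flatMap_cons, Grounding.encodeMonomial,
      Grounding.encodeFactor, List.length_cons, List.length_nil, List.flatMap_nil]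
    simp [Expr.eval, BinOp.eval, hs.idx]

theorem BlockState.exec_stores (hs : BlockState I B w last out i h) (hw : 1 ≤ w)
    (hB : I.radix ^ w < B) {s : ι} (hi : i < (A.blk s).src.card I I.domList) {u : List ι}
    (hself : last (A.id s) = A.partialRef I I.domList I.radix s i)
    (hf : (A.blk s).Fits w u) :
    OkStmts B (A.blockStores s) h ∧
      BlockState I B w (Function.update last (A.id s)
        (A.partialRef I I.domList I.radix s (i + 1))) out i (execs (A.blockStores s) h) := by
  have hcard := Source.card_le (I := I) hw hf.arity
  have hkey := hf.key
  unfold Layout.partialRef at hself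
  unfold Layout.blockStores Layout.partialRef
  cases hb : A.blk s with
  | head T terms =>
    rw [hb] at hself
    refine ⟨hs.below, ?_⟩
    -- A head block has no array: its page consists of zeros and is not written.
    have : Function.update last (A.id s) (fun _ => 0) = last := by
      rw [← Function.update_eq_self (A.id s) last, hself]
      simp
    simp only [this]
    exact hs
  | chain src key terms =>
    rw [hb] at hself hi hcard
    simp only [Block.src] at hi hcard
    have hlt := keyCode_lt (two_le_radix I) (hkey src key terms hb) (src.row_lt I hi)
    have haddr := hs.eval_addr (A := A) hw hi s key
    -- Storing `i + 1` at the key of tuple `i` performs one step of the recursion of `lastIdx`. The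
    -- shift by one keeps 0 free as the sign for no tuple.
    have hup : Function.update last (A.id s)
        (lastIdx (fun i => keyCode I.radix key (src.row I I.domList i)) (i + 1))
        = Function.update last (A.id s) (Function.update (last (A.id s))
          (keyCode I.radix key (src.row I I.domList i)) (i + 1)) := by
      congr 1
      rw [hself]
      funext κ
      rw [Function.update_apply, lastIdx]
      simp only [eq_comm]
    have hv : (Expr.add (.var 0) (.const 1)).eval h = i + 1 := by
      simp only [Expr.eval, BinOp.eval, hs.idx]
    have hbel : Store.Below B { h with mem := (Function.update h.mem
        ((A.addrExpr src s key).eval h) ((Expr.add (.var 0) (.const 1)).eval h)) } :=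
      hs.below.store (by rw [hv]; omega)
    refine ⟨⟨hs.below, hbel⟩, ⟨⟨hs.var_one, hs.var_two, hs.var_three, hs.var_four, hs.var_base, ?_,
      hs.out_eq, hbel⟩, hs.idx⟩⟩
    simp only [execs, List.foldl_cons, List.foldl_nil, Stmt.exec]
    rw [haddr, hv, hs.mem_eq, memory, pagedMem_update _ _ _ hlt, content_update_add_three]
    change pagedMem _ (content _ _ _ (Function.update last (A.id s) (Function.update (last (A.id s))
      _ _))) = _
    rw [← hup]; rfl

end

/-! ### The blocks in sequence. -/

section

variable {S : Schema} {ι : Type} {A : Layout S ι} {I : Instance S} {B X w : ℕ}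

/-- The state of the program after the blocks in a list. -/
def BlocksDone (A : Layout S ι) (I : Instance S) (B w : ℕ) (out : List ℕ) (u : List ι)
    (h : Store) : Prop :=
  ∃ last : ℕ → ℕ → ℕ, State I B I.radix I.domList.length (I.radix ^ w)
      (memory I (I.radix ^ w) I.domList last)
      (out ++ (A.blockEqs I I.domList I.radix u).flatMap encodeEqn) h ∧
    (∀ t ∈ u, last (A.id t) = A.ref I I.domList I.radix t) ∧
    ∀ q, (∀ t ∈ u, A.id t ≠ q) → last q = fun _ => 0

theorem State.blockState {last : ℕ → ℕ → ℕ} {out : List ℕ} {h : Store} (hB : I.radix ^ w < B)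
    (hs : State I B I.radix I.domList.length (I.radix ^ w)
      (memory I (I.radix ^ w) I.domList last) out h) {i : ℕ} (hi : i ≤ I.radix ^ w) :
    BlockState I B w last out i (h.setIdx i) :=
  ⟨hs.setIdx (by omega), setIdx_var_zero _ _⟩

theorem partialRef_zero (s : ι) : A.partialRef I I.domList I.radix s 0 = fun _ => 0 := by
  funext κ
  unfold Layout.partialRef
  cases A.blk s <;> rfl

/-- Throughout the loop the arrays of earlier blocks are final, the own array is the partial one,
and all other arrays are still zero. Injectivity of the numbers keeps the pages apart. -/
theorem block_triple (hid : Function.Injective A.id) (hw : 1 ≤ w) (hB : I.radix ^ w < B)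
    {out : List ℕ} {u : List ι} {s : ι} (hsu : s ∉ u)
    (hX : (A.blk s).src.card I I.domList ≤ X) (hf : (A.blk s).Fits w u) :
    Triple B X (BlocksDone A I B w out u) [A.blockSeg s] (BlocksDone A I B w out (u ++ [s])) := by
  have hcard := Source.card_le (I := I) hw hf.arity
  have hne : ∀ t ∈ u, A.id t ≠ A.id s := fun t ht he => hsu (hid he ▸ ht)
  refine Triple.loop _ hX
    (fun i h => ∃ last : ℕ → ℕ → ℕ, BlockState I B w last
      (out ++ (A.blockEqs I I.domList I.radix u).flatMap encodeEqn ++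
        (List.range i).flatMap fun i => encodeEqn (A.eqn I I.domList I.radix s i)) i h ∧
      (∀ t ∈ u, last (A.id t) = A.ref I I.domList I.radix t) ∧
      (∀ q, (∀ t ∈ u, A.id t ≠ q) → A.id s ≠ q → last q = fun _ => 0) ∧
      last (A.id s) = A.partialRef I I.domList I.radix s i) ?_ ?_ ?_ ?_
  · rintro h ⟨last, hs, hl, h0⟩
    have hs' := hs.blockState hB (i := 0) (by omega)
    refine ⟨hs.below, ?_, last, by simpa using hs', hl, fun q hq _ => h0 q hq, ?_⟩
    -- The limit is evaluated before the index is set to 0. This makes no difference, since it does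
    -- not read variable 0.
    · rw [← hs'.eval_card hw]
      cases (A.blk s).src with
      | edb R =>
        simp only [Layout.cardExpr, Expr.eval, Store.setIdx]
        rw [Function.update_of_ne (by omega)]
      | idb T =>
        simp only [Layout.cardExpr, Expr.eval_pow, Expr.eval, Store.setIdx]
        rw [Function.update_of_ne (by omega)]
    · rw [h0 _ hne, partialRef_zero]
  · rintro i _ h ⟨last, hs, -⟩
    exact ⟨hs.below, hs.idx⟩
  · rintro i hi h ⟨last, hs, hl, h0, hself⟩
    set o := out ++ (A.blockEqs I I.domList I.radix u).flatMap encodeEqn ++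
        (List.range i).flatMap fun i => encodeEqn (A.eqn I I.domList I.radix s i) with ho
    have hw₁ : execs ((A.eqnExprs s).map .write) h
        = { h with out := o ++ encodeEqn (A.eqn I I.domList I.radix s i) } := by
      rw [execs_writes, hs.eval_eqn hw hi hl hself hf, hs.out_eq]
    have hs₁ : BlockState I B w last (o ++ encodeEqn (A.eqn I I.domList I.radix s i)) i
        { h with out := o ++ encodeEqn (A.eqn I I.domList I.radix s i) } :=
      ⟨⟨hs.var_one, hs.var_two, hs.var_three, hs.var_four, hs.var_base, hs.mem_eq, rfl,
        hs.below.out _⟩, hs.idx⟩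
    obtain ⟨hok, hs₂⟩ := hs₁.exec_stores (A := A) hw hB hi hself hf
    refine ⟨okStmts_writes _ hs.below (by rw [hw₁]; exact hok),
      Function.update last (A.id s) (A.partialRef I I.domList I.radix s (i + 1)), ?_, ?_, ?_, ?_⟩
    · have hout : out ++ (A.blockEqs I I.domList I.radix u).flatMap encodeEqn ++
        ((List.range (i + 1)).flatMap fun i => encodeEqn (A.eqn I I.domList I.radix s i))
          = o ++ encodeEqn (A.eqn I I.domList I.radix s i) := by
        rw [ho, List.range_succ, List.flatMap_append]
        simp
      rw [hout, iter, execs_append, hw₁, hs₂.idx]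
      exact hs₂.toState.blockState hB (by omega)
    · intro t ht
      rw [Function.update_of_ne (hne t ht), hl t ht]
    · intro q hq hq'
      rw [Function.update_of_ne hq'.symm, h0 q hq hq']
    · rw [Function.update_self]
  · rintro h ⟨last, hs, hl, h0, hself⟩
    refine ⟨last, ?_, ?_, ?_⟩
    · convert hs.toState using 1
      rw [Layout.blockEqs, List.flatMap_append, List.flatMap_append, Layout.blockEqs,
        List.flatMap_singleton, List.flatMap_map, List.append_assoc]
    · intro t ht
      rcases List.mem_append.1 ht with ht | ht
      · exact hl t ht
      · rw [List.mem_singleton.1 ht, hself]; rfl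
    · intro q hq
      exact h0 q (fun t ht => hq t (by simp [ht])) (hq s (by simp))

theorem segs_triple (hid : Function.Injective A.id) (hw : 1 ≤ w) (hB : I.radix ^ w < B)
    (order : List ι) (hord : ∀ u s v, order = u ++ s :: v → s ∉ u ∧ (A.blk s).Fits w u)
    (hX : I.encode.length ≤ X) (hXc : ∀ s ∈ order, (A.blk s).src.card I I.domList ≤ X) :
    Triple B X (fun h => h = inputStore I.encode) (A.segs w order)
      (fun h => h.out = (A.eqs I I.domList I.radix order).flatMap encodeEqn) := by
  have hB' : I.radix < B := (radix_le_pow I hw).trans_lt hB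
  have hXR : ∀ R, (I.cells R).length ≤ X := by
    intro R
    by_cases h0 : (I.cells R).length = 0
    · omega
    · have := (I.encode_getD_cells R (i := (I.cells R).length - 1) (by omega)).2
      omega
  refine (base_triple hB').append ((size_triple hw hB hX).append ((dom_triple hw hB hXR).append
    (flag_triple.append ?_)))
  have key := Triple.flatMap (B := B) (X := X) (fun s => [A.blockSeg s])
    (BlocksDone A I B w [S.numIdb, 1, 1, 1, 0]) order (fun u s v huv =>
      block_triple hid hw hB (hord u s v huv).1 (hXc s (by rw [huv]; simp)) (hord u s v huv).2)
  intro h hs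
  obtain ⟨hok, last, hs', -, -⟩ := key h ⟨fun _ _ => 0, by simpa [Layout.blockEqs] using hs,
    by simp, fun _ _ => rfl⟩
  refine ⟨hok, hs'.out_eq.trans ?_⟩
  rw [Layout.eqs, List.flatMap_cons]
  rfl

end

end Datalog

/-! ### Bounds in terms of the input size and the active domain. -/

namespace Datalog

open RAM

theorem RAM.Computes.mono {M : List Instr} {input output : List ℕ} {t t' B B' : ℕ}
    (h : Computes M input output t B) (ht : t ≤ t') (hB : B ≤ B') :
    Computes M input output t' B' := by
  obtain ⟨s, hs, h1, h2, h3⟩ := h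
  exact ⟨s, hs.trans ht, h1, h2, fun j hj a =>
    ⟨(h3 j hj a).1.trans_le hB, (h3 j hj a).2.trans_le hB⟩⟩

namespace Instance

variable {S : Schema} (I : Instance S)

theorem table_length_le_size (R : Fin S.numEdb) : (I.table R).length ≤ I.size :=
  Finset.single_le_sum (f := fun R => (I.table R).length) (fun _ _ => Nat.zero_le _)
    (Finset.mem_univ R)

theorem mem_encode {x : ℕ} (hx : x ∈ I.encode) : x ≤ I.size ∨ x ∈ I.adom := by
  obtain ⟨R, -, hR⟩ := List.mem_flatMap.1 hx
  rcases List.mem_cons.1 hR with rfl | hR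
  · exact Or.inl (I.table_length_le_size R)
  · right
    obtain ⟨c, hc, hxc⟩ := List.mem_flatMap.1 hR
    obtain ⟨j, rfl⟩ := (List.mem_ofFn' _ _).1 hxc
    simp only [adom, Finset.mem_biUnion, Finset.mem_univ, true_and, List.mem_toFinset,
      Finset.mem_image]
    exact ⟨R, c, hc, j, rfl⟩

theorem encode_length_le :
    I.encode.length ≤ S.numEdb + (∑ R, S.edbArity R) * I.size := by
  have h : I.encode.length = ∑ R, (1 + (I.table R).length * S.edbArity R) := by
    change ((List.finRange S.numEdb).flatMap I.encodeTable).length = _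
    rw [List.length_flatMap, ← List.ofFn_eq_map, List.sum_ofFn]
    exact Finset.sum_congr rfl fun R _ => I.encodeTable_length R
  rw [h, Finset.sum_add_distrib, Finset.sum_mul]
  refine Nat.add_le_add (by simp) (Finset.sum_le_sum fun R _ => ?_)
  rw [mul_comm]
  exact Nat.mul_le_mul_left _ (I.table_length_le_size R)

theorem radix_le {d : ℕ} (h : ∀ a ∈ I.adom, a < (I.size + 2) ^ d) :
    I.radix ≤ (I.size + 2) ^ (d + 1 + (S.numEdb + (∑ R, S.edbArity R) + 3)) := by
  have h1 : I.maxWord I.encode.length ≤ (I.size + 2) ^ (d + 1) := by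
    refine Finset.sup_le fun j hj => ?_
    have hj' := Finset.mem_range.1 hj
    rw [List.getD_eq_getElem _ _ hj']
    rcases I.mem_encode (List.getElem_mem hj') with hx | hx
    · exact hx.trans (le_trans (by omega) (Nat.le_self_pow (by omega) (I.size + 2)))
    · exact (h _ hx).le.trans (Nat.pow_le_pow_right (by omega) (by omega))
  have h2 := I.encode_length_le
  have h3 : I.size + 2 ≤ (I.size + 2) ^ (d + 1) := Nat.le_self_pow (by omega) _
  generalize hA : ∑ R, S.edbArity R = a at *
  rw [pow_add]
  -- A constant factor `c` is absorbed into the exponent by `c ≤ 2 ^ c ≤ (m + 2) ^ c`.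
  have h4 : S.numEdb + a + 3 ≤ (I.size + 2) ^ (S.numEdb + a + 3) :=
    Nat.lt_two_pow_self.le.trans (Nat.pow_le_pow_left (by omega) _)
  refine le_trans ?_ (Nat.mul_le_mul_left _ h4)
  generalize (I.size + 2) ^ (d + 1) = p at *
  have h5 : a * I.size ≤ a * p := Nat.mul_le_mul_left _ (by omega)
  have h6 : S.numEdb ≤ S.numEdb * p := Nat.le_mul_of_pos_right _ (by omega)
  rw [radix]
  nlinarith

end Instance

/-- This is where the arity enters. The summand 1 is needed for an empty domain, over which a
nullary predicate still has one tuple while `0 ^ k` may vanish. -/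
theorem Source.card_le_size {S : Schema} {k : ℕ} (hk : ∀ T, S.idbArity T ≤ k) (I : Instance S)
    (src : Source S) : src.card I I.domList ≤ I.size + I.adom.card ^ k + 1 := by
  cases src with
  | edb R => exact (I.table_length_le_size R).trans (by omega)
  | idb T =>
    rw [Source.card, I.domList_length]
    rcases Nat.eq_zero_or_pos I.adom.card with h0 | h0
    · rw [h0]
      have : 0 ^ S.idbArity T ≤ 1 := by
        rcases Nat.eq_zero_or_pos (S.idbArity T) with h | h <;> simp [h]
      exact this.trans (Nat.le_add_left _ _)
    · exact (Nat.pow_le_pow_right h0 (hk T)).trans (by omega)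

/-- The code, its length and the sizes of its expressions depend only on the layout and the order.
The exponent `d` affects the word bound alone. -/
theorem Layout.exists_computes {S : Schema} {ι : Type} {A : Layout S ι} {w k : ℕ}
    (hid : Function.Injective A.id) (hw : 1 ≤ w) (order : List ι)
    (hord : ∀ u s v, order = u ++ s :: v → s ∉ u ∧ (A.blk s).Fits w u)
    (hk : ∀ T, S.idbArity T ≤ k) :
    ∃ (M : List Instr) (C : ℕ), ∀ d : ℕ, ∃ b : ℕ, ∀ I : Instance S,
      (∀ a ∈ I.adom, a < (I.size + 2) ^ d) →
      Computes M I.encode ((A.eqs I I.domList I.radix order).flatMap encodeEqn)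
        (C * (I.size + I.adom.card ^ k + 1)) ((I.size + 2) ^ b) := by
  set p := A.segs w order with hp
  set K := S.numEdb + ∑ R, S.edbArity R + 1 with hK
  set s := 1 + (p.map Seg.size).sum with hs
  refine ⟨progCode 0 p, (progCode 0 p).length * (K + 1), fun d =>
    ⟨(d + 1 + (S.numEdb + (∑ R, S.edbArity R) + 3)) * (w + 1) * s, fun I hI => ?_⟩⟩
  set Y := I.size + I.adom.card ^ k + 1 with hY
  have h2 := two_le_radix I
  have hpow : I.radix ^ w + 1 ≤ I.radix ^ (w + 1) := by
    have : 1 ≤ I.radix ^ w := Nat.one_le_pow _ _ (by omega)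
    rw [pow_succ]; nlinarith
  have hX1 : I.encode.length ≤ K * Y := by
    refine I.encode_length_le.trans ?_
    have : I.size + 1 ≤ Y := by omega
    rw [hK]
    generalize (∑ R, S.edbArity R) = a
    have h1 : a * I.size ≤ a * Y := Nat.mul_le_mul_left _ (by omega)
    have h2 : S.numEdb ≤ S.numEdb * Y := Nat.le_mul_of_pos_right _ (by omega)
    rw [add_mul, add_mul]
    omega
  have hX2 : ∀ s ∈ order, (A.blk s).src.card I I.domList ≤ K * Y := fun s _ =>
    (Source.card_le_size hk I _).trans (Nat.le_mul_of_pos_left _ (by omega))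
  -- Stored words do not exceed the page size `I.radix ^ w`. Addresses in later pages do, but they
  -- occur only as temporary words, which the power `s` covers.
  obtain ⟨hok, hout⟩ := segs_triple (B := I.radix ^ w + 1) (X := K * Y) hid hw (by omega) order
    hord hX1 hX2 _ rfl
  have hradix := radix_le_pow I hw
  have hc := computes_of_progOk (S := s) (by omega) (by omega) (fun g hg =>
    (List.single_le_sum (fun _ _ => Nat.zero_le _) _ (List.mem_map_of_mem hg)).trans
      (Nat.le_add_left _ 1)) (encode_getD_lt (by omega)) hok
  rw [hout] at hc
  refine hc.mono ?_ ?_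
  · rw [mul_assoc]
    refine Nat.mul_le_mul_left _ ?_
    have : (K + 1) * Y = K * Y + Y := by ring
    omega
  · calc (I.radix ^ w + 1) ^ s ≤ (I.radix ^ (w + 1)) ^ s := Nat.pow_le_pow_left hpow _
      _ ≤ (((I.size + 2) ^ (d + 1 + (S.numEdb + (∑ R, S.edbArity R) + 3))) ^ (w + 1)) ^ s :=
        Nat.pow_le_pow_left (Nat.pow_le_pow_left (I.radix_le hI) _) _
      _ = _ := by rw [← pow_mul, ← pow_mul, mul_assoc]

/-! ### The grounding -/

/-- Every occurrence of a coefficient or variable costs at least one word of the output. -/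
theorem Grounding.size_le_encode_length {S : Schema} (G : Grounding S) :
    G.size ≤ G.encode.length := by
  rw [size, encode, List.length_flatMap]
  refine List.sum_le_sum fun q _ => ?_
  have h1 : ∀ w : Monomial S, w.length ≤ (encodeMonomial w).length := by
    intro w
    rw [encodeMonomial, List.length_cons, List.length_flatMap]
    have : (w.map fun _ => 1).sum ≤ (w.map fun f => (encodeFactor f).length).sum :=
      List.sum_le_sum fun f _ => by cases f <;> simp [encodeFactor]
    simp only [List.map_const', List.sum_replicate, smul_eq_mul, mul_one] at this
    omega
  have h2 : (q.2.map List.length).sum ≤ (q.2.map fun w => (encodeMonomial w).length).sum :=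
    List.sum_le_sum fun w _ => h1 w
  simp only [List.length_append, encodeVar, List.length_cons, List.length_flatMap]
  omega

theorem eq_of_digits_eq {n : ℕ} (a : ℕ) : ∀ {i i' : ℕ}, i < n ^ a → i' < n ^ a →
    (∀ j < a, i / n ^ j % n = i' / n ^ j % n) → i = i' := by
  induction a with
  | zero => intro i i' hi hi' _; simp at hi hi'; omega
  | succ a ih =>
    intro i i' hi hi' h
    have h0 := h 0 (by omega)
    rw [pow_zero, Nat.div_one, Nat.div_one] at h0
    have h1 : i / n = i' / n := by
      refine ih ?_ ?_ fun j hj => ?_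
      · exact Nat.div_lt_of_lt_mul (by rwa [pow_succ'] at hi)
      · exact Nat.div_lt_of_lt_mul (by rwa [pow_succ'] at hi')
      · have := h (j + 1) (by omega)
        rwa [pow_succ', ← Nat.div_div_eq_div_mul, ← Nat.div_div_eq_div_mul] at this
    rw [← Nat.div_add_mod i n, ← Nat.div_add_mod i' n, h0, h1]

/-! ### Enumeration of the tuples of a source. -/

namespace Source

variable {S : Schema} (I : Instance S)

/-- The tuple number `i` of a source. -/
def tuple (src : Source S) (i : ℕ) : Fin src.arity → ℕ := fun j => src.row I I.domList i j

/-- The set of the tuples of a source. -/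
def tuples : (src : Source S) → Finset (Fin src.arity → ℕ)
  | .edb R => (I.table R).toFinset
  | .idb T => Fintype.piFinset fun _ : Fin (S.idbArity T) => I.adom

/-- A tuple as a function of the position. -/
def extend {a : ℕ} (c : Fin a → ℕ) (j : ℕ) : ℕ := if h : j < a then c ⟨j, h⟩ else 0

theorem extend_val {a : ℕ} (c : Fin a → ℕ) (j : Fin a) : extend c j = c j := by
  simp [extend]

theorem row_eq_extend (src : Source S) (i : ℕ) :
    src.row I I.domList i = extend (src.tuple I i) := by
  funext j
  cases src with
  | edb R => simp only [extend, tuple, row, arity]; split <;> rfl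
  | idb T => simp only [extend, tuple, row, arity]; split <;> simp_all

theorem tuple_edb (R : Fin S.numEdb) {i : ℕ} (hi : i < (I.table R).length) :
    (edb R).tuple I i = (I.table R)[i] := by
  funext j
  have hj : (j : ℕ) < S.edbArity R := j.2
  simp only [tuple, row, dif_pos hj]
  rw [List.getD_eq_getElem _ _ hi]
  rfl

/-- Tables have no repetitions, and a number is determined by its digits to base `n`. Without
injectivity sums would count tuples repeatedly, and heads would have several equations. -/
theorem tuple_injOn (src : Source S) :
    Set.InjOn (src.tuple I) (Finset.range (src.card I I.domList)) := by
  intro i hi i' hi' h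
  rw [Finset.coe_range, Set.mem_Iio] at hi hi'
  cases src with
  | edb R =>
    rw [tuple_edb I R hi, tuple_edb I R hi'] at h
    exact (I.nodup R).getElem_inj_iff.1 h
  | idb T =>
    refine eq_of_digits_eq (n := I.domList.length) _ hi hi' fun j hj => ?_
    have hn : 0 < I.domList.length := by
      rcases Nat.eq_zero_or_pos I.domList.length with h0 | h0
      · simp only [card, h0, zero_pow (show S.idbArity T ≠ 0 by omega)] at hi
        omega
      · exact h0
    have := congrFun h ⟨j, hj⟩
    simp only [tuple, row, hj, if_true] at this
    rw [List.getD_eq_getElem _ _ (Nat.mod_lt _ hn), List.getD_eq_getElem _ _ (Nat.mod_lt _ hn)]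
      at this
    exact (Instance.nodup_listDom _).getElem_inj_iff.1 this

theorem image_tuple (src : Source S) :
    (Finset.range (src.card I I.domList)).image (src.tuple I) = src.tuples I := by
  cases src with
  | edb R =>
    ext c
    simp only [Finset.mem_image, Finset.mem_range, tuples]
    constructor
    · rintro ⟨i, hi, rfl⟩
      rw [tuple_edb I R hi]
      exact List.mem_toFinset.2 (List.getElem_mem hi)
    · intro hc
      obtain ⟨i, hi, rfl⟩ := List.mem_iff_getElem.1 (List.mem_toFinset.1 hc)
      exact ⟨i, hi, tuple_edb I R hi⟩
  | idb T =>
    -- Surjectivity by counting: there are `n ^ a` numbers, the enumeration is injective, and there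
    -- are `n ^ a` tuples.
    refine Finset.eq_of_subset_of_card_le ?_ ?_
    · intro c hc
      obtain ⟨i, hi, rfl⟩ := Finset.mem_image.1 hc
      rw [Finset.mem_range] at hi
      refine Fintype.mem_piFinset.2 fun (j : Fin (S.idbArity T)) => ?_
      have hn : 0 < I.domList.length := by
        rcases Nat.eq_zero_or_pos I.domList.length with h0 | h0
        · simp only [card, h0, zero_pow (show S.idbArity T ≠ 0 by have := j.2; omega)] at hi
          omega
        · exact h0
      simp only [tuple, row, j.2, if_true]
      rw [List.getD_eq_getElem _ _ (Nat.mod_lt _ hn), ← I.toFinset_domList, List.mem_toFinset]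
      exact List.getElem_mem _
    · rw [Finset.card_image_of_injOn ((idb T).tuple_injOn I), Finset.card_range]
      change (Fintype.piFinset fun _ : Fin (S.idbArity T) => I.adom).card ≤ _
      rw [Fintype.card_piFinset_const, card, I.domList_length]

theorem sum_row {σ : Type*} [AddCommMonoid σ] (src : Source S) (f : (ℕ → ℕ) → σ) :
    ∑ i ∈ Finset.range (src.card I I.domList), f (src.row I I.domList i)
      = ∑ c ∈ src.tuples I, f (extend c) := by
  rw [← image_tuple, Finset.sum_image (src.tuple_injOn I)]
  exact Finset.sum_congr rfl fun i _ => by rw [row_eq_extend]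

theorem mem_adom_of_mem_tuples {src : Source S} {c : Fin src.arity → ℕ} (hc : c ∈ src.tuples I)
    (j : Fin src.arity) : c j ∈ I.adom := by
  cases src with
  | edb R =>
    simp only [Instance.adom, Finset.mem_biUnion, Finset.mem_univ, true_and, List.mem_toFinset,
      Finset.mem_image]
    exact ⟨R, c, List.mem_toFinset.1 hc, j, rfl⟩
  | idb T => exact Fintype.mem_piFinset.1 hc j

end Source

/-- Predicate names separate the kinds of variables: below `S.numIdb` the original IDB predicates,
`S.numIdb` itself for the flags, and above it one name per block. Within a block the tuples or their
numbers differ. -/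
theorem Layout.eqs_nodup {S : Schema} {ι : Type} {A : Layout S ι} (hid : Function.Injective A.id)
    (hhead : ∀ s s' T l l', A.blk s = .head T l → A.blk s' = .head T l' → s = s')
    (I : Instance S) {order : List ι} (hnd : order.Nodup) :
    ((A.eqs I I.domList I.radix order).map Prod.fst).Nodup := by
  have hfst : ∀ s i, (A.eqn I I.domList I.radix s i).1 = (match A.blk s with
      | .head T _ => (T.val, List.ofFn ((Source.idb T).tuple I i))
      | .chain _ _ _ => A.chainVar s (i + 1)) := by
    intro s i
    unfold eqn
    cases A.blk s <;> rfl
  have hne : ∀ s i, (A.eqn I I.domList I.radix s i).1.1 ≠ S.numIdb := by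
    intro s i
    rw [hfst]
    cases A.blk s with
    | head T l => have := T.2; simp only; omega
    | chain src key l => simp only [chainVar]; omega
  rw [eqs, List.map_cons, List.nodup_cons]
  constructor
  · simp only [blockEqs, List.mem_map, List.mem_flatMap, flagVar, not_exists, not_and]
    rintro q ⟨s, -, i, -, rfl⟩ hq
    exact hne s i (by rw [hq])
  · rw [blockEqs, List.map_flatMap, List.nodup_flatMap]
    constructor
    · intro s _
      rw [List.map_map]
      refine List.Nodup.map_on (fun i hi i' hi' h => ?_) List.nodup_range
      simp only [Function.comp_apply, hfst] at h
      rw [List.mem_range] at hi hi'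
      revert hi hi' h
      cases A.blk s with
      | head T l =>
        intro hi hi' h
        simp only [Prod.mk.injEq, true_and] at h
        exact (Source.idb T).tuple_injOn I (Finset.mem_coe.2 (Finset.mem_range.2 hi))
          (Finset.mem_coe.2 (Finset.mem_range.2 hi'))
          (List.ofFn_injective h)
      | chain src key l =>
        intro _ _ h
        simpa [chainVar] using h
    · refine hnd.imp fun {s s'} hss => ?_
      rw [Function.onFun, List.disjoint_left]
      simp only [List.map_map, List.mem_map, Function.comp_apply, not_exists, not_and]
      rintro x ⟨i, -, rfl⟩ i' - h
      apply hss
      rw [hfst, hfst] at h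
      cases hb : A.blk s with
      | head T l =>
        cases hb' : A.blk s' with
        | head T' l' =>
          rw [hb, hb'] at h
          simp only [Prod.mk.injEq] at h
          have hT : T' = T := Fin.ext h.1
          subst hT
          exact hhead _ _ _ _ _ hb hb'
        | chain src' key' l' =>
          rw [hb, hb'] at h
          simp only [chainVar, Prod.mk.injEq] at h
          have := T.2
          omega
      | chain src key l =>
        cases hb' : A.blk s' with
        | head T' l' =>
          rw [hb, hb'] at h
          simp only [chainVar, Prod.mk.injEq] at h
          have := T'.2
          omega
        | chain src' key' l' =>
          rw [hb, hb'] at h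
          simp only [chainVar, Prod.mk.injEq] at h
          exact hid (by omega)

end Datalog

namespace Datalog

open OmegaCompletePartialOrder

/-! ### Least fixpoints -/

/-- Separate continuity suffices. The double supremum over `i` and `j` is dominated by the diagonal,
since the term for `(i, j)` is at most the term for `max i j`. -/
theorem ωScottContinuous_binary {α β γ δ : Type*} [OmegaCompletePartialOrder α]
    [OmegaCompletePartialOrder β] [OmegaCompletePartialOrder γ] [OmegaCompletePartialOrder δ]
    {op : β → γ → δ} (hl : ∀ a, ωScottContinuous (op a))
    (hr : ∀ b, ωScottContinuous fun a => op a b) {f : α → β} {g : α → γ}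
    (hf : ωScottContinuous f) (hg : ωScottContinuous g) :
    ωScottContinuous fun x => op (f x) (g x) := by
  have hmono : Monotone fun x => op (f x) (g x) := fun x y hxy =>
    ((hl (f x)).monotone (hg.monotone hxy)).trans ((hr (g y)).monotone (hf.monotone hxy))
  refine ωScottContinuous_iff_monotone_map_ωSup.2 ⟨hmono, fun c => le_antisymm ?_ ?_⟩
  · rw [hf.map_ωSup, (hr _).map_ωSup]
    refine ωSup_le _ _ fun i => ?_
    change op (f (c i)) (g (ωSup c)) ≤ _
    rw [hg.map_ωSup, (hl _).map_ωSup]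
    refine ωSup_le _ _ fun j => ?_
    refine le_ωSup_of_le (max i j) ?_
    change op (f (c i)) (g (c j)) ≤ op (f (c (max i j))) (g (c (max i j)))
    exact ((hl _).monotone (hg.monotone (c.monotone (le_max_right i j)))).trans
      ((hr _).monotone (hf.monotone (c.monotone (le_max_left i j))))
  · exact ωSup_le _ _ fun i => hmono (le_ωSup c i)

/-- Kleene's theorem: the supremum of the iterates from the least element is the least fixpoint. -/
theorem exists_isLeast_fixedPoints {α : Type*} [OmegaCompletePartialOrder α] {F : α → α}
    (hF : ωScottContinuous F) {x₀ : α} (h₀ : ∀ x, x₀ ≤ x) :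
    ∃ x, IsLeast (Function.fixedPoints F) x := by
  let F' : α →𝒄 α := ContinuousHom.ofFun F hF
  refine ⟨ωSup (fixedPoints.iterateChain F' x₀ (h₀ _)), ?_, fun y hy => ?_⟩
  · exact fixedPoints.ωSup_iterate_mem_fixedPoint F' x₀ (h₀ _)
  · exact fixedPoints.ωSup_iterate_le_fixedPoint F' x₀ (h₀ _) hy (h₀ y)

/-- Addition and multiplication are `ω`-continuous in each argument. -/
structure ContinuousOps (σ : Type*) [CommSemiring σ] [OmegaCompletePartialOrder σ] : Prop where
  add_left : ∀ a : σ, ωScottContinuous fun x => a + x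
  mul_left : ∀ a : σ, ωScottContinuous fun x => a * x

namespace ContinuousOps

variable {σ : Type*} [CommSemiring σ] [OmegaCompletePartialOrder σ] {α : Type*}
  [OmegaCompletePartialOrder α]

theorem add (hσ : ContinuousOps σ) {f g : α → σ} (hf : ωScottContinuous f)
    (hg : ωScottContinuous g) : ωScottContinuous fun x => f x + g x :=
  ωScottContinuous_binary hσ.add_left
    (fun b => by simpa only [add_comm] using hσ.add_left b) hf hg

theorem mul (hσ : ContinuousOps σ) {f g : α → σ} (hf : ωScottContinuous f)
    (hg : ωScottContinuous g) : ωScottContinuous fun x => f x * g x :=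
  ωScottContinuous_binary hσ.mul_left
    (fun b => by simpa only [mul_comm] using hσ.mul_left b) hf hg

theorem list_sum (hσ : ContinuousOps σ) {β : Type*} (l : List β) {f : β → α → σ}
    (hf : ∀ b, ωScottContinuous (f b)) :
    ωScottContinuous fun x => (l.map fun b => f b x).sum := by
  induction l with
  | nil => exact ωScottContinuous.const
  | cons b l ih => simpa only [List.map_cons, List.sum_cons] using hσ.add (hf b) ih

theorem list_prod (hσ : ContinuousOps σ) {β : Type*} (l : List β) {f : β → α → σ}
    (hf : ∀ b, ωScottContinuous (f b)) :
    ωScottContinuous fun x => (l.map fun b => f b x).prod := by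
  induction l with
  | nil => exact ωScottContinuous.const
  | cons b l ih => simpa only [List.map_cons, List.prod_cons] using hσ.mul (hf b) ih

theorem finset_sum (hσ : ContinuousOps σ) {β : Type*} (s : Finset β) {f : β → α → σ}
    (hf : ∀ b, ωScottContinuous (f b)) : ωScottContinuous fun x => ∑ b ∈ s, f b x := by
  classical
  induction s using Finset.induction_on with
  | empty => exact ωScottContinuous.const
  | insert b s hb ih => simpa only [Finset.sum_insert hb] using hσ.add (hf b) ih

theorem program_ico (hσ : ContinuousOps σ) {S : Schema} (P : Program S) (I : Instance S)
    (ann : (R : Fin S.numEdb) → (Fin (S.edbArity R) → ℕ) → σ) :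
    ωScottContinuous (P.ico I ann) := by
  refine ωScottContinuous.of_apply₂ fun T => ωScottContinuous.of_apply₂ fun c => ?_
  refine hσ.list_sum _ fun φ => hσ.finset_sum _ fun v => hσ.list_prod _ fun A => ?_
  cases A with
  | edb R x => exact ωScottContinuous.const
  | idb T x => exact (ωScottContinuous.apply T).apply₂ (v ∘ x)

theorem grounding_ico (hσ : ContinuousOps σ) {S : Schema} (G : Grounding S)
    (e : (R : Fin S.numEdb) → (Fin (S.edbArity R) → ℕ) → σ) :
    ωScottContinuous (G.ico e) := by
  refine ωScottContinuous.of_apply₂ fun x => ?_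
  refine hσ.list_sum _ fun q => hσ.list_sum _ fun w => hσ.list_prod _ fun f => ?_
  cases f with
  | inl a => exact ωScottContinuous.const
  | inr y => exact ωScottContinuous.apply y

end ContinuousOps

/-- The values of the grounded atoms of the program. -/
def atomValues {S : Schema} {σ : Type*} (g : GroundVar → σ) (T : Fin S.numIdb)
    (c : Fin (S.idbArity T) → ℕ) : σ := g (T.val, List.ofFn c)

theorem groundAtom_injective {S : Schema} {T T' : Fin S.numIdb} {c : Fin (S.idbArity T) → ℕ}
    {c' : Fin (S.idbArity T') → ℕ} (h : (T.val, List.ofFn c) = (T'.val, List.ofFn c')) :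
    (⟨T, c⟩ : Σ T : Fin S.numIdb, Fin (S.idbArity T) → ℕ) = ⟨T', c'⟩ := by
  rw [Prod.mk.injEq] at h
  obtain rfl := Fin.ext h.1
  rw [List.ofFn_injective h.2]

/-- If every solution of the equations for the new predicates turns the equations for the grounded
atoms of the program into its immediate consequence operator, the grounding is equivalent to the
program. -/
theorem sigmaEquivalent_of_ico_eq {S : Schema} {P : Program S} {I : Instance S} {G : Grounding S}
    {σ : Type*} [CommSemiring σ] [OmegaCompletePartialOrder σ] [CanonicallyOrderedAdd σ]
    (hσ : ContinuousOps σ)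
    (hico : ∀ (ann : (R : Fin S.numEdb) → (Fin (S.edbArity R) → ℕ) → σ) (g : GroundVar → σ),
      (∀ x : GroundVar, S.numIdb ≤ x.1 → g x = G.ico (I.value ann) g x) →
      ∀ T c, G.ico (I.value ann) g (T.val, List.ofFn c) = P.ico I ann (atomValues g) T c) :
    SigmaEquivalent P I G σ := by
  intro ann
  classical
  set e := I.value ann
  obtain ⟨hP, hPl⟩ := exists_isLeast_fixedPoints (hσ.program_ico P I ann) (x₀ := fun _ _ => 0)
    (fun x T c => zero_le)
  obtain ⟨hG, hGl⟩ := exists_isLeast_fixedPoints (hσ.grounding_ico G e) (x₀ := fun _ => 0)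
    (fun x y => zero_le)
  refine ⟨hP, hG, hPl, hGl, ?_⟩
  -- the solution of the equations for the new predicates over the least fixpoint of the program
  let F : (GroundVar → σ) → GroundVar → σ := fun g x =>
    if hx : ∃ p : Σ T : Fin S.numIdb, Fin (S.idbArity T) → ℕ, x = (p.1.val, List.ofFn p.2) then
      hP hx.choose.1 hx.choose.2 else G.ico e g x
  have hFc : ωScottContinuous F := by
    refine ωScottContinuous.of_apply₂ fun x => ?_
    by_cases hx : ∃ p : Σ T : Fin S.numIdb, Fin (S.idbArity T) → ℕ, x = (p.1.val, List.ofFn p.2)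
    · simp only [F, hx, dif_pos]
      exact ωScottContinuous.const
    · simp only [F, hx]
      exact (hσ.grounding_ico G e).apply₂ x
  have hFa : ∀ g (T : Fin S.numIdb) (c : Fin (S.idbArity T) → ℕ),
      F g (T.val, List.ofFn c) = hP T c := by
    intro g T c
    have hx : ∃ p : Σ T : Fin S.numIdb, Fin (S.idbArity T) → ℕ,
        (T.val, List.ofFn c) = (p.1.val, List.ofFn p.2) := ⟨⟨T, c⟩, rfl⟩
    have h := groundAtom_injective hx.choose_spec
    simp only [F, hx, dif_pos]
    rw [← show hP T c = hP hx.choose.1 hx.choose.2 from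
      congrArg (fun p : Σ T : Fin S.numIdb, Fin (S.idbArity T) → ℕ => hP p.1 p.2) h]
  have hFn : ∀ g (x : GroundVar), (∀ (T : Fin S.numIdb) (c : Fin (S.idbArity T) → ℕ),
      x ≠ (T.val, List.ofFn c)) → F g x = G.ico e g x := by
    intro g x hx
    have : ¬ ∃ p : Σ T : Fin S.numIdb, Fin (S.idbArity T) → ℕ, x = (p.1.val, List.ofFn p.2) :=
      fun ⟨p, hp⟩ => hx p.1 p.2 hp
    simp only [F, this]
    rfl
  obtain ⟨g, hgl⟩ := exists_isLeast_fixedPoints hFc (x₀ := fun _ => 0) (fun x y => zero_le)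
  have hg : F g = g := hgl.1
  have hatom : atomValues g = hP := by
    funext T c
    rw [atomValues, ← hg, hFa]
  have hnew : ∀ x : GroundVar, S.numIdb ≤ x.1 → ∀ (T : Fin S.numIdb)
      (c : Fin (S.idbArity T) → ℕ), x ≠ (T.val, List.ofFn c) := by
    rintro x hx T c rfl
    exact absurd hx (not_le.2 T.2)
  -- Away from the grounded atoms of the program `F` is the operator of the grounding. At the atoms
  -- `hico` applies because `g` solves the new equations, and `hP` is a fixpoint of the program.
  have hgfix : G.ico e g = g := by
    funext x
    by_cases hx : ∀ (T : Fin S.numIdb) (c : Fin (S.idbArity T) → ℕ), x ≠ (T.val, List.ofFn c)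
    · rw [← hFn g x hx, hg]
    · push Not at hx
      obtain ⟨T, c, rfl⟩ := hx
      rw [hico ann g (fun x hx => by rw [← hFn g x (hnew x hx), hg]), hatom]
      rw [show P.ico I ann hP = hP from hPl.1, ← hFa g T c, hg]
  have hGfix : G.ico e hG = hG := hGl.1
  have h1 : hG ≤ g := hGl.2 hgfix
  -- Conversely, `hG` solves the new equations, so by `hico` its restriction to the atoms is a
  -- fixpoint of the program.
  have h2 : hP ≤ atomValues hG := by
    refine hPl.2 ?_
    change P.ico I ann (atomValues hG) = atomValues hG
    funext T c
    rw [← hico ann hG (fun x _ => by rw [hGfix]), hGfix]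
    rfl
  intro c
  refine le_antisymm (h2 P.target c) ?_
  calc hG (P.target.val, List.ofFn c) ≤ g (P.target.val, List.ofFn c) := h1 _
    _ = hP P.target c := congrFun (congrFun hatom P.target) c

end Datalog

namespace Datalog

/-! ### The values of the variables of the grounding -/

theorem sum_filter_fst_eq {α β σ : Type*} [DecidableEq α] [AddCommMonoid σ] (f : α × β → σ)
    {l : List (α × β)} (hl : (l.map Prod.fst).Nodup) {q : α × β} (hq : q ∈ l) :
    ((l.filter fun p => p.1 = q.1).map f).sum = f q := by
  induction l with
  | nil => simp at hq
  | cons p l ih =>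
    rw [List.map_cons, List.nodup_cons] at hl
    rcases List.mem_cons.1 hq with rfl | hq
    · have : l.filter (fun p => p.1 = q.1) = [] := by
        rw [List.filter_eq_nil_iff]
        intro p hp h
        simp only [decide_eq_true_eq] at h
        exact hl.1 (List.mem_map.2 ⟨p, hp, h⟩)
      simp [this]
    · have hne : p.1 ≠ q.1 := fun h => hl.1 (List.mem_map.2 ⟨q, hq, h.symm⟩)
      simp [hne, ih hl.2 hq]

section

variable {S : Schema} {σ : Type*} [CommSemiring σ]

/-- The value of a monomial. -/
def monomialValue (e : (R : Fin S.numEdb) → (Fin (S.edbArity R) → ℕ) → σ) (g : GroundVar → σ)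
    (w : Monomial S) : σ := (w.map fun f => Sum.elim (fun a => e a.1 a.2) g f).prod

theorem Grounding.ico_of_mem (G : Grounding S)
    (e : (R : Fin S.numEdb) → (Fin (S.edbArity R) → ℕ) → σ) (g : GroundVar → σ)
    {q : GroundVar × List (Monomial S)} (hq : q ∈ G.eqs) :
    G.ico e g q.1 = (q.2.map (monomialValue e g)).sum :=
  sum_filter_fst_eq (fun q : GroundVar × List (Monomial S) => (q.2.map (monomialValue e g)).sum)
    G.distinct hq

theorem Grounding.ico_of_not_mem (G : Grounding S)
    (e : (R : Fin S.numEdb) → (Fin (S.edbArity R) → ℕ) → σ) (g : GroundVar → σ)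
    {x : GroundVar} (hx : x ∉ G.eqs.map Prod.fst) : G.ico e g x = 0 := by
  have : G.eqs.filter (fun q => q.1 = x) = [] := by
    rw [List.filter_eq_nil_iff]
    intro p hp h
    simp only [decide_eq_true_eq] at h
    exact hx (List.mem_map.2 ⟨p, hp, h⟩)
  simp [ico, this]

/-- With truncated subtraction, `(x - y) + (y - x)` is 0 exactly when `x = y`. -/
theorem flag_eq (r : ℕ → ℕ) (l : List (ℕ × ℕ)) :
    flag r l = if ∀ p ∈ l, r p.1 = r p.2 then 1 else 0 := by
  induction l with
  | nil => simp [flag]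
  | cons p l ih =>
    rw [flag, ih]
    by_cases hp : r p.1 = r p.2
    · simp only [List.forall_mem_cons, hp, true_and]
      simp
    · have : 1 - (r p.1 - r p.2 + (r p.2 - r p.1)) = 0 := by omega
      simp [hp, this]

end

/-! ### Values of flags, messages and heads. -/

namespace Layout

variable {S : Schema} {ι : Type} {σ : Type*} [CommSemiring σ]

/-- The value of the term that belongs to a tuple. -/
def termValue (A : Layout S ι) (I : Instance S)
    (e : (R : Fin S.numEdb) → (Fin (S.edbArity R) → ℕ) → σ) (g : GroundVar → σ)
    (r : ℕ → ℕ) (τ : Term S ι) : σ :=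
  (if ∀ p ∈ τ.eqs, r p.1 = r p.2 then 1 else 0) *
    (τ.factors.map fun f =>
      Sum.elim (fun a => e a.1 a.2) g (A.groundFactor I I.domList I.radix r f)).prod

/-- The message of a block at a key. -/
def message (A : Layout S ι) (I : Instance S) (g : GroundVar → σ) (s : ι) (κ : ℕ) : σ :=
  g (A.chainVar s (A.ref I I.domList I.radix s κ))

variable {A : Layout S ι} {I : Instance S} {order : List ι} {G : Grounding S}
  {e : (R : Fin S.numEdb) → (Fin (S.edbArity R) → ℕ) → σ} {g : GroundVar → σ}

theorem flagVar_value (hG : G.eqs = A.eqs I I.domList I.radix order)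
    (hg : ∀ x : GroundVar, S.numIdb ≤ x.1 → g x = G.ico e g x) (p : Prop) [Decidable p] :
    g (flagVar S (if p then 1 else 0)) = if p then 1 else 0 := by
  rw [hg _ le_rfl]
  split
  · have := G.ico_of_mem e g (q := (flagVar S 1, [[]])) (by simp [hG, eqs])
    simpa [monomialValue] using this
  · refine G.ico_of_not_mem e g ?_
    simp only [hG, eqs, blockEqs, List.map_cons, List.mem_cons, List.mem_map, List.mem_flatMap,
      not_or, not_exists, not_and]
    refine ⟨by simp [flagVar], ?_⟩
    rintro q ⟨s, -, i, -, rfl⟩ h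
    have h1 := congrArg Prod.fst h
    revert h1
    unfold eqn
    cases A.blk s with
    | head T l => have := T.2; simp only [flagVar]; omega
    | chain src key l => simp only [flagVar, chainVar]; omega

theorem monomialValue_groundTerm (hG : G.eqs = A.eqs I I.domList I.radix order)
    (hg : ∀ x : GroundVar, S.numIdb ≤ x.1 → g x = G.ico e g x) (r : ℕ → ℕ) (τ : Term S ι) :
    monomialValue e g (A.groundTerm I I.domList I.radix r τ) = A.termValue I e g r τ := by
  simp only [monomialValue, groundTerm, List.map_cons, List.prod_cons, Sum.elim_inr, flag_eq,
    flagVar_value hG hg, List.map_map]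
  rfl

theorem mem_eqs (hG : G.eqs = A.eqs I I.domList I.radix order) {s : ι} (hs : s ∈ order) {i : ℕ}
    (hi : i < (A.blk s).src.card I I.domList) : A.eqn I I.domList I.radix s i ∈ G.eqs := by
  rw [hG, eqs, blockEqs]
  refine List.mem_cons_of_mem _ (List.mem_flatMap.2 ⟨s, hs, List.mem_map.2 ⟨i, ?_, rfl⟩⟩)
  simpa using hi

/-- The variables of the partial sums that have equations carry the indices from 1 on. Index 0, the
reference to no tuple, thus stands for the empty sum. -/
theorem chainVar_zero (hG : G.eqs = A.eqs I I.domList I.radix order)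
    (hg : ∀ x : GroundVar, S.numIdb ≤ x.1 → g x = G.ico e g x) (s : ι) :
    g (A.chainVar s 0) = 0 := by
  rw [hg _ (by simp only [chainVar]; omega)]
  refine G.ico_of_not_mem e g ?_
  simp only [hG, eqs, blockEqs, List.map_cons, List.mem_cons, List.mem_map, List.mem_flatMap,
    not_or, not_exists, not_and]
  refine ⟨by simp [flagVar, chainVar], ?_⟩
  rintro q ⟨s', -, i, -, rfl⟩ h
  revert h
  unfold eqn
  cases A.blk s' with
  | head T l => have := T.2; simp only [chainVar, Prod.mk.injEq]; omega
  | chain src key l => simp [chainVar]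

/-- The last tuple with key `κ` among the first `n` carries the sum over all of them with that key,
because its equation refers to its predecessor with the same key. -/
theorem chainVar_lastIdx (hG : G.eqs = A.eqs I I.domList I.radix order)
    (hg : ∀ x : GroundVar, S.numIdb ≤ x.1 → g x = G.ico e g x) {s : ι} (hs : s ∈ order)
    {src : Source S} {key : List ℕ} {terms : List (Term S ι)}
    (hb : A.blk s = .chain src key terms) (κ : ℕ) {n : ℕ} (hn : n ≤ src.card I I.domList) :
    g (A.chainVar s (lastIdx (fun i => keyCode I.radix key (src.row I I.domList i)) n κ))
      = ∑ i ∈ Finset.range n, if keyCode I.radix key (src.row I I.domList i) = κ then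
        (terms.map (A.termValue I e g (src.row I I.domList i))).sum else 0 := by
  induction n with
  | zero => simpa [lastIdx] using chainVar_zero hG hg s
  | succ n ih =>
    rw [Finset.sum_range_succ, lastIdx, ← ih (by omega)]
    -- If tuple `n` has the key, its equation adds its terms to the previous partial sum. Otherwise
    -- neither the reference nor the sum changes.
    split
    · next hκ =>
      have hm := G.ico_of_mem e g (mem_eqs hG hs (i := n) (by rw [hb]; exact hn))
      have he : A.eqn I I.domList I.radix s n = (A.chainVar s (n + 1),
          [.inr (A.chainVar s (lastIdx (fun i => keyCode I.radix key (src.row I I.domList i)) n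
            (keyCode I.radix key (src.row I I.domList n))))] ::
          terms.map (A.groundTerm I I.domList I.radix (src.row I I.domList n))) := by
        unfold eqn; rw [hb]
      rw [he] at hm
      rw [hg _ (by simp only [chainVar]; omega), hm]
      simp only [List.map_cons, List.sum_cons, List.map_map, Function.comp_def,
        monomialValue_groundTerm hG hg]
      simp [monomialValue, hκ]
    · rw [add_zero]

theorem message_eq (hG : G.eqs = A.eqs I I.domList I.radix order)
    (hg : ∀ x : GroundVar, S.numIdb ≤ x.1 → g x = G.ico e g x) {s : ι} (hs : s ∈ order)
    {src : Source S} {key : List ℕ} {terms : List (Term S ι)}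
    (hb : A.blk s = .chain src key terms) (κ : ℕ) :
    A.message I g s κ = ∑ c ∈ src.tuples I, if keyCode I.radix key (Source.extend c) = κ then
        (terms.map (A.termValue I e g (Source.extend c))).sum else 0 := by
  have h := chainVar_lastIdx hG hg hs hb κ le_rfl
  rw [Source.sum_row I src (fun r => if keyCode I.radix key r = κ then
    (terms.map (A.termValue I e g r)).sum else 0)] at h
  rw [← h, message, ref]
  unfold partialRef
  rw [hb]
  rfl

theorem ico_head (hG : G.eqs = A.eqs I I.domList I.radix order)
    (hg : ∀ x : GroundVar, S.numIdb ≤ x.1 → g x = G.ico e g x) {s : ι} (hs : s ∈ order)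
    {T : Fin S.numIdb} {terms : List (Term S ι)} (hb : A.blk s = .head T terms)
    {c : Fin (S.idbArity T) → ℕ} (hc : ∀ j, c j ∈ I.adom) :
    G.ico e g (T.val, List.ofFn c)
      = (terms.map (A.termValue I e g (Source.extend c))).sum := by
  have hc' : c ∈ (Source.idb T).tuples I := Fintype.mem_piFinset.2 hc
  rw [← Source.image_tuple] at hc'
  obtain ⟨i, hi, rfl⟩ := Finset.mem_image.1 hc'
  have hm := G.ico_of_mem e g (mem_eqs hG hs (i := i) (by rw [hb]; exact Finset.mem_range.1 hi))
  have he : A.eqn I I.domList I.radix s i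
      = ((T.val, List.ofFn ((Source.idb T).tuple I i)),
        terms.map (A.groundTerm I I.domList I.radix ((Source.idb T).row I I.domList i))) := by
    unfold eqn; rw [hb]; rfl
  rw [he] at hm
  refine hm.trans ?_
  rw [List.map_map]
  refine congrArg List.sum (List.map_congr_left fun τ _ => ?_)
  refine (monomialValue_groundTerm hG hg _ τ).trans ?_
  exact congrArg (fun r => A.termValue I e g r τ) (Source.row_eq_extend I (.idb T) i)

/-- Heads are enumerated only over the active domain. Outside it the program has the value 0, and so
has a variable without an equation. -/
theorem ico_head_of_not_mem (hG : G.eqs = A.eqs I I.domList I.radix order)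
    {T : Fin S.numIdb} {c : Fin (S.idbArity T) → ℕ} (hc : ¬ ∀ j, c j ∈ I.adom) :
    G.ico e g (T.val, List.ofFn c) = 0 := by
  refine G.ico_of_not_mem e g ?_
  have hT := T.2
  simp only [hG, eqs, blockEqs, List.map_cons, List.mem_cons, List.mem_map, List.mem_flatMap,
    not_or, not_exists, not_and]
  refine ⟨by simp only [flagVar, Prod.mk.injEq]; omega, ?_⟩
  rintro q ⟨s, -, i, hi, rfl⟩ h
  revert h hi
  unfold eqn
  cases A.blk s with
  | head T' l =>
    intro hi h
    have hTc := groundAtom_injective (c := (Source.idb T').tuple I i) h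
    obtain rfl : T' = T := congrArg Sigma.fst hTc
    obtain rfl : (Source.idb T').tuple I i = c := eq_of_heq (Sigma.mk.inj hTc).2
    have : (Source.idb T').tuple I i ∈ (Source.idb T').tuples I := by
      rw [← Source.image_tuple]
      exact Finset.mem_image_of_mem _ (by simpa [Block.src] using hi)
    exact hc fun j => Source.mem_adom_of_mem_tuples I this j
  | chain src key l =>
    simp only [chainVar, Prod.mk.injEq]
    omega

end Layout

end Datalog

namespace Datalog

/-! ### Elimination orders from free-connex join trees -/

/-- Uniqueness of the parent: shortest walks from `r` to `u` and `u'` extend to paths to `t`, and a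
tree has only one such path. -/
theorem _root_.SimpleGraph.IsTree.eq_of_dist_add_one {V : Type*} {G : SimpleGraph V}
    (hG : G.IsTree) (r : V) {t u u' : V} (h : G.Adj u t) (h' : G.Adj u' t)
    (hd : G.dist r t = G.dist r u + 1) (hd' : G.dist r t = G.dist r u' + 1) : u = u' := by
  obtain ⟨p, -, hp⟩ := hG.connected.exists_path_of_dist r u
  obtain ⟨p', -, hp'⟩ := hG.connected.exists_path_of_dist r u'
  have h1 : (p.concat h).IsPath :=
    SimpleGraph.Walk.isPath_of_length_eq_dist _ (by rw [SimpleGraph.Walk.length_concat, hp, hd])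
  have h1' : (p'.concat h').IsPath :=
    SimpleGraph.Walk.isPath_of_length_eq_dist _ (by rw [SimpleGraph.Walk.length_concat, hp', hd'])
  have := (hG.isAcyclic.subsingleton_path r t).elim ⟨_, h1⟩ ⟨_, h1'⟩
  exact (SimpleGraph.Walk.concat_inj (congrArg Subtype.val this)).1

/-- A path that has started to move away from the root never turns back, since the only neighbour
closer to the root is the parent, from which it has just come. -/
theorem _root_.SimpleGraph.IsTree.dist_le_of_isPath_cons {V : Type*} {G : SimpleGraph V}
    (hG : G.IsTree) (r : V) {u v : V} (p : G.Walk u v) : ∀ {t : V} (h : G.Adj t u),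
    (SimpleGraph.Walk.cons h p).IsPath → G.dist r u = G.dist r t + 1 →
      G.dist r u ≤ G.dist r v := by
  induction p with
  | nil => intro _ _ _ _; exact le_rfl
  | cons h' p ih =>
    intro t h hp hd
    rw [SimpleGraph.Walk.cons_isPath_iff] at hp
    rcases hG.dist_eq_dist_add_one_of_adj r h' with h1 | h1
    · have := hG.eq_of_dist_add_one r h h'.symm hd h1
      subst this
      exact absurd (by simp) hp.2
    · exact (by omega : _ ≤ _).trans (ih h' hp.1 h1)

namespace TreeDecomposition

variable {ℓ : ℕ} {E : Set (Finset (Fin ℓ))} {D : TreeDecomposition ℓ E}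

/-- The path from `t` to `t₀` inside the subtree of `y` must begin with the parent of `t`: if it
began by moving away from the root, it could not end at a node as close as `t₀`. -/
theorem exists_parent (r : Fin D.numNodes) {y : Fin ℓ} {t t₀ : Fin D.numNodes} (ht : y ∈ D.bag t)
    (ht₀ : y ∈ D.bag t₀) (hne : t₀ ≠ t) (hd : D.tree.dist r t₀ ≤ D.tree.dist r t) :
    ∃ u, D.tree.Adj u t ∧ D.tree.dist r t = D.tree.dist r u + 1 ∧ y ∈ D.bag u := by
  obtain ⟨p, hp, -⟩ := (D.running y).exists_path_of_dist ⟨t, ht⟩ ⟨t₀, ht₀⟩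
  cases p with
  | nil => exact absurd rfl hne
  | @cons _ u _ h q =>
    have hq := hp.map (f := (SimpleGraph.Embedding.induce {t | y ∈ D.bag t}).toHom)
      Subtype.val_injective
    rw [SimpleGraph.Walk.map_cons] at hq
    have h' : D.tree.Adj t u.1 := h
    refine ⟨u.1, h'.symm, ?_, u.2⟩
    rcases D.isTree.dist_eq_dist_add_one_of_adj r h' with h1 | h1
    · exact h1
    · have := D.isTree.dist_le_of_isPath_cons r _ _ hq h1
      change D.tree.dist r u.1 ≤ D.tree.dist r t₀ at this
      omega

theorem IsTop.eq_of_dist_le {r t t' : Fin D.numNodes} {y : Fin ℓ} (h : D.IsTop r y t)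
    (ht' : y ∈ D.bag t') (hd : D.tree.dist r t' ≤ D.tree.dist r t) : t' = t := by
  by_contra hne
  obtain ⟨u, -, hu, hyu⟩ := exists_parent r h.1 ht' hne hd
  have := h.2 u hyu
  omega

theorem exists_isTop (r : Fin D.numNodes) (y : Fin ℓ) : ∃ t, D.IsTop r y t := by
  classical
  have hne : (Finset.univ.filter fun t => y ∈ D.bag t).Nonempty := by
    obtain ⟨t⟩ := (D.running y).nonempty
    exact ⟨t.1, Finset.mem_filter.2 ⟨Finset.mem_univ _, t.2⟩⟩
  obtain ⟨t, ht, hmin⟩ := Finset.exists_min_image _ (fun t => D.tree.dist r t) hne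
  exact ⟨t, by simpa using ht, fun t' ht' => hmin t' (by simpa using ht')⟩

/-- Climbing from `t` to parents whose bags contain `y` ends at the top. The length is recorded
because a walk of length equal to the distance is a path. -/
theorem IsTop.exists_walk {r ty : Fin D.numNodes} {y : Fin ℓ} (h : D.IsTop r y ty) (n : ℕ) :
    ∀ t, D.tree.dist r t = n → y ∈ D.bag t →
      ∃ p : D.tree.Walk r t, p.length = D.tree.dist r t ∧ ty ∈ p.support := by
  induction n using Nat.strong_induction_on with
  | _ n ih =>
    intro t hn ht
    by_cases hne : ty = t
    · subst hne
      obtain ⟨p, -, hp⟩ := D.isTree.connected.exists_path_of_dist r ty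
      exact ⟨p, hp, p.end_mem_support⟩
    · obtain ⟨u, hu, hd, hyu⟩ := exists_parent r ht h.1 hne (h.2 t ht)
      obtain ⟨p, hp, hty⟩ := ih _ (by omega) u rfl hyu
      refine ⟨p.concat hu, by rw [SimpleGraph.Walk.length_concat, hp, hd], ?_⟩
      rw [SimpleGraph.Walk.support_concat]
      simp [hty]

theorem IsTop.isAncestor {r t ty : Fin D.numNodes} {y : Fin ℓ} (h : D.IsTop r y ty)
    (ht : y ∈ D.bag t) (hne : ty ≠ t) : D.IsAncestor r ty t := by
  obtain ⟨p, hp, hty⟩ := h.exists_walk _ t rfl ht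
  exact ⟨hne, p, p.isPath_of_length_eq_dist hp, hty⟩

end TreeDecomposition

/-- An order of elimination for a sum-product query. Step `t` takes the product of the atoms that
are assigned to it and of the messages of earlier steps that are sent to it, and sums out the
variables of its guard that it does not keep. -/
structure Plan {S : Schema} {T : Fin S.numIdb} (φ : SumProd S T) where
  numSteps : ℕ
  guard : Fin numSteps → Atom S φ.numVars
  guard_mem : ∀ t, guard t ∈ φ.body
  keep : Fin numSteps → Finset (Fin φ.numVars)
  keep_subset : ∀ t, keep t ⊆ (guard t).vars
  assign : Fin φ.body.length → Fin numSteps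
  vars_assign : ∀ i, (φ.body[i]).vars ⊆ (guard (assign i)).vars
  target : Fin numSteps → Option (Fin numSteps)
  lt_target : ∀ t p, target t = some p → t < p
  keep_target : ∀ t p, target t = some p → keep t ⊆ (guard p).vars
  keep_none : ∀ t, target t = none → keep t ⊆ φ.headVars
  head_keep : ∀ t, ∀ y ∈ (guard t).vars, y ∈ φ.headVars → y ∈ keep t
  later : ∀ t t' y, y ∈ (guard t).vars → y ∉ keep t → t < t' → y ∉ (guard t').vars
  total : ∀ y ∉ φ.headVars, ∃ t, y ∈ (guard t).vars ∧ y ∉ keep t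

/-- The steps are the nodes of the join tree, leaves towards root, and the guard of a node is an
atom whose variables form its bag. A non-head variable is summed out at its top. -/
theorem SumProd.FreeConnexAcyclic.nonempty_plan {S : Schema} {T : Fin S.numIdb} {φ : SumProd S T}
    (h : φ.FreeConnexAcyclic) : Nonempty (Plan φ) := by
  classical
  obtain ⟨D, hjoin, r, hfc⟩ := h
  choose A hA hvars using hjoin
  -- The dual order sorts by decreasing distance from the root, so children precede their parents.
  let π := Tuple.sort fun t => OrderDual.toDual (D.tree.dist r t)
  have hπ : ∀ {s t : Fin D.numNodes}, s ≤ t → D.tree.dist r (π t) ≤ D.tree.dist r (π s) :=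
    fun hst => Tuple.monotone_sort (fun t => OrderDual.toDual (D.tree.dist r t)) hst
  let K (t : Fin D.numNodes) : Finset (Fin φ.numVars) :=
    (D.bag t).filter fun y => y ∈ φ.headVars ∨ ¬ D.IsTop r y t
  have hcov : ∀ i : Fin φ.body.length, ∃ t, (φ.body[i]).vars ⊆ D.bag t := fun i =>
    D.covers _ ⟨_, List.getElem_mem _, rfl⟩
  choose a ha using hcov
  -- A message that still contains a non-head variable fits into the bag of the parent.
  have hkey : ∀ t, ¬ K t ⊆ φ.headVars →
      ∃ u, D.tree.dist r t = D.tree.dist r u + 1 ∧ K t ⊆ D.bag u := by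
    intro t ht
    obtain ⟨y, hy, hyH⟩ := Finset.not_subset.1 ht
    obtain ⟨hyt, hyK⟩ := Finset.mem_filter.1 hy
    have hytop : ¬ D.IsTop r y t := hyK.resolve_left hyH
    obtain ⟨ty, hty⟩ := D.exists_isTop r y
    have hne : ty ≠ t := fun h => hytop (h ▸ hty)
    obtain ⟨u, hu, hd, -⟩ := D.exists_parent r hyt hty.1 hne (hty.2 t hyt)
    -- Here free-connexity is used: the top of the non-head variable `y` is a proper ancestor of
    -- `t`, so `t` is not the top of any head variable. For the other kept variables this is the
    -- definition of `K`.
    have hnt : ∀ z ∈ K t, ¬ D.IsTop r z t := by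
      intro z hz hztop
      by_cases hzH : z ∈ φ.headVars
      · exact hfc z hzH y hyH t ty hztop hty (hty.isAncestor hyt hne)
      · exact ((Finset.mem_filter.1 hz).2.resolve_left hzH) hztop
    refine ⟨u, hd, fun z hz => ?_⟩
    have hzt := (Finset.mem_filter.1 hz).1
    obtain ⟨tz, htz⟩ := D.exists_isTop r z
    obtain ⟨u', hu', hd', hzu'⟩ := D.exists_parent r hzt htz.1
      (fun h => hnt z hz (h ▸ htz)) (htz.2 t hzt)
    rwa [D.isTree.eq_of_dist_add_one r hu hu' hd hd']
  choose par hpard hparK using hkey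
  refine ⟨{
    numSteps := D.numNodes
    guard := fun t => A (π t)
    guard_mem := fun t => hA _
    keep := fun t => K (π t)
    keep_subset := fun t => by rw [hvars]; exact Finset.filter_subset _ _
    assign := fun i => π.symm (a i)
    vars_assign := fun i => by rw [hvars, Equiv.apply_symm_apply]; exact ha i
    -- A message in head variables only goes directly to the head, since the bag of the parent may
    -- lack some of them.
    target := fun t => if ht : K (π t) ⊆ φ.headVars then none else some (π.symm (par (π t) ht))
    lt_target := ?_
    keep_target := ?_
    keep_none := ?_
    head_keep := ?_
    later := ?_
    total := ?_ }⟩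
  · intro t p hp
    split at hp
    · cases hp
    · next ht =>
      obtain rfl := Option.some.inj hp
      by_contra hlt
      have := hπ (not_lt.1 hlt)
      rw [Equiv.apply_symm_apply] at this
      have := hpard _ ht
      omega
  · intro t p hp
    split at hp
    · cases hp
    · next ht =>
      obtain rfl := Option.some.inj hp
      rw [hvars, Equiv.apply_symm_apply]
      exact hparK _ ht
  · intro t ht
    split at ht
    · assumption
    · cases ht
  · intro t y hy hyH
    rw [hvars] at hy
    exact Finset.mem_filter.2 ⟨hy, Or.inl hyH⟩
  · intro t t' y hy hyK hlt hy'
    rw [hvars] at hy hy'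
    -- A variable that is dropped has its top here, and every other node that contains it is
    -- strictly farther from the root.
    have htop : D.IsTop r y (π t) := by
      by_contra hn
      exact hyK (Finset.mem_filter.2 ⟨hy, Or.inr hn⟩)
    have := π.injective (htop.eq_of_dist_le hy' (hπ hlt.le))
    omega
  · intro y hyH
    obtain ⟨t, ht⟩ := D.exists_isTop r y
    refine ⟨π.symm t, by rw [hvars, Equiv.apply_symm_apply]; exact ht.1, ?_⟩
    rw [Equiv.apply_symm_apply, Finset.mem_filter]
    rintro ⟨-, h | h⟩
    · exact hyH h
    · exact h ht

end Datalog

namespace Datalog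

/-! ### Elimination of variables -/

/-- The assignments of elements of `D` to the variables in `J`; the other variables are `0`. -/
def box {ℓ : ℕ} (D : Finset ℕ) (J : Finset (Fin ℓ)) : Finset (Fin ℓ → ℕ) :=
  Fintype.piFinset fun y => if y ∈ J then D else {0}

theorem mem_box {ℓ : ℕ} {D : Finset ℕ} {J : Finset (Fin ℓ)} {v : Fin ℓ → ℕ} :
    v ∈ box D J ↔ (∀ y ∈ J, v y ∈ D) ∧ ∀ y ∉ J, v y = 0 := by
  rw [box, Fintype.mem_piFinset]
  constructor
  · refine fun h => ⟨fun y hy => ?_, fun y hy => ?_⟩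
    · simpa [hy] using h y
    · simpa [hy] using h y
  · rintro ⟨h1, h2⟩ y
    by_cases hy : y ∈ J
    · simpa [hy] using h1 y hy
    · simpa [hy] using h2 y hy

/-- The value of the function depends only on the values of the variables in `J`. -/
def DependsOnly {ℓ : ℕ} {σ : Type*} (J : Finset (Fin ℓ)) (f : (Fin ℓ → ℕ) → σ) : Prop :=
  ∀ v w, (∀ y ∈ J, v y = w y) → f v = f w

theorem DependsOnly.mono {ℓ : ℕ} {σ : Type*} {J J' : Finset (Fin ℓ)} {f : (Fin ℓ → ℕ) → σ}
    (h : DependsOnly J f) (hJ : J ⊆ J') : DependsOnly J' f :=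
  fun v w hvw => h v w fun y hy => hvw y (hJ hy)

theorem DependsOnly.mul {ℓ : ℕ} {σ : Type*} [Mul σ] {J : Finset (Fin ℓ)}
    {f g : (Fin ℓ → ℕ) → σ} (hf : DependsOnly J f) (hg : DependsOnly J g) :
    DependsOnly J fun v => f v * g v :=
  fun v w hvw => by
    change f v * g v = f w * g w
    rw [hf v w hvw, hg v w hvw]

theorem DependsOnly.prod {ℓ : ℕ} {σ ι : Type*} [CommMonoid σ] {J : Finset (Fin ℓ)} {s : Finset ι}
    {f : ι → (Fin ℓ → ℕ) → σ} (hf : ∀ i ∈ s, DependsOnly J (f i)) :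
    DependsOnly J fun v => ∏ i ∈ s, f i v :=
  fun v w hvw => Finset.prod_congr rfl fun i hi => hf i hi v w hvw

/-- Summing out the variables in `J` outside `Z`, on which the rest does not depend. -/
theorem sum_box_eliminate {ℓ a : ℕ} {σ : Type*} [CommSemiring σ] {D : Finset ℕ}
    {V J Z : Finset (Fin ℓ)} (hJV : J ⊆ V) (hZJ : Z ⊆ J) {x : Fin a → Fin ℓ}
    (hx : ∀ j, x j ∈ J → x j ∈ Z) (c : Fin a → ℕ) {F R M : (Fin ℓ → ℕ) → σ}
    (hF : DependsOnly J F) (hR : DependsOnly (J \ Z)ᶜ R)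
    (hM : ∀ v, (∀ y ∈ Z, v y ∈ D) →
      M v = ∑ u ∈ box D J, if ∀ y ∈ Z, u y = v y then F u else 0) :
    ∑ w ∈ box D V with w ∘ x = c, F w * R w
      = ∑ w ∈ box D (V \ (J \ Z)) with w ∘ x = c, M w * R w := by
  classical
  -- The sum is split along the map that forgets the eliminated variables. Both the head condition
  -- and `R` are constant on its fibres.
  let ρ (w : Fin ℓ → ℕ) (y : Fin ℓ) : ℕ := if y ∈ J \ Z then 0 else w y
  have hxY : ∀ j, x j ∉ J \ Z := fun j h =>
    (Finset.mem_sdiff.1 h).2 (hx j (Finset.mem_sdiff.1 h).1)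
  have hmaps : ∀ w ∈ (box D V).filter (fun w => w ∘ x = c),
      ρ w ∈ (box D (V \ (J \ Z))).filter (fun w => w ∘ x = c) := by
    intro w hw
    obtain ⟨hw, hwc⟩ := Finset.mem_filter.1 hw
    obtain ⟨h1, h2⟩ := mem_box.1 hw
    refine Finset.mem_filter.2 ⟨mem_box.2 ⟨fun y hy => ?_, fun y hy => ?_⟩, ?_⟩
    · obtain ⟨hyV, hyY⟩ := Finset.mem_sdiff.1 hy
      simpa only [ρ, if_neg hyY] using h1 y hyV
    · by_cases hyY : y ∈ J \ Z
      · simp only [ρ, if_pos hyY]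
      · simp only [ρ, if_neg hyY]
        exact h2 y fun hyV => hy (Finset.mem_sdiff.2 ⟨hyV, hyY⟩)
    · rw [← hwc]
      funext j
      simp only [ρ, Function.comp_apply, if_neg (hxY j)]
  rw [← Finset.sum_fiberwise_of_maps_to hmaps]
  refine Finset.sum_congr rfl fun w' hw' => ?_
  obtain ⟨hw', hwc'⟩ := Finset.mem_filter.1 hw'
  obtain ⟨h1', h2'⟩ := mem_box.1 hw'
  have hZ' : ∀ y ∈ Z, y ∈ V \ (J \ Z) := fun y hy =>
    Finset.mem_sdiff.2 ⟨hJV (hZJ hy), fun h => (Finset.mem_sdiff.1 h).2 hy⟩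
  rw [hM w' fun y hy => h1' y (hZ' y hy), ← Finset.sum_filter, Finset.sum_mul]
  have hρ : ∀ {w : Fin ℓ → ℕ} {y : Fin ℓ}, ρ w = w' → y ∉ J \ Z → w y = w' y := by
    intro w y h hy
    rw [← h]
    simp only [ρ, if_neg hy]
  -- The fibre over `w'` corresponds to the assignments on `J` that agree with `w'` on `Z`: restrict
  -- to `J`, or fill up with `w'` outside `J`.
  refine Finset.sum_bij' (fun w _ y => if y ∈ J then w y else 0)
    (fun u _ y => if y ∈ J then u y else w' y) ?_ ?_ ?_ ?_ ?_
  · intro w hw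
    obtain ⟨hw, hwρ⟩ := Finset.mem_filter.1 hw
    obtain ⟨h1, h2⟩ := mem_box.1 (Finset.mem_filter.1 hw).1
    refine Finset.mem_filter.2 ⟨mem_box.2 ⟨fun y hy => ?_, fun y hy => if_neg hy⟩, fun y hy => ?_⟩
    · simpa only [if_pos hy] using h1 y (hJV hy)
    · simp only [if_pos (hZJ hy)]
      exact hρ hwρ fun h => (Finset.mem_sdiff.1 h).2 hy
  · intro u hu
    obtain ⟨hu, huZ⟩ := Finset.mem_filter.1 hu
    obtain ⟨h1, h2⟩ := mem_box.1 hu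
    refine Finset.mem_filter.2 ⟨Finset.mem_filter.2 ⟨mem_box.2 ⟨fun y hy => ?_, fun y hy => ?_⟩, ?_⟩,
      ?_⟩
    · by_cases hyJ : y ∈ J
      · simpa only [if_pos hyJ] using h1 y hyJ
      · simp only [if_neg hyJ]
        exact h1' y (Finset.mem_sdiff.2 ⟨hy, fun h => hyJ (Finset.mem_sdiff.1 h).1⟩)
    · have hyJ : y ∉ J := fun h => hy (hJV h)
      simp only [if_neg hyJ]
      exact h2' y fun h => hy (Finset.mem_sdiff.1 h).1
    · rw [← hwc']
      funext j
      simp only [Function.comp_apply]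
      split
      · next h => exact huZ _ (hx j h)
      · rfl
    · funext y
      simp only [ρ]
      split
      · next h => exact (h2' y fun h' => (Finset.mem_sdiff.1 h').2 h).symm
      · next h =>
        split
        · next hyJ =>
          refine huZ y ?_
          by_contra hyZ
          exact h (Finset.mem_sdiff.2 ⟨hyJ, hyZ⟩)
        · rfl
  · intro w hw
    obtain ⟨hw, hwρ⟩ := Finset.mem_filter.1 hw
    funext y
    by_cases hyJ : y ∈ J
    · simp only [if_pos hyJ]
    · simp only [if_neg hyJ]
      exact (hρ hwρ fun h => hyJ (Finset.mem_sdiff.1 h).1).symm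
  · intro u hu
    obtain ⟨h1, h2⟩ := mem_box.1 (Finset.mem_filter.1 hu).1
    funext y
    by_cases hyJ : y ∈ J
    · simp only [if_pos hyJ]
    · simp only [if_neg hyJ, h2 y hyJ]
  · intro w hw
    obtain ⟨hw, hwρ⟩ := Finset.mem_filter.1 hw
    congr 1
    · exact hF _ _ fun y hy => (if_pos hy).symm
    · exact hR _ _ fun y hy => hρ hwρ (Finset.mem_compl.1 hy)

/-! ### Elimination along a plan. -/

namespace Plan

variable {S : Schema} {T : Fin S.numIdb} {φ : SumProd S T} (π : Plan φ)

/-- The variables that remain before step `j`. -/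
def remaining (j : ℕ) : Finset (Fin φ.numVars) :=
  Finset.univ.filter fun y => ∀ t : Fin π.numSteps, t.val < j → y ∈ (π.guard t).vars → y ∈ π.keep t

theorem remaining_zero : π.remaining 0 = Finset.univ := by
  simp [remaining]

theorem remaining_numSteps : π.remaining π.numSteps = φ.headVars := by
  ext y
  simp only [remaining, Finset.mem_filter, Finset.mem_univ, true_and]
  constructor
  · intro h
    by_contra hy
    obtain ⟨t, ht, htk⟩ := π.total y hy
    exact htk (h t t.2 ht)
  · intro hy t _ ht
    exact π.head_keep t y ht hy

theorem guard_subset_remaining (t : Fin π.numSteps) : (π.guard t).vars ⊆ π.remaining t := by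
  intro y hy
  refine Finset.mem_filter.2 ⟨Finset.mem_univ _, fun s hs hys => ?_⟩
  by_contra hk
  exact π.later s t y hys hk hs hy

theorem remaining_succ (t : Fin π.numSteps) :
    π.remaining (t + 1) = π.remaining t \ ((π.guard t).vars \ π.keep t) := by
  ext y
  simp only [remaining, Finset.mem_filter, Finset.mem_univ, true_and, Finset.mem_sdiff, not_and,
    not_not]
  constructor
  · exact fun h => ⟨fun s hs => h s (by omega), h t (by omega)⟩
  · rintro ⟨h1, h2⟩ s hs
    rcases Nat.lt_succ_iff_lt_or_eq.1 hs with hs | hs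
    · exact h1 s hs
    · rw [Fin.ext hs]; exact h2

/-- Before each step the value is the sum, over the remaining variables, of the product of the atoms
not yet used, the later indicators and the messages not yet consumed. One step is an application of
`sum_box_eliminate`. The functions `χ` allow each step to range only over the tuples of its guard.
-/
theorem eliminate {σ : Type*} [CommSemiring σ] {D : Finset ℕ}
    {f : Fin φ.body.length → (Fin φ.numVars → ℕ) → σ} (hf : ∀ i, DependsOnly (φ.body[i]).vars (f i))
    {χ : Fin π.numSteps → (Fin φ.numVars → ℕ) → σ} (hχ : ∀ t, DependsOnly (π.guard t).vars (χ t))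
    {M : Fin π.numSteps → (Fin φ.numVars → ℕ) → σ} (hM : ∀ t, DependsOnly (π.keep t) (M t))
    (hrec : ∀ t v, (∀ y ∈ π.keep t, v y ∈ D) →
      M t v = ∑ u ∈ box D (π.guard t).vars, if ∀ y ∈ π.keep t, u y = v y then
        χ t u * (∏ i with π.assign i = t, f i u) * ∏ s with π.target s = some t, M s u else 0)
    (c : Fin (S.idbArity T) → ℕ) :
    ∑ w ∈ box D Finset.univ with w ∘ φ.head = c, (∏ i, f i w) * ∏ t, χ t w
      = ∑ w ∈ box D φ.headVars with w ∘ φ.head = c, ∏ s with π.target s = none, M s w := by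
  classical
  -- The messages sent but not consumed before step `j`. Those without a target remain to the end
  -- and form the result.
  let pend (j : ℕ) : Finset (Fin π.numSteps) :=
    Finset.univ.filter fun s => s.val < j ∧ ∀ p, π.target s = some p → j ≤ p.val
  let Q (j : ℕ) : σ := ∑ w ∈ box D (π.remaining j) with w ∘ φ.head = c,
    (∏ i with j ≤ (π.assign i).val, f i w) * (∏ s with j ≤ s.val, χ s w) * ∏ s ∈ pend j, M s w
  have hstep : ∀ t : Fin π.numSteps, Q t = Q (t + 1) := by
    intro t
    have hsplit1 : (Finset.univ.filter fun i => t.val ≤ (π.assign i).val)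
        = (Finset.univ.filter fun i => π.assign i = t) ∪
          Finset.univ.filter fun i => t.val + 1 ≤ (π.assign i).val := by
      ext i
      simp only [Finset.mem_filter, Finset.mem_univ, true_and, Finset.mem_union, Fin.ext_iff]
      omega
    have hdisj1 : Disjoint (Finset.univ.filter fun i => π.assign i = t)
        (Finset.univ.filter fun i => t.val + 1 ≤ (π.assign i).val) := by
      rw [Finset.disjoint_filter]
      intro i _ h
      rw [h]; omega
    have hsplit2 : (Finset.univ.filter fun s : Fin π.numSteps => t.val ≤ s.val)
        = insert t (Finset.univ.filter fun s => t.val + 1 ≤ s.val) := by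
      ext i
      simp only [Finset.mem_filter, Finset.mem_univ, true_and, Finset.mem_insert, Fin.ext_iff]
      omega
    let rest : Finset (Fin π.numSteps) :=
      Finset.univ.filter fun s => s.val < t ∧ ∀ p, π.target s = some p → t.val + 1 ≤ p.val
    have hsplit3 : pend t = (Finset.univ.filter fun s => π.target s = some t) ∪ rest := by
      ext s
      simp only [pend, rest, Finset.mem_filter, Finset.mem_univ, true_and, Finset.mem_union]
      constructor
      · rintro ⟨h1, h2⟩
        by_cases hs : π.target s = some t
        · exact Or.inl hs
        · refine Or.inr ⟨h1, fun p hp => ?_⟩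
          have := h2 p hp
          have : p ≠ t := fun h => hs (h ▸ hp)
          rw [Ne, Fin.ext_iff] at this
          omega
      · rintro (h | ⟨h1, h2⟩)
        · refine ⟨π.lt_target s t h, fun p hp => ?_⟩
          rw [h] at hp
          obtain rfl := Option.some.inj hp
          exact le_rfl
        · exact ⟨h1, fun p hp => by have := h2 p hp; omega⟩
    have hdisj3 : Disjoint (Finset.univ.filter fun s => π.target s = some t) rest := by
      rw [Finset.disjoint_filter]
      rintro s _ h ⟨_, h2⟩
      have := h2 t h
      omega
    have hsplit4 : pend (t + 1) = insert t rest := by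
      ext s
      simp only [pend, rest, Finset.mem_filter, Finset.mem_univ, true_and, Finset.mem_insert]
      constructor
      · rintro ⟨h1, h2⟩
        by_cases hs : s = t
        · exact Or.inl hs
        · rw [Fin.ext_iff] at hs
          exact Or.inr ⟨by omega, h2⟩
      · rintro (rfl | ⟨h1, h2⟩)
        · exact ⟨by omega, fun p hp => π.lt_target s p hp⟩
        · exact ⟨by omega, h2⟩
    let R (w : Fin φ.numVars → ℕ) : σ := (∏ i with t.val + 1 ≤ (π.assign i).val, f i w) *
      (∏ s with t.val + 1 ≤ s.val, χ s w) * ∏ s ∈ rest, M s w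
    -- By the field `later`, the variables dropped at `t` occur in no later guard, so the remaining
    -- factors do not depend on them.
    have hlater : ∀ s : Fin π.numSteps, t < s →
        (π.guard s).vars ⊆ ((π.guard t).vars \ π.keep t)ᶜ := by
      intro s hs y hy
      rw [Finset.mem_compl, Finset.mem_sdiff]
      exact fun h => π.later t s y h.1 h.2 hs hy
    have hR : DependsOnly ((π.guard t).vars \ π.keep t)ᶜ R := by
      refine (DependsOnly.mul (.prod fun i hi => ?_) (.prod fun s hs => ?_)).mul
        (.prod fun s hs => ?_)
      · exact (hf i).mono ((π.vars_assign i).trans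
          (hlater _ (Finset.mem_filter.1 hi).2))
      · exact (hχ s).mono (hlater s (Finset.mem_filter.1 hs).2)
      · refine (hM s).mono ?_
        obtain ⟨-, hst, hp⟩ := Finset.mem_filter.1 hs
        cases htg : π.target s with
        | some p => exact (π.keep_target s p htg).trans (hlater p (hp p htg))
        | none =>
          -- A message without a target involves head variables only, and these are never dropped.
          intro y hy
          rw [Finset.mem_compl, Finset.mem_sdiff]
          exact fun h => h.2 (π.head_keep t y h.1 (π.keep_none s htg hy))
    let F (w : Fin φ.numVars → ℕ) : σ :=
      χ t w * (∏ i with π.assign i = t, f i w) * ∏ s with π.target s = some t, M s w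
    have hF : DependsOnly (π.guard t).vars F := by
      refine ((hχ t).mul (.prod fun i hi => ?_)).mul (.prod fun s hs => ?_)
      · have := π.vars_assign i
        rw [(Finset.mem_filter.1 hi).2] at this
        exact (hf i).mono this
      · exact (hM s).mono (π.keep_target s t (Finset.mem_filter.1 hs).2)
    have hmain := sum_box_eliminate (D := D) (π.guard_subset_remaining t) (π.keep_subset t)
      (x := φ.head) (fun j hj => π.head_keep t _ hj (Finset.mem_image_of_mem _ (Finset.mem_univ j)))
      c hF hR (hrec t)
    rw [← remaining_succ] at hmain
    refine Eq.trans (Finset.sum_congr rfl fun w _ => ?_)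
      (hmain.trans (Finset.sum_congr rfl fun w _ => ?_))
    · rw [hsplit1, hsplit2, hsplit3, Finset.prod_union hdisj1, Finset.prod_union hdisj3,
        Finset.prod_insert (by simp)]
      simp only [F, R]
      ring
    · rw [hsplit4, Finset.prod_insert (by simp [rest])]
      simp only [R]
      ring
  have hall : ∀ j ≤ π.numSteps, Q 0 = Q j := by
    intro j
    induction j with
    | zero => intro _; rfl
    | succ j ih => intro hj; rw [ih (by omega)]; exact hstep ⟨j, hj⟩
  have h0 : Q 0 = ∑ w ∈ box D Finset.univ with w ∘ φ.head = c, (∏ i, f i w) * ∏ t, χ t w := by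
    simp only [Q, pend, π.remaining_zero]
    simp
  have hn : Q π.numSteps = ∑ w ∈ box D φ.headVars with w ∘ φ.head = c,
      ∏ s with π.target s = none, M s w := by
    have hp : pend π.numSteps = Finset.univ.filter fun s => π.target s = none := by
      ext s
      simp only [pend, Finset.mem_filter, Finset.mem_univ, true_and, s.2]
      cases π.target s with
      | none => simp
      | some p => simp
    have h1 : (Finset.univ.filter fun i => π.numSteps ≤ (π.assign i).val) = ∅ := by
      simp [Finset.filter_eq_empty_iff]
    have h2 : (Finset.univ.filter fun s : Fin π.numSteps => π.numSteps ≤ s.val) = ∅ := by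
      simp [Finset.filter_eq_empty_iff]
    simp only [Q, hp, π.remaining_numSteps, h1, h2, Finset.prod_empty, one_mul]
  rw [← h0, ← hn, hall _ le_rfl]

end Plan

end Datalog

namespace Datalog

/-! ### Tuples as assignments -/

/-- A position of a tuple of variables at which the variable occurs. -/
noncomputable def position {a ℓ : ℕ} (x : Fin a → Fin ℓ) (y : Fin ℓ) : ℕ :=
  open Classical in if h : ∃ j, x j = y then h.choose.val else 0

theorem exists_position_eq {a ℓ : ℕ} (x : Fin a → Fin ℓ) (j : Fin a) :
    ∃ j', position x (x j) = j'.val ∧ x j' = x j := by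
  have h : ∃ j', x j' = x j := ⟨j, rfl⟩
  exact ⟨h.choose, by rw [position, dif_pos h], h.choose_spec⟩

/-- The equations between positions that say that the tuple is constant on each variable. -/
noncomputable def consistency {a ℓ : ℕ} (x : Fin a → Fin ℓ) : List (ℕ × ℕ) :=
  (List.finRange a).map fun j => (j.val, position x (x j))

/-- The assignment that belongs to a tuple. -/
noncomputable def assignment {a ℓ : ℕ} (x : Fin a → Fin ℓ) (c : Fin a → ℕ) (y : Fin ℓ) : ℕ :=
  Source.extend c (position x y)

theorem assignment_comp {a ℓ : ℕ} {x : Fin a → Fin ℓ} {c : Fin a → ℕ} :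
    (∀ p ∈ consistency x, Source.extend c p.1 = Source.extend c p.2) ↔ assignment x c ∘ x = c := by
  rw [funext_iff]
  simp [consistency, assignment, Source.extend_val, eq_comm]

theorem assignment_eq {a ℓ : ℕ} (x : Fin a → Fin ℓ) (u : Fin ℓ → ℕ) (j : Fin a) :
    assignment x (u ∘ x) (x j) = u (x j) := by
  obtain ⟨j', h, hx⟩ := exists_position_eq x j
  rw [assignment, h, Source.extend_val, Function.comp_apply, hx]

/-- A tuple that passes the equality test is `u ∘ x` for exactly one assignment `u` on the variables
of `x`. The flag removes all other tuples. -/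
theorem sum_assignment {a ℓ : ℕ} {σ : Type*} [CommSemiring σ] {D : Finset ℕ} {x : Fin a → Fin ℓ}
    {t : Finset (Fin a → ℕ)} (ht : ∀ c ∈ t, ∀ j, c j ∈ D) {F : (Fin ℓ → ℕ) → σ}
    (hF : DependsOnly (Finset.univ.image x) F) :
    ∑ c ∈ t, (if ∀ p ∈ consistency x, Source.extend c p.1 = Source.extend c p.2 then 1 else 0) *
        F (assignment x c)
      = ∑ u ∈ box D (Finset.univ.image x), if u ∘ x ∈ t then F u else 0 := by
  have hmem : ∀ j, x j ∈ Finset.univ.image x := fun j =>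
    Finset.mem_image_of_mem _ (Finset.mem_univ j)
  simp only [assignment_comp, ite_mul, one_mul, zero_mul]
  rw [← Finset.sum_filter, ← Finset.sum_filter]
  refine Finset.sum_bij' (fun c _ y => if y ∈ Finset.univ.image x then assignment x c y else 0)
    (fun u _ => u ∘ x) ?_ ?_ ?_ ?_ ?_
  · intro c hc
    obtain ⟨hc, hcx⟩ := Finset.mem_filter.1 hc
    have : (fun y => if y ∈ Finset.univ.image x then assignment x c y else 0) ∘ x = c := by
      rw [← hcx]
      funext j
      simp only [Function.comp_apply, if_pos (hmem j)]
      rw [hcx]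
    refine Finset.mem_filter.2 ⟨mem_box.2 ⟨fun y hy => ?_, fun y hy => if_neg hy⟩, ?_⟩
    · obtain ⟨j, -, rfl⟩ := Finset.mem_image.1 hy
      exact (congrArg (· ∈ D) (congrFun this j)).mpr (ht c hc j)
    · rwa [this]
  · intro u hu
    obtain ⟨hu, hut⟩ := Finset.mem_filter.1 hu
    exact Finset.mem_filter.2 ⟨hut, funext fun j => assignment_eq x u j⟩
  · intro c hc
    obtain ⟨hc, hcx⟩ := Finset.mem_filter.1 hc
    funext j
    simp only [Function.comp_apply, if_pos (hmem j)]
    exact congrFun hcx j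
  · intro u hu
    obtain ⟨hu, hut⟩ := Finset.mem_filter.1 hu
    funext y
    by_cases hy : y ∈ Finset.univ.image x
    · rw [if_pos hy]
      obtain ⟨j, -, rfl⟩ := Finset.mem_image.1 hy
      exact assignment_eq x u j
    · rw [if_neg hy, (mem_box.1 hu).2 y hy]
  · intro c hc
    exact hF _ _ fun y hy => (if_pos hy).symm

/-- Constants are digits to base `N`, so different keys receive different array cells. -/
theorem ofDigits_map_inj {ℓ N : ℕ} {J : Finset (Fin ℓ)} {u v : Fin ℓ → ℕ} (hN : 1 < N)
    (hu : ∀ y ∈ J, u y < N) (hv : ∀ y ∈ J, v y < N) :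
    Nat.ofDigits N (J.toList.map u) = Nat.ofDigits N (J.toList.map v) ↔ ∀ y ∈ J, u y = v y := by
  constructor
  · intro h
    have := Nat.ofDigits_inj_of_len_eq hN (by simp) (by simpa using hu) (by simpa using hv) h
    simpa using this
  · intro h
    congr 1
    exact List.map_congr_left (by simpa using h)

/-! ### The layout of a program -/

section Atom

variable {S : Schema} {ℓ : ℕ}

/-- The tuples that an atom can match. -/
def Atom.source : Atom S ℓ → Source S
  | .edb R _ => .edb R
  | .idb T _ => .idb T

/-- The arguments of an atom. -/
def Atom.args : (B : Atom S ℓ) → Fin B.source.arity → Fin ℓ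
  | .edb _ x => x
  | .idb _ x => x

theorem Atom.image_args (B : Atom S ℓ) : Finset.univ.image B.args = B.vars := by
  cases B <;> rfl

theorem Atom.dependsOnly_eval {σ : Type*} (e : (R : Fin S.numEdb) → (Fin (S.edbArity R) → ℕ) → σ)
    (h : (T : Fin S.numIdb) → (Fin (S.idbArity T) → ℕ) → σ) (B : Atom S ℓ) :
    DependsOnly B.vars fun v => B.eval e h v := by
  intro v w hvw
  have hj : ∀ {a : ℕ} (x : Fin a → Fin ℓ), (∀ y ∈ Finset.univ.image x, v y = w y) →
      v ∘ x = w ∘ x := fun x hx =>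
    funext fun j => hx _ (Finset.mem_image_of_mem _ (Finset.mem_univ j))
  cases B with
  | edb R x => simp only [Atom.eval, hj x hvw]
  | idb T x => simp only [Atom.eval, hj x hvw]

/-- The factor that an atom becomes for the tuples over the given variables. -/
noncomputable def Atom.factor {ι : Type} {a : ℕ} (x : Fin a → Fin ℓ) : Atom S ℓ → Factor S ι
  | .edb R p => .edb R fun j => position x (p j)
  | .idb T p => .idb T fun j => position x (p j)

/-- The product of atoms and messages, for the tuples over the given variables. -/
noncomputable def productTerm {ι : Type} {a : ℕ} (x : Fin a → Fin ℓ) (atoms : List (Atom S ℓ))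
    (msgs : List (ι × Finset (Fin ℓ))) : Term S ι where
  eqs := consistency x
  factors := atoms.map (Atom.factor x) ++
    msgs.map fun m => .msg m.1 (m.2.toList.map (position x))

/-- The message of a block at the values of some variables. -/
noncomputable def Layout.messageAt {ι : Type} {σ : Type*} (A : Layout S ι) (I : Instance S)
    (g : GroundVar → σ) (m : ι × Finset (Fin ℓ)) (v : Fin ℓ → ℕ) : σ :=
  A.message I g m.1 (Nat.ofDigits I.radix (m.2.toList.map v))

theorem Layout.dependsOnly_messageAt {ι : Type} {σ : Type*} (A : Layout S ι)
    (I : Instance S) (g : GroundVar → σ) (m : ι × Finset (Fin ℓ)) :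
    DependsOnly m.2 (A.messageAt I g m) := by
  intro v w hvw
  have : m.2.toList.map v = m.2.toList.map w := List.map_congr_left (by simpa using hvw)
  rw [messageAt, messageAt, this]

/-- Key positions refer to the tuple, so the number of the key of a message is computed from the
values of its variables under `assignment x c`. -/
theorem Layout.termValue_productTerm {ι : Type} {σ : Type*} [CommSemiring σ] (A : Layout S ι)
    (I : Instance S) (e : (R : Fin S.numEdb) → (Fin (S.edbArity R) → ℕ) → σ) (g : GroundVar → σ)
    {a : ℕ} (x : Fin a → Fin ℓ) (atoms : List (Atom S ℓ)) (msgs : List (ι × Finset (Fin ℓ)))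
    (c : Fin a → ℕ) :
    A.termValue I e g (Source.extend c) (productTerm x atoms msgs)
      = (if ∀ p ∈ consistency x, Source.extend c p.1 = Source.extend c p.2 then 1 else 0) *
        ((atoms.map fun B => B.eval e (atomValues g) (assignment x c)).prod *
          (msgs.map fun m => A.messageAt I g m (assignment x c)).prod) := by
  rw [termValue, productTerm]
  simp only [List.map_append, List.prod_append, List.map_map]
  refine congrArg₂ _ rfl (congrArg₂ _ (congrArg List.prod ?_) (congrArg List.prod ?_))
  · refine List.map_congr_left fun B _ => ?_
    cases B <;> rfl
  · refine List.map_congr_left fun m _ => ?_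
    simp only [Function.comp_apply, groundFactor, Sum.elim_inr, messageAt, message, keyCode,
      List.map_map]
    rfl

end Atom

/-! ### The layout that follows the plans. -/

section Program

variable {S : Schema} (P : Program S)

/-- The blocks of the layout of a program: the steps of all plans, and the IDB predicates. -/
abbrev Program.Node (π : ∀ T (r : Fin (P.rules T).length), Plan ((P.rules T).get r)) : Type :=
  (Σ T, Σ r, Fin (π T r).numSteps) ⊕ Fin S.numIdb

variable {P} (π : ∀ T (r : Fin (P.rules T).length), Plan ((P.rules T).get r))

/-- The message of a step of a plan. -/
def Program.msg (T : Fin S.numIdb) (r : Fin (P.rules T).length) (t : Fin (π T r).numSteps) :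
    P.Node π × Finset (Fin ((P.rules T).get r).numVars) :=
  (.inl ⟨T, r, t⟩, (π T r).keep t)

/-- The term of a step of a plan. -/
noncomputable def Program.stepTerm (T : Fin S.numIdb) (r : Fin (P.rules T).length)
    (t : Fin (π T r).numSteps) : Term S (P.Node π) :=
  productTerm ((π T r).guard t).args
    ((Finset.univ.filter fun i => (π T r).assign i = t).toList.map
      fun i => ((P.rules T).get r).body[i])
    ((Finset.univ.filter fun s => (π T r).target s = some t).toList.map (Program.msg π T r))

/-- The term that collects the results of a plan. -/
noncomputable def Program.headTerm (T : Fin S.numIdb) (r : Fin (P.rules T).length) :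
    Term S (P.Node π) :=
  productTerm ((P.rules T).get r).head []
    ((Finset.univ.filter fun s => (π T r).target s = none).toList.map (Program.msg π T r))

/-- The blocks of the grounding that follows the plans. -/
noncomputable def Program.layout : Layout S (P.Node π) where
  id s := (Fintype.equivFin _ s).val
  blk
    | .inl ⟨T, r, t⟩ => .chain ((π T r).guard t).source
        (((π T r).keep t).toList.map (position ((π T r).guard t).args)) [Program.stepTerm π T r t]
    | .inr T => .head T ((List.finRange (P.rules T).length).map (Program.headTerm π T))

/-- The later a block can be written, the higher its rank. -/
def Program.rank : P.Node π → WithTop ℕ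
  | .inl ⟨_, _, t⟩ => (t.val : WithTop ℕ)
  | .inr _ => ⊤

theorem exists_order {ι α : Type*} [Fintype ι] [LinearOrder α] (ρ : ι → α) :
    ∃ order : List ι, order.Nodup ∧ (∀ s, s ∈ order) ∧ ∀ u s v, order = u ++ s :: v →
      s ∉ u ∧ ∀ s', ρ s' < ρ s → s' ∈ u := by
  classical
  have hperm := List.mergeSort_perm (Finset.univ : Finset ι).toList fun a b => decide (ρ a ≤ ρ b)
  have hsort := List.pairwise_mergeSort (le := fun a b => decide (ρ a ≤ ρ b))
    (fun a b c => by simpa using le_trans) (fun a b => by simpa using le_total _ _)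
    (Finset.univ : Finset ι).toList
  have hnd := hperm.nodup_iff.2 (Finset.nodup_toList _)
  have hmem : ∀ s : ι, s ∈ (Finset.univ : Finset ι).toList.mergeSort fun a b => ρ a ≤ ρ b :=
    fun s => hperm.mem_iff.2 (by simp)
  refine ⟨_, hnd, hmem, fun u s v h => ?_⟩
  rw [h] at hnd hsort hmem
  rw [List.pairwise_append, List.pairwise_cons] at hsort
  refine ⟨fun hs => (List.nodup_append.1 hnd).2.2 s hs s (by simp) rfl, fun s' hs' => ?_⟩
  rcases List.mem_append.1 (hmem s') with h' | h'
  · exact h'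
  · rcases List.mem_cons.1 h' with rfl | h'
    · exact absurd hs' (lt_irrefl _)
    · exact absurd hs' (not_lt.2 (by simpa using hsort.2.1.1 s' h'))

/-- There are finitely many blocks, so one width bounds all arities and all numbers of variables.
References go to smaller ranks: messages go to later steps of the same plan, and heads have rank
`⊤`. -/
theorem Program.exists_width :
    ∃ w, 1 ≤ w ∧ ∀ (u : List (P.Node π)) (s : P.Node π),
      (∀ s', Program.rank π s' < Program.rank π s → s' ∈ u) →
        ((Program.layout π).blk s).Fits w u := by
  obtain ⟨w₁, h₁⟩ := (Set.finite_range fun s : P.Node π =>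
    ((Program.layout π).blk s).src.arity).bddAbove
  obtain ⟨w₂, h₂⟩ := (Set.finite_range fun s : Σ T, Fin (P.rules T).length =>
    ((P.rules s.1).get s.2).numVars).bddAbove
  have hlen : ∀ T r (J : Finset (Fin ((P.rules T).get r).numVars)) (f : _ → ℕ),
      (J.toList.map f).length ≤ w₁ + w₂ + 1 := by
    intro T r J f
    have h := J.card_le_univ
    have h' := h₂ ⟨⟨T, r⟩, rfl⟩
    simp only [Fintype.card_fin] at h
    simp only [List.length_map, Finset.length_toList]
    simp only at h'
    omega
  refine ⟨w₁ + w₂ + 1, by omega, fun u s hs => ⟨?_, ?_, ?_⟩⟩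
  · have := h₁ ⟨s, rfl⟩
    simp only at this
    omega
  · intro src key terms h
    rcases s with ⟨T, r, t⟩ | T
    · injection h with h1 h2 h3
      rw [← h2]
      exact hlen T r _ _
    · exact absurd h (by simp [layout])
  · rcases s with ⟨T, r, t⟩ | T
    · intro τ hτ f hf
      obtain rfl := List.mem_singleton.1 hτ
      rcases List.mem_append.1 hf with hf | hf
      · obtain ⟨B, -, rfl⟩ := List.mem_map.1 hf
        cases B <;> trivial
      · obtain ⟨m, hm, rfl⟩ := List.mem_map.1 hf
        obtain ⟨t', ht', rfl⟩ := List.mem_map.1 hm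
        rw [Finset.mem_toList, Finset.mem_filter] at ht'
        refine ⟨hs _ ?_, hlen T r _ _⟩
        exact WithTop.coe_lt_coe.2 ((π T r).lt_target t' t ht'.2)
    · intro τ hτ f hf
      obtain ⟨r, -, rfl⟩ := List.mem_map.1 hτ
      rcases List.mem_append.1 hf with hf | hf
      · simp at hf
      · obtain ⟨m, hm, rfl⟩ := List.mem_map.1 hf
        obtain ⟨t', -, rfl⟩ := List.mem_map.1 hm
        exact ⟨hs _ (WithTop.coe_lt_top _), hlen T r _ _⟩

/-! ### The equations of the grounding -/

theorem Instance.lt_radix {I : Instance S} {a : ℕ} (ha : a ∈ I.adom) : a < I.radix := by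
  rw [← I.toFinset_domList, List.mem_toFinset] at ha
  have := I.le_maxWord_of_mem_domList ha
  rw [Instance.radix]
  omega

variable {I : Instance S} {σ : Type*} [CommSemiring σ] {order : List (P.Node π)} {G : Grounding S}
  {g : GroundVar → σ}

/-- This is the recursion that `Plan.eliminate` requires. Tuples of the guard become assignments by
`sum_assignment`, and equality of key numbers becomes agreement on the kept variables by
`ofDigits_map_inj`. -/
theorem Program.messageAt_eq {e : (R : Fin S.numEdb) → (Fin (S.edbArity R) → ℕ) → σ}
    (hord : ∀ s, s ∈ order)
    (hG : G.eqs = (Program.layout π).eqs I I.domList I.radix order)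
    (hg : ∀ x : GroundVar, S.numIdb ≤ x.1 → g x = G.ico e g x)
    (T : Fin S.numIdb) (r : Fin (P.rules T).length) (t : Fin (π T r).numSteps)
    (v : Fin ((P.rules T).get r).numVars → ℕ) (hv : ∀ y ∈ (π T r).keep t, v y ∈ I.adom) :
    (Program.layout π).messageAt I g (Program.msg π T r t) v
      = ∑ u ∈ box I.adom ((π T r).guard t).vars, if ∀ y ∈ (π T r).keep t, u y = v y then
        (if u ∘ ((π T r).guard t).args ∈ ((π T r).guard t).source.tuples I then 1 else 0) *
        (∏ i with (π T r).assign i = t, (((P.rules T).get r).body[i]).eval e (atomValues g) u) *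
        ∏ s with (π T r).target s = some t,
          (Program.layout π).messageAt I g (Program.msg π T r s) u else 0 := by
  set J := ((π T r).guard t).vars with hJ
  set κ := Nat.ofDigits I.radix (((π T r).keep t).toList.map v) with hκ
  let F₀ (u : Fin ((P.rules T).get r).numVars → ℕ) : σ :=
    (∏ i with (π T r).assign i = t, (((P.rules T).get r).body[i]).eval e (atomValues g) u) *
      ∏ s with (π T r).target s = some t,
        (Program.layout π).messageAt I g (Program.msg π T r s) u
  have hF₀ : DependsOnly J F₀ := by
    refine DependsOnly.mul (.prod fun i hi => ?_) (.prod fun s hs => ?_)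
    · have := (π T r).vars_assign i
      rw [(Finset.mem_filter.1 hi).2] at this
      exact (Atom.dependsOnly_eval e (atomValues g) _).mono this
    · exact (Layout.dependsOnly_messageAt _ I g _).mono
        ((π T r).keep_target s t (Finset.mem_filter.1 hs).2)
  -- The key condition is made part of the summand, which still depends only on the guard because
  -- the kept variables belong to it.
  let F (u : Fin ((P.rules T).get r).numVars → ℕ) : σ :=
    if Nat.ofDigits I.radix (((π T r).keep t).toList.map u) = κ then F₀ u else 0
  have hF : DependsOnly (Finset.univ.image ((π T r).guard t).args) F := by
    rw [Atom.image_args]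
    intro u w huw
    have h1 : ((π T r).keep t).toList.map u = ((π T r).keep t).toList.map w :=
      List.map_congr_left fun y hy => huw y ((π T r).keep_subset t (Finset.mem_toList.1 hy))
    simp only [F, h1, hF₀ u w huw]
  have h := Layout.message_eq hG hg (hord (.inl ⟨T, r, t⟩)) rfl κ
  refine h.trans (Eq.trans (Finset.sum_congr rfl fun c _ => ?_)
    ((sum_assignment (fun c hc => Source.mem_adom_of_mem_tuples I hc) hF).trans ?_))
  · rw [List.map_singleton, List.sum_singleton, stepTerm, Layout.termValue_productTerm, keyCode,
      List.map_map]
    simp only [F, F₀, List.map_map, Finset.prod_map_toList, Function.comp_def]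
    rw [mul_ite, mul_zero]
    rfl
  · rw [Atom.image_args]
    refine Finset.sum_congr rfl fun u hu => ?_
    have hiff := ofDigits_map_inj (two_le_radix I) (J := (π T r).keep t)
      (fun y hy => Instance.lt_radix ((mem_box.1 hu).1 y ((π T r).keep_subset t hy)))
      (fun y hy => Instance.lt_radix (hv y hy))
    simp only [F, F₀, hκ, hiff]
    split_ifs <;> simp

/-- The head term multiplies the messages that have no target, which is the right-hand side of
`Plan.eliminate`. -/
theorem Program.termValue_headTerm {ann : (R : Fin S.numEdb) → (Fin (S.edbArity R) → ℕ) → σ}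
    (hord : ∀ s, s ∈ order)
    (hG : G.eqs = (Program.layout π).eqs I I.domList I.radix order)
    (hg : ∀ x : GroundVar, S.numIdb ≤ x.1 → g x = G.ico (I.value ann) g x)
    (T : Fin S.numIdb) (r : Fin (P.rules T).length) (c : Fin (S.idbArity T) → ℕ)
    (hc : ∀ j, c j ∈ I.adom) :
    (Program.layout π).termValue I (I.value ann) g (Source.extend c) (Program.headTerm π T r)
      = ((P.rules T).get r).eval I ann (atomValues g) c := by
  set φ := (P.rules T).get r with hφ
  have hhead : (Program.layout π).termValue I (I.value ann) g (Source.extend c)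
      (Program.headTerm π T r) = ∑ w ∈ box I.adom φ.headVars with w ∘ φ.head = c,
        ∏ s with (π T r).target s = none,
          (Program.layout π).messageAt I g (Program.msg π T r s) w := by
    -- A fixed head tuple is treated as a sum over a singleton; the flag accounts for repeated head
    -- variables.
    have := sum_assignment (D := I.adom) (x := φ.head) (t := {c}) (σ := σ)
      (F := fun w => ∏ s with (π T r).target s = none,
          (Program.layout π).messageAt I g (Program.msg π T r s) w)
      (by simpa using hc)
      (.prod fun s hs => (Layout.dependsOnly_messageAt _ I g _).mono
        ((π T r).keep_none s (Finset.mem_filter.1 hs).2))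
    rw [Finset.sum_singleton] at this
    rw [headTerm, Layout.termValue_productTerm]
    simp only [List.map_nil, List.prod_nil, one_mul, List.map_map, Finset.prod_map_toList,
      Function.comp_def]
    rw [Finset.sum_filter]
    simp only [Finset.mem_singleton] at this
    exact this
  let χ (t : Fin (π T r).numSteps) (w : Fin φ.numVars → ℕ) : σ :=
    if w ∘ ((π T r).guard t).args ∈ ((π T r).guard t).source.tuples I then 1 else 0
  have hχ : ∀ t, DependsOnly ((π T r).guard t).vars (χ t) := by
    intro t v w hvw
    have : v ∘ ((π T r).guard t).args = w ∘ ((π T r).guard t).args := by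
      funext j
      refine hvw _ ?_
      rw [← Atom.image_args]
      exact Finset.mem_image_of_mem _ (Finset.mem_univ j)
    simp only [χ, this]
  rw [hhead, ← (π T r).eliminate
    (f := fun i w => (φ.body[i]).eval (I.value ann) (atomValues g) w)
    (fun i => Atom.dependsOnly_eval _ _ _) hχ
    (M := fun t => (Program.layout π).messageAt I g (Program.msg π T r t))
    (fun t => Layout.dependsOnly_messageAt _ I g (Program.msg π T r t))
    (fun t v hv => Program.messageAt_eq π hord hG hg T r t v hv), SumProd.eval]
  have hbox : box I.adom (Finset.univ : Finset (Fin φ.numVars))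
      = Fintype.piFinset fun _ => I.adom := by simp [box]
  rw [hbox]
  refine Finset.sum_congr rfl fun w hw => ?_
  have hw := Fintype.mem_piFinset.1 (Finset.mem_filter.1 hw).1
  have hprod : (φ.body.map fun B => B.eval (I.value ann) (atomValues g) w).prod
      = ∏ i : Fin φ.body.length, (φ.body[i]).eval (I.value ann) (atomValues g) w := by
    rw [← List.prod_ofFn]
    congr 1
    exact (List.ofFn_getElem_eq_map φ.body _).symm
  rw [hprod]
  -- The indicators change nothing, since each guard is itself an atom of the body: where an EDB
  -- indicator vanishes, so does that atom. Over the active domain an IDB indicator is always 1.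
  by_cases h1 : ∀ t, w ∘ ((π T r).guard t).args ∈ ((π T r).guard t).source.tuples I
  · rw [Finset.prod_eq_one (s := Finset.univ) (f := fun t => χ t w) fun t _ => if_pos (h1 t),
      mul_one]
  · push Not at h1
    obtain ⟨t, ht⟩ := h1
    obtain ⟨i, hi, hit⟩ := List.getElem_of_mem ((π T r).guard_mem t)
    have h0 : (φ.body[i]).eval (I.value ann) (atomValues g) w = 0 := by
      rw [hit]
      revert ht
      cases (π T r).guard t with
      | edb R x =>
        intro ht
        exact if_neg fun h => ht (List.mem_toFinset.2 h)
      | idb T x =>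
        intro ht
        exact absurd (Fintype.mem_piFinset.2 fun j => hw _) ht
    rw [Finset.prod_eq_zero (Finset.mem_univ (⟨i, hi⟩ : Fin φ.body.length)) h0, zero_mul]

/-- Only the equations of the new predicates are assumed to be solved by `g`. The IDB atoms keep
arbitrary values, as the comparison of least fixpoints demands. -/
theorem Program.ico_layout {ann : (R : Fin S.numEdb) → (Fin (S.edbArity R) → ℕ) → σ}
    (hord : ∀ s, s ∈ order)
    (hG : G.eqs = (Program.layout π).eqs I I.domList I.radix order)
    (hg : ∀ x : GroundVar, S.numIdb ≤ x.1 → g x = G.ico (I.value ann) g x)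
    (T : Fin S.numIdb) (c : Fin (S.idbArity T) → ℕ) :
    G.ico (I.value ann) g (T.val, List.ofFn c) = P.ico I ann (atomValues g) T c := by
  rw [Program.ico]
  by_cases hc : ∀ j, c j ∈ I.adom
  · rw [Layout.ico_head hG hg (hord (.inr T)) rfl hc, List.map_map]
    have : ∀ r, ((Program.layout π).termValue I (I.value ann) g (Source.extend c) ∘
        Program.headTerm π T) r = ((P.rules T).get r).eval I ann (atomValues g) c :=
      fun r => Program.termValue_headTerm π hord hG hg T r c hc
    rw [List.map_congr_left fun r _ => this r]
    conv_rhs => rw [← List.ofFn_getElem_eq_map, List.ofFn_eq_map]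
    rfl
  · rw [Layout.ico_head_of_not_mem hG hc]
    refine (List.sum_eq_zero fun z hz => ?_).symm
    obtain ⟨φ, -, rfl⟩ := List.mem_map.1 hz
    refine Finset.sum_eq_zero fun v hv => absurd (fun j => ?_) hc
    obtain ⟨hv', rfl⟩ := Finset.mem_filter.1 hv
    exact Fintype.mem_piFinset.1 hv' _

end Program

end Datalog

/-! ### The proposition. -/

theorem mainTheorem7 (S : Datalog.Schema) (P : Datalog.Program S) (k : ℕ)
    (hP : P.RulewiseFreeConnexAcyclic) (hk : P.arity ≤ k) :
    ∃ (M : List Datalog.RAM.Instr) (C : ℕ), ∀ d : ℕ, ∃ b : ℕ, ∀ I : Datalog.Instance S,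
      (∀ a ∈ I.adom, a < (I.size + 2) ^ d) →
      ∃ G : Datalog.Grounding S,
        G.size ≤ C * (I.size + I.adom.card ^ k + 1) ∧
        Datalog.RAM.Computes M I.encode G.encode
          (C * (I.size + I.adom.card ^ k + 1)) ((I.size + 2) ^ b) ∧
        ∀ (σ : Type*) [CommSemiring σ] [OmegaCompletePartialOrder σ] [CanonicallyOrderedAdd σ],
          (∀ a : σ, OmegaCompletePartialOrder.ωScottContinuous fun x => a + x) →
          (∀ a : σ, OmegaCompletePartialOrder.ωScottContinuous fun x => a * x) →
          Datalog.SigmaEquivalent P I G σ := by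
  have hplan : ∀ T (r : Fin (P.rules T).length), Nonempty (Datalog.Plan ((P.rules T).get r)) :=
    fun T r => (hP T _ (List.get_mem _ r)).nonempty_plan
  -- The plans, the order and the width are chosen before any instance is given, so the machine and
  -- the constant depend on the program and `k` only.
  let π T r := (hplan T r).some
  obtain ⟨order, hnd, hmem, hord⟩ := Datalog.exists_order (Datalog.Program.rank π)
  obtain ⟨w, hw, hfits⟩ := Datalog.Program.exists_width π
  have hid : Function.Injective (Datalog.Program.layout π).id :=
    Fin.val_injective.comp (Fintype.equivFin _).injective
  obtain ⟨M, C, hMC⟩ := Datalog.Layout.exists_computes hid hw order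
    (fun u s v h => ⟨(hord u s v h).1, hfits u s (hord u s v h).2⟩)
    (fun T => (Finset.le_sup (f := S.idbArity) (Finset.mem_univ T)).trans hk)
  refine ⟨M, C, fun d => ?_⟩
  obtain ⟨b, hb⟩ := hMC d
  refine ⟨b, fun I hI => ?_⟩
  have hhead : ∀ s s' T l l', (Datalog.Program.layout π).blk s = .head T l →
      (Datalog.Program.layout π).blk s' = .head T l' → s = s' := by
    rintro (s | T₁) (s' | T₂) T l l' h h'
    · cases h
    · cases h
    · cases h'
    · cases h
      cases h'
      rfl
  let G : Datalog.Grounding S :=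
    ⟨_, Datalog.Layout.eqs_nodup hid hhead I hnd⟩
  have hc : Datalog.RAM.Computes M I.encode G.encode _ _ := hb I hI
  -- The size bound is the time bound, by way of the length of the output.
  exact ⟨G, G.size_le_encode_length.trans hc.length_le, hc, fun σ _ _ _ hadd hmul =>
    Datalog.sigmaEquivalent_of_ico_eq ⟨hadd, hmul⟩ fun ann g hg T c =>
      Datalog.Program.ico_layout π hmem rfl hg T c⟩
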